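/- Let $R$ be either the ring of Eisenstein integers $\mathbb E=\mathbb Z[e^{2\pi i/3}]$ or the ring of Gaussian integers $\mathbb G=\mathbb Z[i]$. A \emph{primitive lax vector} is a pair $(x,y)\in R^2$ of coprime elements, modulo $(x,y)\sim(\epsilon x,\epsilon y)$ for $\epsilon\in R^\times$. A \emph{lax basis} is an unordered pair of primitive lax vectors whose representatives form an $R$-basis of $R^2$. A \emph{lax superbasis} is an unordered triple of distinct primitive lax vectors, any two of which form a lax basis. For $R=\mathbb E$, a \emph{lax tetrabasis} is an unordered quadruple of distinct primitive lax vectors, any three of which form a lax superbasis. For $R=\mathbb G$, a \emph{lax cubasis} is a set of three two-element sets $\{\{u_1,u_2\},\{v_1,v_2\},\{w_1,w_2\}\}$ of primitive lax vectors such that $\{u_i,v_j,w_k\}$ is a lax superbasis for all $i,j,k\in\{1,2\}$. The \emph{topograph} of $R^2$ is the incidence geometry with four types of elements: cells (primitive lax vectors), faces (lax bases), edges (lax superbases) and points (lax tetrabases if $R=\mathbb E$, lax cubases if $R=\mathbb G$). Incidence is containment; a lax vector, basis or superbasis is contained in a cubasis if all its lax vectors lie in the union of the three two-element sets. The group $PSL_2(R)$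 acts on the topograph through its natural action on $R^2$. Let $W$ be the Coxeter group of type $(a,b,c)$, generated by $S=\{s_0,s_1,s_2,s_3\}$ with relations $s_i^2=1$, $(s_0s_1)^a=(s_1s_2)^b=(s_2s_3)^c=1$, and $s_is_j=s_js_i$ for $|i-j|\ge 2$. Let $W^+$ be its even subgroup. For $T\subset S$ let $W_T=\langle T\rangle$. In the Coxeter geometry of type $(a,b,c)$ the flags of type $T$ are the cosets $wW_T\in W/W_T$; two flags are incident if the cosets intersect, and $W$ acts by left multiplication. Index the cells, faces, edges and points of a topograph by $s_0,s_1,s_2,s_3$, respectively. A \emph{flag of type $T$} in the topograph is a family consisting of one element for each node in $S\setminus T$, pairwise incident. Two such flags are incident if each element of the first is incident with each element of the second, where elements of the same type are incident only if they are equal. \textbf{Theorem.} Let $(R,W)$ be $\mathbb E$ together with the Coxeter group of type $(3,3,6)$, or $\mathbb G$ together with the Coxeter group of type $(3,4,4)$. Then there is an injective homomorphism $\iota\colon PSL_2(R)\hookrightarrow W$, whose image is a subgroup of index two in $W^+$, and there are bijections, one for each $T\subset S$, $$\Phi_T\colon\{\text{flags of type } T \text{ in the topograph of } R^2\}\longrightarrow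 W/W_T,$$ such that \begin{enumerate} \item for all flags $x$ of type $T$ and $x'$ of type $T'$ in the topograph, $x$ and $x'$ are incident if and only if the cosets $\Phi_T(x)$ and $\Phi_{T'}(x')$ intersect; \item $\Phi_T(g\cdot x)=\iota(g)\cdot\Phi_T(x)$ for all $g\in PSL_2(R)$ and all flags $x$ of type $T$. \end{enumerate} That is, the topographs for $\mathbb E^2$ and $\mathbb G^2$ are equivariantly isomorphic to the Coxeter geometries of types $(3,3,6)$ and $(3,4,4)$, respectively. -/

import Mathlib

open scoped Pointwise MatrixGroups

noncomputable section

/-! ### Incidence geometries of rank four with a group action, and their flags -/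

/-- An incidence geometry of rank four, with node (type) set `Fin 4`, together with an action of `G`
by type-preserving and incidence-preserving transformations. -/
structure IncidenceGeometry (G : Type) [Group G] where
  /-- The elements of each type. -/
  Elem : Fin 4 → Type
  /-- Incidence between elements of arbitrary types. -/
  Inc : (Σ i, Elem i) → (Σ i, Elem i) → Prop
  /-- The group acts on the elements of each type. -/
  act : ∀ i, MulAction G (Elem i)
  /-- The action preserves incidence. -/
  inc_smul : ∀ (g : G) {i j : Fin 4} (x : Elem i) (y : Elem j),
    Inc ⟨i, x⟩ ⟨j, y⟩ → Inc ⟨i, g • x⟩ ⟨j, g • y⟩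

attribute [instance] IncidenceGeometry.act

/-- A geometry of flags with an action of `G`: for every set `T` of nodes there are the flags
"of type `T`", with an action of `G`, and there is an incidence relation between flags of arbitrary
types.  As for cosets of parabolic subgroups, a flag of type `T` is one which has
one element for each node *outside* `T`; thus type `∅` means a maximal flag. -/
structure FlagGeometry (G : Type) [Group G] where
  Flag : Set (Fin 4) → Type
  Inc : ∀ {T T' : Set (Fin 4)}, Flag T → Flag T' → Prop
  act : ∀ T, MulAction G (Flag T)

attribute [instance] FlagGeometry.act

namespace IncidenceGeometry

variable {G : Type} [Group G] (X : IncidenceGeometry G)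

/-- Flags of type `T`: one element of each type `i ∉ T`, pairwise incident. -/
def FlagOfType (T : Set (Fin 4)) : Type :=
  {f : ∀ i : {i : Fin 4 // i ∉ T}, X.Elem i.1 //
    ∀ i j : {i : Fin 4 // i ∉ T}, X.Inc ⟨i.1, f i⟩ ⟨j.1, f j⟩}

instance (T : Set (Fin 4)) : MulAction G (X.FlagOfType T) where
  smul g f := ⟨fun i => g • f.1 i, fun i j => X.inc_smul g _ _ (f.2 i j)⟩
  one_smul f := Subtype.ext (funext fun i => one_smul G (f.1 i))
  mul_smul g h f := Subtype.ext (funext fun i => mul_smul g h (f.1 i))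

/-- The geometry of flags of an incidence geometry.  Two flags are incident if all elements of the
first are incident with all elements of the second. -/
def flags : FlagGeometry G where
  Flag := X.FlagOfType
  Inc f f' := ∀ i j, X.Inc ⟨i.1, f.1 i⟩ ⟨j.1, f'.1 j⟩
  act _ := inferInstance

end IncidenceGeometry

/-- A type-preserving and incidence-preserving isomorphism from a geometry of flags with an action
of `G` to one with an action of `H`, intertwining the actions via `ι : G →* H`. -/
structure FlagGeometry.EquivariantIso {G H : Type} [Group G] [Group H]
    (X : FlagGeometry G) (Y : FlagGeometry H) (ι : G →* H) where
  toEquiv : ∀ T : Set (Fin 4), X.Flag T ≃ Y.Flag T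
  inc_iff : ∀ {T T' : Set (Fin 4)} (x : X.Flag T) (x' : X.Flag T'),
    Y.Inc (toEquiv T x) (toEquiv T' x') ↔ X.Inc x x'
  map_smul : ∀ (g : G) {T : Set (Fin 4)} (x : X.Flag T),
    toEquiv T (g • x) = ι g • toEquiv T x

/-! ### Coxeter geometries -/

namespace CoxeterMatrix

/-- The Coxeter matrix of type `(3,3,6)`. -/
def type336 : CoxeterMatrix (Fin 4) where
  M := !![1, 3, 2, 2;
          3, 1, 3, 2;
          2, 3, 1, 6;
          2, 2, 6, 1]
  off_diagonal i j := by fin_cases i <;> fin_cases j <;> simp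

/-- The Coxeter matrix of type `(3,4,4)`. -/
def type344 : CoxeterMatrix (Fin 4) where
  M := !![1, 3, 2, 2;
          3, 1, 4, 2;
          2, 4, 1, 4;
          2, 2, 4, 1]
  off_diagonal i j := by fin_cases i <;> fin_cases j <;> simp

/-- The parabolic subgroup `W_T` generated by the simple reflections in `T`. -/
def parabolic {B : Type} (M : CoxeterMatrix B) (T : Set B) : Subgroup M.Group :=
  Subgroup.closure (M.simple '' T)

/-- The even subgroup `W⁺`. -/
def evenSubgroup {B : Type} (M : CoxeterMatrix B) : Subgroup M.Group :=
  M.toCoxeterSystem.lengthParity.ker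

/-- The Coxeter geometry: the flags of type `T` are the cosets `W ⧸ W_T`, two flags are incident
if these cosets intersect, and `W` acts by left multiplication. -/
def geometry (M : CoxeterMatrix (Fin 4)) : FlagGeometry M.Group where
  Flag T := M.Group ⧸ M.parabolic T
  Inc x x' := ∃ w : M.Group, (QuotientGroup.mk w = x) ∧ (QuotientGroup.mk w = x')
  act _ := inferInstance

end CoxeterMatrix

/-! ### Lax vectors, bases, superbases, tetrabases and cubases -/

section Lax

variable (R : Type) [CommRing R]

/-- Primitive vectors: coprime ordered pairs of elements of `R`. -/
def PrimitiveVector : Type := {v : Fin 2 → R // IsCoprime (v 0) (v 1)}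

/-- Two primitive vectors are identified if they differ by a unit. -/
instance PrimitiveVector.setoid : Setoid (PrimitiveVector R) where
  r v w := ∃ ε : Rˣ, w.1 = ε • v.1
  iseqv :=
    { refl := fun v => ⟨1, by simp⟩
      symm := by
        rintro v w ⟨ε, h⟩
        exact ⟨ε⁻¹, by rw [h, inv_smul_smul]⟩
      trans := by
        rintro u v w ⟨ε, h⟩ ⟨δ, h'⟩
        exact ⟨δ * ε, by rw [h', h, mul_smul]⟩ }

/-- Primitive lax vectors. -/
def LaxVector : Type := Quotient (PrimitiveVector.setoid R)

variable {R} in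
/-- The lax vector represented by a primitive vector. -/
def LaxVector.mk (v : PrimitiveVector R) : LaxVector R := Quotient.mk _ v

instance : MulAction SL(2, R) (PrimitiveVector R) where
  smul A v := ⟨A.1.mulVec v.1, v.2.mulVecSL A⟩
  one_smul v := Subtype.ext (Matrix.one_mulVec v.1)
  mul_smul A B v := Subtype.ext (Matrix.mulVec_mulVec v.1 A.1 B.1).symm

variable {R}

theorem PrimitiveVector.coe_smul (A : SL(2, R)) (v : PrimitiveVector R) :
    (A • v).1 = A.1.mulVec v.1 := rfl

theorem PrimitiveVector.smul_rel (A : SL(2, R)) {v w : PrimitiveVector R} (h : v ≈ w) :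
    A • v ≈ A • w := by
  obtain ⟨ε, h⟩ := h
  exact ⟨ε, by rw [coe_smul, coe_smul, h, Matrix.mulVec_smul]⟩

instance : MulAction SL(2, R) (LaxVector R) where
  smul A := Quotient.map (fun v => A • v) (fun _ _ h => PrimitiveVector.smul_rel A h)
  one_smul := by
    rintro ⟨v⟩
    exact congrArg (Quotient.mk _) (one_smul _ v)
  mul_smul A B := by
    rintro ⟨v⟩
    exact congrArg (Quotient.mk _) (mul_smul A B v)

theorem LaxVector.center_smul {A : SL(2, R)} (hA : A ∈ Subgroup.center SL(2, R))
    (a : LaxVector R) : A • a = a := by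
  obtain ⟨r, hr, h⟩ := Matrix.SpecialLinearGroup.mem_center_iff.mp hA
  rw [Fintype.card_fin] at hr
  induction a using Quotient.inductionOn with
  | h v =>
    refine (Quotient.sound ⟨⟨r, r, by rw [← sq, hr], by rw [← sq, hr]⟩, ?_⟩ :
      LaxVector.mk v = LaxVector.mk (A • v)).symm
    rw [PrimitiveVector.coe_smul, ← h]
    ext i
    simp [Matrix.scalar_apply, Matrix.mulVec_diagonal, Units.smul_def]

/-- The action of `PSL(2, R)` on primitive lax vectors induced by the action of `SL(2, R)` on `R²`. -/
instance : MulAction PSL(2, R) (LaxVector R) :=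
  MulAction.compHom (LaxVector R)
    (QuotientGroup.lift (Subgroup.center SL(2, R)) (MulAction.toPermHom SL(2, R) (LaxVector R))
      (fun _ hA => Equiv.ext fun a => LaxVector.center_smul hA a))

theorem LaxVector.mk_smul_mk (A : SL(2, R)) (v : PrimitiveVector R) :
    (QuotientGroup.mk A : PSL(2, R)) • LaxVector.mk v = LaxVector.mk (A • v) := rfl

/-- The lax vectors `a`, `b` are represented by primitive vectors which form an `R`-basis of `R²`. -/
def IsBasisPair (a b : LaxVector R) : Prop :=
  ∃ v w : PrimitiveVector R, LaxVector.mk v = a ∧ LaxVector.mk w = b ∧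
    LinearIndependent R ![v.1, w.1] ∧ Submodule.span R {v.1, w.1} = ⊤

/-- An unordered pair of lax vectors forming a basis. -/
def IsLaxBasis (s : Set (LaxVector R)) : Prop :=
  s.ncard = 2 ∧ ∃ a b : LaxVector R, s = {a, b} ∧ IsBasisPair a b

/-- An unordered triple of lax vectors, any two of which form a lax basis. -/
def IsLaxSuperbasis (s : Set (LaxVector R)) : Prop :=
  s.ncard = 3 ∧ ∀ t ⊆ s, t.ncard = 2 → IsLaxBasis t

/-- An unordered quadruple of lax vectors, any three of which form a lax superbasis. -/
def IsLaxTetrabasis (s : Set (LaxVector R)) : Prop :=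
  s.ncard = 4 ∧ ∀ t ⊆ s, t.ncard = 3 → IsLaxSuperbasis t

/-- A set of three two-element sets of lax vectors, all eight transversals of which are lax
superbases. -/
def IsLaxCubasis (P : Set (Set (LaxVector R))) : Prop :=
  P.ncard = 3 ∧ ∃ u v w : Fin 2 → LaxVector R,
    u 0 ≠ u 1 ∧ v 0 ≠ v 1 ∧ w 0 ≠ w 1 ∧
    P = {{u 0, u 1}, {v 0, v 1}, {w 0, w 1}} ∧
    ∀ i j k : Fin 2, IsLaxSuperbasis {u i, v j, w k}

theorem ncard_smul_set {G α : Type} [Group G] [MulAction G α] (g : G) (s : Set α) :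
    (g • s).ncard = s.ncard :=
  Set.ncard_image_of_injective s (MulAction.injective g)

theorem IsBasisPair.smul (g : PSL(2, R)) {a b : LaxVector R} (h : IsBasisPair a b) :
    IsBasisPair (g • a) (g • b) := by
  obtain ⟨v, w, rfl, rfl, hli, hsp⟩ := h
  induction g using QuotientGroup.induction_on with
  | H A =>
    refine ⟨A • v, A • w, rfl, rfl, ?_, ?_⟩
    · have h := hli.map' (Matrix.SpecialLinearGroup.toLin' A).toLinearMap
        (LinearEquiv.ker _)
      convert! h using 1
      ext i
      fin_cases i <;> rfl
    · have h := congrArg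
        (Submodule.map (Matrix.SpecialLinearGroup.toLin' A).toLinearMap) hsp
      rw [Submodule.map_span, Submodule.map_top, LinearEquiv.range, Set.image_pair] at h
      exact h

theorem IsLaxBasis.smul (g : PSL(2, R)) {s : Set (LaxVector R)} (h : IsLaxBasis s) :
    IsLaxBasis (g • s) := by
  obtain ⟨hs, a, b, rfl, h⟩ := h
  exact ⟨by rw [ncard_smul_set, hs], g • a, g • b, Set.image_pair _ _ _, h.smul g⟩

theorem IsLaxSuperbasis.smul (g : PSL(2, R)) {s : Set (LaxVector R)} (h : IsLaxSuperbasis s) :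
    IsLaxSuperbasis (g • s) := by
  refine ⟨by rw [ncard_smul_set, h.1], fun t ht hc => ?_⟩
  have := (h.2 (g⁻¹ • t) (Set.smul_set_subset_iff_subset_inv_smul_set.mpr (by rwa [inv_inv]))
    (by rw [ncard_smul_set, hc])).smul g
  rwa [smul_inv_smul] at this

theorem IsLaxTetrabasis.smul (g : PSL(2, R)) {s : Set (LaxVector R)} (h : IsLaxTetrabasis s) :
    IsLaxTetrabasis (g • s) := by
  refine ⟨by rw [ncard_smul_set, h.1], fun t ht hc => ?_⟩
  have := (h.2 (g⁻¹ • t) (Set.smul_set_subset_iff_subset_inv_smul_set.mpr (by rwa [inv_inv]))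
    (by rw [ncard_smul_set, hc])).smul g
  rwa [smul_inv_smul] at this

theorem IsLaxCubasis.smul (g : PSL(2, R)) {P : Set (Set (LaxVector R))} (h : IsLaxCubasis P) :
    IsLaxCubasis (g • P) := by
  obtain ⟨hP, u, v, w, hu, hv, hw, rfl, h⟩ := h
  refine ⟨by rw [ncard_smul_set, hP], fun i => g • u i, fun i => g • v i, fun i => g • w i,
    fun e => hu (MulAction.injective g e), fun e => hv (MulAction.injective g e),
    fun e => hw (MulAction.injective g e), ?_, fun i j k => ?_⟩
  · simp only [Set.smul_set_insert, Set.smul_set_singleton]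
  · simpa only [Set.smul_set_insert, Set.smul_set_singleton] using (h i j k).smul g

variable (R)

/-- Lax bases. -/
def LaxBasis : Type := {s : Set (LaxVector R) // IsLaxBasis s}

/-- Lax superbases. -/
def LaxSuperbasis : Type := {s : Set (LaxVector R) // IsLaxSuperbasis s}

/-- Lax tetrabases. -/
def LaxTetrabasis : Type := {s : Set (LaxVector R) // IsLaxTetrabasis s}

/-- Lax cubases. -/
def LaxCubasis : Type := {P : Set (Set (LaxVector R)) // IsLaxCubasis P}

instance : MulAction PSL(2, R) (LaxBasis R) where
  smul g s := ⟨g • s.1, s.2.smul g⟩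
  one_smul s := Subtype.ext (one_smul _ s.1)
  mul_smul g h s := Subtype.ext (mul_smul g h s.1)

instance : MulAction PSL(2, R) (LaxSuperbasis R) where
  smul g s := ⟨g • s.1, s.2.smul g⟩
  one_smul s := Subtype.ext (one_smul _ s.1)
  mul_smul g h s := Subtype.ext (mul_smul g h s.1)

instance : MulAction PSL(2, R) (LaxTetrabasis R) where
  smul g s := ⟨g • s.1, s.2.smul g⟩
  one_smul s := Subtype.ext (one_smul _ s.1)
  mul_smul g h s := Subtype.ext (mul_smul g h s.1)

instance : MulAction PSL(2, R) (LaxCubasis R) where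
  smul g P := ⟨g • P.1, P.2.smul g⟩
  one_smul P := Subtype.ext (one_smul _ P.1)
  mul_smul g h P := Subtype.ext (mul_smul g h P.1)

/-! ### Topographs -/

/-- The elements of a topograph whose points form the type `Point`: cells (type `0`) are primitive
lax vectors, faces (type `1`) are lax bases, edges (type `2`) are lax superbases. -/
def TopographElem (Point : Type) : Fin 4 → Type
  | 0 => LaxVector R
  | 1 => LaxBasis R
  | 2 => LaxSuperbasis R
  | 3 => Point

instance (Point : Type) [MulAction PSL(2, R) Point] :
    ∀ i, MulAction PSL(2, R) (TopographElem R Point i)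
  | 0 => inferInstanceAs (MulAction PSL(2, R) (LaxVector R))
  | 1 => inferInstanceAs (MulAction PSL(2, R) (LaxBasis R))
  | 2 => inferInstanceAs (MulAction PSL(2, R) (LaxSuperbasis R))
  | 3 => inferInstanceAs (MulAction PSL(2, R) Point)

variable {R}

/-- The set of lax vectors contained in an element of a topograph. -/
def TopographElem.vectors {Point : Type} (vec : Point → Set (LaxVector R)) :
    ∀ {i : Fin 4}, TopographElem R Point i → Set (LaxVector R)
  | 0, a => {(a : LaxVector R)}
  | 1, s => (s : LaxBasis R).1
  | 2, s => (s : LaxSuperbasis R).1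
  | 3, p => vec p

theorem TopographElem.vectors_smul {Point : Type} [MulAction PSL(2, R) Point]
    (vec : Point → Set (LaxVector R)) (hvec : ∀ (g : PSL(2, R)) p, vec (g • p) = g • vec p)
    (g : PSL(2, R)) {i : Fin 4} (x : TopographElem R Point i) :
    vectors vec (g • x) = g • vectors vec x := by
  match i, x with
  | 0, a => exact (Set.smul_set_singleton (α := PSL(2, R)) (β := LaxVector R)).symm
  | 1, s => rfl
  | 2, s => rfl
  | 3, p => exact hvec g p

variable (R)

/-- The topograph whose points form the type `Point`, where `vec p` is the set of lax vectors
contained in the point `p`.  Two elements of different types are incident if one is contained in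
the other; an element is incident with no other element of its type. -/
def topograph (Point : Type) [MulAction PSL(2, R) Point] (vec : Point → Set (LaxVector R))
    (hvec : ∀ (g : PSL(2, R)) p, vec (g • p) = g • vec p) : IncidenceGeometry PSL(2, R) where
  Elem := TopographElem R Point
  Inc x y := x = y ∨
    (x.1 < y.1 ∧ TopographElem.vectors vec x.2 ⊆ TopographElem.vectors vec y.2) ∨
    (y.1 < x.1 ∧ TopographElem.vectors vec y.2 ⊆ TopographElem.vectors vec x.2)
  act := inferInstance
  inc_smul g i j x y h := by
    rcases h with h | ⟨h, h'⟩ | ⟨h, h'⟩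
    · obtain ⟨rfl, h⟩ := Sigma.mk.inj_iff.mp h
      obtain rfl := eq_of_heq h
      exact Or.inl rfl
    · refine Or.inr (Or.inl ⟨h, ?_⟩)
      simp only [TopographElem.vectors_smul vec hvec]
      exact Set.smul_set_mono h'
    · refine Or.inr (Or.inr ⟨h, ?_⟩)
      simp only [TopographElem.vectors_smul vec hvec]
      exact Set.smul_set_mono h'

end Lax

/-- The Eisenstein integers `ℤ[ω]`, where `ω² = -1 - ω`, that is, `ω = exp (2πi/3)`. -/
abbrev EisensteinInt : Type := QuadraticAlgebra ℤ (-1) (-1)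

/-- The Eisenstein topograph: its points are the lax tetrabases. -/
def eisensteinTopograph : IncidenceGeometry PSL(2, EisensteinInt) :=
  topograph EisensteinInt (LaxTetrabasis EisensteinInt) (fun s => s.1) (fun _ _ => rfl)

/-- The Gaussian topograph: its points are the lax cubases.  A lax vector, basis or superbasis is
contained in a cubasis if it consists of lax vectors of its three two-element sets. -/
def gaussianTopograph : IncidenceGeometry PSL(2, GaussianInt) :=
  topograph GaussianInt (LaxCubasis GaussianInt) (fun P => ⋃₀ P.1)
    (fun g P => by
      change ⋃₀ ((fun s => g • s) '' P.1) = (fun a => g • a) '' (⋃₀ P.1)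
      rw [Set.sUnion_eq_biUnion, Set.sUnion_eq_biUnion, Set.biUnion_image, Set.image_iUnion₂]
      rfl)

end

/-! The link between the two geometries is an explicit action of `W` on lax vectors by antilinear
maps `a ↦ A · conj a`. The generator `s₃` is coordinatewise conjugation, and `s₀`, `s₁`, `s₂` are
conjugation followed by the swap of coordinates, by `(x, y) ↦ (y - x, y)` and by `diag(1, u)`. Here
`u` is a generator of the unit group: a primitive sixth root of unity over the Eisenstein integers
and `i` over the Gaussian integers. A product of two generators is linear, so each Coxeter relation
says that a power of a two by two matrix is scalar, which is a finite computation.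

The action is faithful. A lax vector `v` determines the Hermitian matrix `v v*`, because units have
absolute value one. In suitable integral coordinates (`weight`) the generators act on these matrices
by the contragredient of the reflection representation attached to a Cartan matrix, and the matrices
`v v*` span. Hence an element that acts trivially on lax vectors acts trivially on roots. By the
positivity of roots (`reflectionRep_nonneg`) the reflection representation is faithful. Positivity
also shows that a standard parabolic subgroup is the intersection of the maximal ones containing it
(`mem_closure_of_forall_compl`), and this allows flags of every type to be treated through their
single elements.

Every invertible matrix acts like an element of `W`: powers of `s₂s₃` give the diagonal matrices
`diag(1, d)`, these and `s₁s₃` give the transvections, and the Euclidean algorithm does the rest.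
The same factorizations identify the stabilizers of the standard cell and face with parabolic
subgroups. Now `GL₂(R)` is transitive on ordered superbases, each superbasis lies in exactly two
points, and `s₃` interchanges the two points over the standard one. So `W` is transitive on
chambers. The stabilizers of the standard edge and point are found by moving `e₁`, `e₂`, `e₃` back
one after the other; what remains is `1` or `s₃` (`exists_mem_parabolic_of_smul_set`). Chamber
transitivity, the extension of flags to chambers and the four stabilizers are what
`IsCoxeterGeometry` asks for, and from these the isomorphism with the coset geometry is formal.

Even elements act linearly and odd ones antilinearly, so `W⁺` is identified with `PGL₂(R)`. Inside
it `PSL₂(R)` consists of the classes whose determinant is the square of a unit. Since `u` generates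
the units and is not a square, this is a subgroup of index two. -/

open scoped Pointwise MatrixGroups

noncomputable section

/-! ### The reflection representation of a crystallographic Coxeter group -/

namespace CoxeterMatrix

variable {B : Type} [DecidableEq B]

/-- The matrix, in the basis of simple roots, of the simple reflection with index `i` determined by
the Cartan matrix `c`. -/
def cartanReflection (c : Matrix B B ℤ) (i : B) : Matrix B B ℤ :=
  Matrix.of fun a b => (if a = b then 1 else 0) - if a = i then c i b else 0

/-- The coefficients with respect to the simple roots `α i`, `α j` of the image of
`p • α i + q • α j` under the alternating word of length `k` in `i` and `j` ending with `j`. -/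
def dihedralCoeff (c : Matrix B B ℤ) : B → B → ℕ → ℤ → ℤ → ℤ × ℤ
  | _, _, 0, p, q => (p, q)
  | i, j, k + 1, p, q => (dihedralCoeff c j i k (-q - c j i * p) p).swap

/-- `c` is a Cartan matrix for the Coxeter matrix `M`. -/
structure IsCartan [Fintype B] (M : CoxeterMatrix B) (c : Matrix B B ℤ) : Prop where
  diag : ∀ i, c i i = 2
  liftable : M.IsLiftable (cartanReflection c)
  dihedral : ∀ i j, i ≠ j → ∀ k < M i j,
    0 ≤ (dihedralCoeff c i j k 1 0).1 ∧ 0 ≤ (dihedralCoeff c i j k 1 0).2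

/-- A Cartan matrix of type `(3,3,6)`. -/
def cartan336 : Matrix (Fin 4) (Fin 4) ℤ :=
  !![2, -1, 0, 0; -1, 2, -1, 0; 0, -1, 2, -1; 0, 0, -3, 2]

/-- A Cartan matrix of type `(3,4,4)`. -/
def cartan344 : Matrix (Fin 4) (Fin 4) ℤ :=
  !![2, -1, 0, 0; -1, 2, -1, 0; 0, -2, 2, -1; 0, 0, -2, 2]

theorem type336_ne_zero (i j : Fin 4) : type336 i j ≠ 0 := by
  fin_cases i <;> fin_cases j <;> decide

theorem type344_ne_zero (i j : Fin 4) : type344 i j ≠ 0 := by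
  fin_cases i <;> fin_cases j <;> decide

/-- A bond of order `m` needs `c i j * c j i = 4 cos²(π/m)`, which is 3 for `m = 6` and 2 for `m =
4`. Dropping the symmetry of `c` keeps the entries integral, so that all conditions become finite
integer computations. -/
theorem isCartan_cartan336 : type336.IsCartan cartan336 where
  diag := by decide
  liftable := by unfold IsLiftable; decide
  dihedral i j hij := by revert hij; revert i j; simp only [← Finset.mem_range]; decide

theorem isCartan_cartan344 : type344.IsCartan cartan344 where
  diag := by decide
  liftable := by unfold IsLiftable; decide
  dihedral i j hij := by revert hij; revert i j; simp only [← Finset.mem_range]; decide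

end CoxeterMatrix

/-! ### Positivity of roots, faithfulness and parabolic subgroups. -/

namespace CoxeterSystem

open CoxeterMatrix

variable {B W : Type} [DecidableEq B] [Fintype B] [Group W] {M : CoxeterMatrix B}
  (cs : CoxeterSystem M W) {c : Matrix B B ℤ}

/-- The reflection representation attached to a Cartan matrix. -/
def reflectionRep (hc : M.IsCartan c) : W →* Matrix B B ℤ :=
  cs.lift ⟨cartanReflection c, hc.liftable⟩

theorem reflectionRep_simple (hc : M.IsCartan c) (i : B) :
    cs.reflectionRep hc (cs.simple i) = cartanReflection c i :=
  cs.lift_apply_simple hc.liftable i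

theorem mul_cartanReflection (A : Matrix B B ℤ) (i a b : B) :
    (A * cartanReflection c i) a b = A a b - A a i * c i b := by
  simp [Matrix.mul_apply, cartanReflection, mul_sub, Finset.sum_sub_distrib]

theorem reflectionRep_mul_simple (hc : M.IsCartan c) (w : W) (i a b : B) :
    cs.reflectionRep hc (w * cs.simple i) a b =
      cs.reflectionRep hc w a b - cs.reflectionRep hc w a i * c i b := by
  rw [map_mul, reflectionRep_simple, mul_cartanReflection]

theorem reflectionRep_mul_simple_self (hc : M.IsCartan c) (w : W) (i a : B) :
    cs.reflectionRep hc (w * cs.simple i) a i = -cs.reflectionRep hc w a i := by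
  rw [reflectionRep_mul_simple, hc.diag]; ring

/-- The recursion of `dihedralCoeff` strips the last letter `j` of the word: the reflection `s_j`
sends `p α_i + q α_j` to `p α_i + (-q - c j i p) α_j`. The remaining word ends in `i`, so the two
roots change roles. -/
theorem reflectionRep_mul_alternatingWord (hc : M.IsCartan c) (w : W) (k : ℕ) :
    ∀ (i j a : B) (p q : ℤ),
      cs.reflectionRep hc (w * cs.wordProd (alternatingWord i j k)) a i * p +
        cs.reflectionRep hc (w * cs.wordProd (alternatingWord i j k)) a j * q =
      cs.reflectionRep hc w a i * (dihedralCoeff c i j k p q).1 +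
        cs.reflectionRep hc w a j * (dihedralCoeff c i j k p q).2 := by
  induction k with
  | zero => intro i j a p q; simp [alternatingWord, dihedralCoeff]
  | succ k ih =>
    intro i j a p q
    have h := ih j i a (-q - c j i * p) p
    rw [alternatingWord_succ, wordProd_concat, ← mul_assoc, reflectionRep_mul_simple,
      reflectionRep_mul_simple, hc.diag]
    simp only [dihedralCoeff, Prod.fst_swap, Prod.snd_swap]
    linear_combination h

/-- Every element is the product of an element without right descents at `i`, `j` and an
alternating word in `i`, `j` that is shorter than the longest one. -/
theorem exists_eq_mul_alternatingWord {w : W} {i j : B} (hM : M i j ≠ 0)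
    (hi : ¬cs.IsRightDescent w i) (hj : cs.IsRightDescent w j) :
    ∃ v : W, ∃ k < M i j, w = v * cs.wordProd (alternatingWord i j k) ∧
      cs.length v < cs.length w ∧ ¬cs.IsRightDescent v i ∧ ¬cs.IsRightDescent v j := by
  -- `P k` says that an alternating word of length `k` splits off on the right of `w` with lengths
  -- adding up. The factor `v` sought is the one for the last `k` before `P` first fails.
  let P (k : ℕ) : Prop := ∃ v : W, w = v * cs.wordProd (alternatingWord i j k) ∧
    cs.length w = cs.length v + k
  have hlen (i j : B) (k : ℕ) : cs.length (cs.wordProd (alternatingWord i j k)) ≤ k := by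
    simpa using cs.length_wordProd_le (alternatingWord i j k)
  have h0 : P 0 := ⟨w, by simp [alternatingWord], rfl⟩
  have h1 : P 1 := by
    refine ⟨w * cs.simple j, by simp [alternatingWord], ?_⟩
    have := cs.isRightDescent_iff.mp hj
    lia
  -- At full length the braid relation rewrites the word as one ending in `i`, which would make `i`
  -- a right descent of `w`.
  have hMP : ¬P (M i j) := by
    rintro ⟨v, hv, hl⟩
    obtain ⟨m, hm⟩ := Nat.exists_eq_succ_of_ne_zero hM
    have hb : cs.wordProd (alternatingWord i j (M i j)) =
        cs.wordProd (alternatingWord j i (M j i)) := cs.wordProd_braidWord_eq i j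
    rw [hb, M.symmetric j i, hm, alternatingWord_succ, wordProd_concat, ← mul_assoc] at hv
    apply hi
    rw [IsRightDescent, hv, simple_mul_simple_cancel_right, ← hv, hl, hm]
    have := cs.length_mul_le v (cs.wordProd (alternatingWord i j m))
    have := hlen i j m
    lia
  classical
  have hex : ∃ k, ¬P k := ⟨_, hMP⟩
  obtain ⟨k, hk⟩ : ∃ k, Nat.find hex = k + 1 :=
    Nat.exists_eq_succ_of_ne_zero fun h => (h ▸ Nat.find_spec hex) h0
  have hk1 : ¬P (k + 1) := hk ▸ Nat.find_spec hex
  have hkM : k < M i j := by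
    have := Nat.find_le (h := hex) (n := M i j) hMP
    lia
  have hPk : P k := not_not.mp (Nat.find_min hex (m := k) (by lia))
  obtain ⟨l, rfl⟩ : ∃ l, k = l + 1 :=
    Nat.exists_eq_succ_of_ne_zero (by rintro rfl; exact hk1 h1)
  obtain ⟨v, hv, hl⟩ := hPk
  -- The two possible last letters of `v` are excluded for different reasons. The letter that
  -- continues the alternating word would prove `P (k + 1)`; the letter equal to the first one of
  -- the word would cancel and make `w` too short.
  have hnext : ¬cs.IsRightDescent v (if Even (l + 1) then j else i) := by
    intro hd
    refine hk1 ⟨v * cs.simple (if Even (l + 1) then j else i), ?_, ?_⟩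
    · rw [alternatingWord_succ' i j (l + 1), wordProd_cons, ← mul_assoc,
        simple_mul_simple_cancel_right]
      exact hv
    · have := cs.isRightDescent_iff.mp hd
      lia
  have hprev : ¬cs.IsRightDescent v (if Even l then j else i) := by
    intro hd
    rw [alternatingWord_succ' i j l, wordProd_cons, ← mul_assoc] at hv
    have := cs.length_mul_le (v * cs.simple (if Even l then j else i))
      (cs.wordProd (alternatingWord i j l))
    rw [← hv] at this
    have := hlen i j l
    have := cs.isRightDescent_iff.mp hd
    lia
  refine ⟨v, l + 1, hkM, hv, by lia, ?_⟩
  by_cases he : Even l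
  · rw [if_neg (by simpa [parity_simps] using he)] at hnext
    rw [if_pos he] at hprev
    exact ⟨hnext, hprev⟩
  · rw [if_pos (by simpa [parity_simps] using he)] at hnext
    rw [if_neg he] at hprev
    exact ⟨hprev, hnext⟩

/-- If `w` has no right descent at `i`, then it maps the simple root with index `i` to a
nonnegative combination of simple roots. -/
theorem reflectionRep_nonneg (hc : M.IsCartan c) (hM : ∀ i j, M i j ≠ 0) (w : W) :
    ∀ i, ¬cs.IsRightDescent w i → ∀ a, 0 ≤ cs.reflectionRep hc w a i := by
  induction hn : cs.length w using Nat.strong_induction_on generalizing w with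
  | _ n ih =>
    subst hn
    intro i hi a
    by_cases hw : w = 1
    · rw [hw, map_one, Matrix.one_apply]
      split <;> simp
    obtain ⟨j, hj⟩ := cs.exists_rightDescent_of_ne_one hw
    have hij : i ≠ j := by rintro rfl; exact hi hj
    -- The dihedral factor sends `α_i` to a nonnegative combination of `α_i` and `α_j`, because its
    -- length is below `M i j`; by induction `v` sends both of these roots to nonnegative
    -- combinations.
    obtain ⟨v, k, hk, hwv, hl, hvi, hvj⟩ := cs.exists_eq_mul_alternatingWord (hM i j) hi hj
    have h := cs.reflectionRep_mul_alternatingWord hc v k i j a 1 0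
    rw [← hwv, mul_one, mul_zero, add_zero] at h
    obtain ⟨h1, h2⟩ := hc.dihedral i j hij k hk
    rw [h]
    exact add_nonneg (mul_nonneg (ih _ hl v rfl i hvi a) h1) (mul_nonneg (ih _ hl v rfl j hvj a) h2)

theorem reflectionRep_nonpos (hc : M.IsCartan c) (hM : ∀ i j, M i j ≠ 0) {w : W} {i : B}
    (hi : cs.IsRightDescent w i) (a : B) : cs.reflectionRep hc w a i ≤ 0 := by
  have h := cs.reflectionRep_nonneg hc hM (w * cs.simple i) i
    (cs.isRightDescent_iff_not_isRightDescent_mul.mp hi) a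
  rw [reflectionRep_mul_simple_self] at h
  linarith

/-- A nontrivial element has a right descent `i`, so it makes `α_i` nonpositive and cannot fix it.
-/
theorem reflectionRep_injective (hc : M.IsCartan c) (hM : ∀ i j, M i j ≠ 0) {w : W}
    (hw : cs.reflectionRep hc w = 1) : w = 1 := by
  by_contra h
  obtain ⟨i, hi⟩ := cs.exists_rightDescent_of_ne_one h
  have := cs.reflectionRep_nonpos hc hM hi i
  rw [hw, Matrix.one_apply_eq] at this
  norm_num at this

/-- The rows of the reflection representation with index outside `T` are those of the identity for
the elements of the parabolic subgroup `W_T`. -/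
theorem reflectionRep_apply_of_mem_closure (hc : M.IsCartan c) {T : Set B} {w : W}
    (hw : w ∈ Subgroup.closure (cs.simple '' T)) {a : B} (ha : a ∉ T) (b : B) :
    cs.reflectionRep hc w a b = if a = b then 1 else 0 := by
  induction hw using Subgroup.closure_induction_right generalizing b with
  | one => rw [map_one, Matrix.one_apply]
  | mul_right x y _ hy ih =>
    obtain ⟨i, hi, rfl⟩ := hy
    have : a ≠ i := by rintro rfl; exact ha hi
    rw [reflectionRep_mul_simple, ih, ih, if_neg this, zero_mul, sub_zero]
  | mul_inv_cancel x y _ hy ih =>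
    obtain ⟨i, hi, rfl⟩ := hy
    have : a ≠ i := by rintro rfl; exact ha hi
    rw [inv_simple, reflectionRep_mul_simple, ih, ih, if_neg this, zero_mul, sub_zero]

/-- An element all of whose coordinate rows outside `T` are those of the identity lies in `W_T`. -/
theorem mem_closure_of_reflectionRep (hc : M.IsCartan c) (hM : ∀ i j, M i j ≠ 0) {T : Set B} (w : W)
    (hw : ∀ a ∉ T, ∀ b, cs.reflectionRep hc w a b = if a = b then 1 else 0) :
    w ∈ Subgroup.closure (cs.simple '' T) := by
  induction hn : cs.length w using Nat.strong_induction_on generalizing w with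
  | _ n ih =>
    subst hn
    by_cases h1 : w = 1
    · exact h1 ▸ one_mem _
    obtain ⟨i, hi⟩ := cs.exists_rightDescent_of_ne_one h1
    -- If `i` were outside `T`, the diagonal entry at `i` would be 1 by hypothesis, but it is
    -- nonpositive at a descent. So a letter of `T` can be removed, which leaves the rows outside
    -- `T` unchanged.
    have hiT : i ∈ T := by
      by_contra hiT
      have := cs.reflectionRep_nonpos hc hM hi i
      rw [hw i hiT i, if_pos rfl] at this
      norm_num at this
    have hs : cs.simple i ∈ Subgroup.closure (cs.simple '' T) :=
      Subgroup.subset_closure (Set.mem_image_of_mem _ hiT)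
    have := ih _ hi (w * cs.simple i) (fun a ha b => by
      have : a ≠ i := by rintro rfl; exact ha hiT
      rw [reflectionRep_mul_simple, hw a ha, hw a ha, if_neg this, zero_mul, sub_zero]) rfl
    exact (Subgroup.mul_mem_cancel_right _ hs).mp this

/-- A standard parabolic subgroup is the intersection of the maximal ones containing it. -/
theorem mem_closure_of_forall_compl (hc : M.IsCartan c) (hM : ∀ i j, M i j ≠ 0) {T : Set B} {w : W}
    (hw : ∀ i ∉ T, w ∈ Subgroup.closure (cs.simple '' {i}ᶜ)) :
    w ∈ Subgroup.closure (cs.simple '' T) :=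
  -- Membership in `W_T` is a condition on each row `a ∉ T` separately, and membership in the
  -- parabolic subgroup of `{a}ᶜ` already gives that row.
  cs.mem_closure_of_reflectionRep hc hM w fun a ha b =>
    cs.reflectionRep_apply_of_mem_closure hc (hw a ha) (by simp) b

end CoxeterSystem

/-! ### Geometries with a chamber-transitive action of a Coxeter group -/

namespace IncidenceGeometry

/-- The hypotheses under which the geometry `X` is the Coxeter geometry of `M`: the Coxeter group
acts transitively on the chambers, every flag lies in a chamber, and the stabilizers of the elements
of the chamber `C` are the maximal standard parabolic subgroups. -/
structure IsCoxeterGeometry {G : Type} [Group G] (X : IncidenceGeometry G)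
    (M : CoxeterMatrix (Fin 4)) [∀ i, MulAction M.Group (X.Elem i)] (C : ∀ i, X.Elem i) : Prop where
  inc_smul : ∀ (w : M.Group) {i j : Fin 4} (x : X.Elem i) (y : X.Elem j),
    X.Inc ⟨i, x⟩ ⟨j, y⟩ → X.Inc ⟨i, w • x⟩ ⟨j, w • y⟩
  inc_iff_eq : ∀ {i : Fin 4} (x y : X.Elem i), X.Inc ⟨i, x⟩ ⟨i, y⟩ ↔ x = y
  inc_symm : ∀ x y, X.Inc x y → X.Inc y x
  exists_chamber : ∀ {T : Set (Fin 4)} (f : X.FlagOfType T), ∃ F : ∀ i, X.Elem i,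
    (∀ i j, X.Inc ⟨i, F i⟩ ⟨j, F j⟩) ∧ ∀ i : {i : Fin 4 // i ∉ T}, F i.1 = f.1 i
  chamber : ∀ i j, X.Inc ⟨i, C i⟩ ⟨j, C j⟩
  exists_smul_eq : ∀ F : ∀ i, X.Elem i, (∀ i j, X.Inc ⟨i, F i⟩ ⟨j, F j⟩) →
    ∃ w : M.Group, ∀ i, F i = w • C i
  smul_eq_iff : ∀ (i : Fin 4) (w : M.Group), w • C i = C i ↔ w ∈ M.parabolic {i}ᶜ
  mem_parabolic_iff : ∀ (T : Set (Fin 4)) (w : M.Group),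
    w ∈ M.parabolic T ↔ ∀ i ∉ T, w ∈ M.parabolic {i}ᶜ

namespace IsCoxeterGeometry

variable {G : Type} [Group G] {X : IncidenceGeometry G} {M : CoxeterMatrix (Fin 4)}
  [∀ i, MulAction M.Group (X.Elem i)] {C : ∀ i, X.Elem i}

theorem smul_eq_smul_iff (h : X.IsCoxeterGeometry M C) (i : Fin 4) (w w' : M.Group) :
    w • C i = w' • C i ↔ w⁻¹ * w' ∈ M.parabolic {i}ᶜ := by
  rw [← h.smul_eq_iff, mul_smul, inv_smul_eq_iff, eq_comm]

theorem mk_eq_mk_iff (h : X.IsCoxeterGeometry M C) (T : Set (Fin 4)) (w w' : M.Group) :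
    (QuotientGroup.mk w : M.Group ⧸ M.parabolic T) = QuotientGroup.mk w' ↔
      ∀ i ∉ T, w • C i = w' • C i := by
  simp_rw [QuotientGroup.eq, h.mem_parabolic_iff T, h.smul_eq_smul_iff]

/-- The flag of type `T` that corresponds to a coset of `W_T`. -/
def flagOfCoset (h : X.IsCoxeterGeometry M C) (T : Set (Fin 4)) (q : M.Group ⧸ M.parabolic T) :
    X.FlagOfType T :=
  Quotient.liftOn' q
    (fun w => ⟨fun i => w • C i.1, fun i j => h.inc_smul w _ _ (h.chamber i.1 j.1)⟩)
    (fun w w' hw => Subtype.ext (funext fun i =>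
      (h.mk_eq_mk_iff T w w').mp (Quotient.sound' hw) i.1 i.2))

theorem flagOfCoset_mk (h : X.IsCoxeterGeometry M C) (T : Set (Fin 4)) (w : M.Group)
    (i : {i : Fin 4 // i ∉ T}) :
    (h.flagOfCoset T (QuotientGroup.mk w)).1 i = w • C i.1 := rfl

theorem flagOfCoset_bijective (h : X.IsCoxeterGeometry M C) (T : Set (Fin 4)) :
    Function.Bijective (h.flagOfCoset T) := by
  constructor
  · rintro ⟨w⟩ ⟨w'⟩ hw
    exact (h.mk_eq_mk_iff T w w').mpr fun i hi => congrFun (congrArg Subtype.val hw) ⟨i, hi⟩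
  · intro f
    obtain ⟨F, hF, hf⟩ := h.exists_chamber f
    obtain ⟨w, hw⟩ := h.exists_smul_eq F hF
    exact ⟨QuotientGroup.mk w, Subtype.ext (funext fun i => by
      rw [h.flagOfCoset_mk, ← hw, hf])⟩

open Classical in
theorem inc_flagOfCoset_iff (h : X.IsCoxeterGeometry M C) {T T' : Set (Fin 4)}
    (q : M.Group ⧸ M.parabolic T) (q' : M.Group ⧸ M.parabolic T') :
    X.flags.Inc (h.flagOfCoset T q) (h.flagOfCoset T' q') ↔ M.geometry.Inc q q' := by
  obtain ⟨w, rfl⟩ := QuotientGroup.mk_surjective q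
  obtain ⟨w', rfl⟩ := QuotientGroup.mk_surjective q'
  constructor
  · intro hinc
    have hinc' : ∀ i j, i ∉ T → j ∉ T' → X.Inc ⟨i, w • C i⟩ ⟨j, w' • C j⟩ :=
      fun i j hi hj => hinc ⟨i, hi⟩ ⟨j, hj⟩
    -- Two incident flags are glued to one of type `T ∩ T'`, taking the second flag at the nodes of
    -- `T` and the first elsewhere. A chamber `v • C` containing it gives the common element `v` of
    -- both cosets. At nodes outside `T` and `T'` nothing is lost, since incident elements of equal
    -- type coincide.
    let f : X.FlagOfType (T ∩ T') :=
      ⟨fun i => if i.1 ∈ T then w' • C i.1 else w • C i.1, by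
        rintro ⟨i, hi⟩ ⟨j, hj⟩
        dsimp only
        split_ifs with h1 h2 h2
        · exact h.inc_smul w' _ _ (h.chamber i j)
        · exact h.inc_symm _ _ (hinc' j i h2 fun h' => hi ⟨h1, h'⟩)
        · exact hinc' i j h1 fun h' => hj ⟨h2, h'⟩
        · exact h.inc_smul w _ _ (h.chamber i j)⟩
    obtain ⟨F, hF, hf⟩ := h.exists_chamber f
    obtain ⟨v, hv⟩ := h.exists_smul_eq F hF
    have hv' (i : Fin 4) (hi : i ∉ T ∩ T') : v • C i = if i ∈ T then w' • C i else w • C i := by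
      rw [← hv, hf ⟨i, hi⟩]
    refine ⟨v, (h.mk_eq_mk_iff T v w).mpr fun i hi => ?_,
      (h.mk_eq_mk_iff T' v w').mpr fun i hi => ?_⟩
    · rw [hv' i fun h' => hi h'.1, if_neg hi]
    · rw [hv' i fun h' => hi h'.2]
      split_ifs with h1
      · rfl
      · exact (h.inc_iff_eq _ _).mp (hinc' i i h1 hi)
  · rintro ⟨v, hv, hv'⟩
    rintro ⟨i, hi⟩ ⟨j, hj⟩
    rw [h.flagOfCoset_mk, h.flagOfCoset_mk]
    have h1 := (h.mk_eq_mk_iff T v w).mp hv i hi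
    have h2 := (h.mk_eq_mk_iff T' v w').mp hv' j hj
    rw [← h1, ← h2]
    exact h.inc_smul v _ _ (h.chamber i j)

/-- The bijection between cosets and flags. -/
def cosetEquiv (h : X.IsCoxeterGeometry M C) (T : Set (Fin 4)) :
    M.geometry.Flag T ≃ X.flags.Flag T :=
  Equiv.ofBijective (h.flagOfCoset T) (h.flagOfCoset_bijective T)

theorem cosetEquiv_smul (h : X.IsCoxeterGeometry M C) (ι : G →* M.Group)
    (hι : ∀ (g : G) {i : Fin 4} (x : X.Elem i), g • x = ι g • x) (g : G) {T : Set (Fin 4)}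
    (q : M.geometry.Flag T) : h.cosetEquiv T (ι g • q) = g • h.cosetEquiv T q := by
  induction q using QuotientGroup.induction_on with
  | H w =>
    refine Subtype.ext (funext fun i => ?_)
    change (ι g * w) • C i.1 = g • (w • C i.1)
    rw [hι, mul_smul]

/-- The isomorphism with the Coxeter geometry. -/
def equivariantIso (h : X.IsCoxeterGeometry M C) (ι : G →* M.Group)
    (hι : ∀ (g : G) {i : Fin 4} (x : X.Elem i), g • x = ι g • x) :
    X.flags.EquivariantIso M.geometry ι where
  toEquiv T := (h.cosetEquiv T).symm
  inc_iff {T T'} x x' := by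
    have hx : h.flagOfCoset T ((h.cosetEquiv T).symm x) = x := (h.cosetEquiv T).apply_symm_apply x
    have hx' : h.flagOfCoset T' ((h.cosetEquiv T').symm x') = x' :=
      (h.cosetEquiv T').apply_symm_apply x'
    have hinc := h.inc_flagOfCoset_iff ((h.cosetEquiv T).symm x) ((h.cosetEquiv T').symm x')
    rw [hx, hx'] at hinc
    exact hinc.symm
  map_smul g T x := by
    refine (Equiv.symm_apply_eq _).mpr ?_
    rw [h.cosetEquiv_smul ι hι, Equiv.apply_symm_apply]

end IsCoxeterGeometry

end IncidenceGeometry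

/-! ### Linear and antilinear transformations of lax vectors -/

section Lax

variable {R : Type} [CommRing R]

namespace LaxVector

/-- The lax vector represented by `(x, y)`. -/
def vec (x y : R) (h : IsCoprime x y) : LaxVector R := mk ⟨![x, y], h⟩

theorem mk_eq_vec (v : PrimitiveVector R) : mk v = vec (v.1 0) (v.1 1) v.2 :=
  congrArg mk (Subtype.ext (by ext i; fin_cases i <;> rfl))

theorem exists_eq_vec (a : LaxVector R) : ∃ x y h, a = vec x y h := by
  induction a using Quotient.inductionOn with
  | h v => exact ⟨_, _, _, mk_eq_vec v⟩

theorem vec_eq_vec_iff {x y x' y' : R} {h : IsCoprime x y} {h' : IsCoprime x' y'} :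
    vec x y h = vec x' y' h' ↔ ∃ ε : Rˣ, x' = ε * x ∧ y' = ε * y := by
  refine Quotient.eq.trans (exists_congr fun ε => ?_)
  constructor
  · intro e
    exact ⟨congrFun e 0, congrFun e 1⟩
  · rintro ⟨e0, e1⟩
    ext i
    fin_cases i
    · exact e0
    · exact e1

theorem vec_congr {x y x' y' : R} (hx : x = x') (hy : y = y') {h : IsCoprime x y} :
    vec x y h = vec x' y' (hx ▸ hy ▸ h) := by
  subst hx hy; rfl

/-- The lax vector `(1, 0)`. -/
def e₁ : LaxVector R := vec 1 0 isCoprime_one_left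

/-- The lax vector `(0, 1)`. -/
def e₂ : LaxVector R := vec 0 1 isCoprime_one_right

/-- The lax vector `(1, 1)`. -/
def e₃ : LaxVector R := vec 1 1 isCoprime_one_left

theorem isCoprime_gl_mulVec (A : GL (Fin 2) R) {x y : R} (h : IsCoprime x y) :
    IsCoprime (A 0 0 * x + A 0 1 * y) (A 1 0 * x + A 1 1 * y) := by
  obtain ⟨a, b, hab⟩ := h
  have hA : (A⁻¹).1 * A.1 = 1 := A.inv_mul
  have h00 := congrFun (congrFun hA 0) 0
  have h01 := congrFun (congrFun hA 0) 1
  have h10 := congrFun (congrFun hA 1) 0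
  have h11 := congrFun (congrFun hA 1) 1
  simp only [Matrix.mul_apply, Fin.sum_univ_two, Matrix.one_apply_eq, ne_eq, zero_ne_one,
    one_ne_zero, not_false_eq_true, Matrix.one_apply_ne] at h00 h01 h10 h11
  refine ⟨a * (A⁻¹).1 0 0 + b * (A⁻¹).1 1 0, a * (A⁻¹).1 0 1 + b * (A⁻¹).1 1 1, ?_⟩
  linear_combination hab + a * x * h00 + a * y * h01 + b * x * h10 + b * y * h11

instance : MulAction (GL (Fin 2) R) (PrimitiveVector R) where
  smul A v := ⟨A.1.mulVec v.1, by
    have := isCoprime_gl_mulVec A v.2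
    simpa [Matrix.mulVec, dotProduct] using this⟩
  one_smul v := Subtype.ext (Matrix.one_mulVec v.1)
  mul_smul A B v := Subtype.ext (Matrix.mulVec_mulVec v.1 A.1 B.1).symm

theorem coe_gl_smul (A : GL (Fin 2) R) (v : PrimitiveVector R) : (A • v).1 = A.1.mulVec v.1 := rfl

instance : MulAction (GL (Fin 2) R) (LaxVector R) where
  smul A := Quotient.map (fun v => A • v) (by
    rintro v w ⟨ε, h⟩
    exact ⟨ε, by rw [coe_gl_smul, coe_gl_smul, h, Matrix.mulVec_smul]⟩)
  one_smul := by
    rintro ⟨v⟩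
    exact congrArg (Quotient.mk _) (one_smul _ v)
  mul_smul A B := by
    rintro ⟨v⟩
    exact congrArg (Quotient.mk _) (mul_smul A B v)

theorem gl_smul_vec (A : GL (Fin 2) R) {x y : R} (h : IsCoprime x y) :
    A • vec x y h = vec (A 0 0 * x + A 0 1 * y) (A 1 0 * x + A 1 1 * y)
      (isCoprime_gl_mulVec A h) :=
  congrArg mk (Subtype.ext (by
    change A.1.mulVec ![x, y] = _
    ext i
    fin_cases i <;> simp [Matrix.mulVec, dotProduct]))

theorem psl_smul (A : SL(2, R)) (a : LaxVector R) :
    (QuotientGroup.mk A : PSL(2, R)) • a = (A : GL (Fin 2) R) • a := by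
  induction a using Quotient.inductionOn with
  | h v => rfl

/-- A matrix acts trivially if it fixes `(1, 0)`, `(0, 1)` and `(1, 1)`; it is a scalar then. -/
theorem exists_scalar_of_fix {A : GL (Fin 2) R} (h₁ : A • (e₁ : LaxVector R) = e₁)
    (h₂ : A • (e₂ : LaxVector R) = e₂) (h₃ : A • (e₃ : LaxVector R) = e₃) :
    A 0 1 = 0 ∧ A 1 0 = 0 ∧ A 1 1 = A 0 0 := by
  rw [e₁, gl_smul_vec, vec_eq_vec_iff] at h₁
  rw [e₂, gl_smul_vec, vec_eq_vec_iff] at h₂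
  rw [e₃, gl_smul_vec, vec_eq_vec_iff] at h₃
  obtain ⟨α, -, h₁⟩ := h₁
  obtain ⟨β, h₂, -⟩ := h₂
  obtain ⟨γ, h₃, h₃'⟩ := h₃
  have h01 : A 0 1 = 0 := by simpa using h₂.symm
  have h10 : A 1 0 = 0 := by simpa using h₁.symm
  refine ⟨h01, h10, ?_⟩
  have : (γ : R) * A 1 1 = γ * A 0 0 := by
    rw [h01] at h₃
    rw [h10] at h₃'
    linear_combination h₃ - h₃'
  exact γ.isUnit.mul_left_cancel this

theorem gl_smul_eq_self {A : GL (Fin 2) R} (h01 : A 0 1 = 0) (h10 : A 1 0 = 0)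
    (h11 : A 1 1 = A 0 0) (a : LaxVector R) : A • a = a := by
  obtain ⟨x, y, h, rfl⟩ := exists_eq_vec a
  have hd : IsUnit (A.1.det) := (Matrix.isUnit_iff_isUnit_det _).mp A.isUnit
  rw [Matrix.det_fin_two, h01, h11, zero_mul, sub_zero] at hd
  obtain ⟨ε, hε⟩ := isUnit_of_mul_isUnit_left hd
  rw [gl_smul_vec, eq_comm, vec_eq_vec_iff]
  exact ⟨ε, by rw [hε, h01]; ring, by rw [hε, h10, h11]; ring⟩

theorem gl_smul_eq_self_of_fix {A : GL (Fin 2) R} (h₁ : A • (e₁ : LaxVector R) = e₁)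
    (h₂ : A • (e₂ : LaxVector R) = e₂) (h₃ : A • (e₃ : LaxVector R) = e₃) (a : LaxVector R) :
    A • a = a :=
  let ⟨h01, h10, h11⟩ := exists_scalar_of_fix h₁ h₂ h₃
  gl_smul_eq_self h01 h10 h11 a

end LaxVector

open LaxVector

theorem isBasisPair_mk_of_basis [Nontrivial R] (v w : PrimitiveVector R) :
    (LinearIndependent R ![v.1, w.1] ∧ Submodule.span R {v.1, w.1} = ⊤) ↔
      IsUnit (v.1 0 * w.1 1 - v.1 1 * w.1 0) := by
  have h := Module.Basis.is_basis_iff_det (Pi.basisFun R (Fin 2)) (v := ![v.1, w.1])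
  rw [Matrix.range_cons, Matrix.range_cons, Matrix.range_empty, Set.union_empty,
    Set.singleton_union, Pi.basisFun_det_apply, Matrix.det_fin_two] at h
  rw [h]
  simp only [Matrix.of_apply, Matrix.cons_val_zero, Matrix.cons_val_one]

/-- Other representatives multiply the determinant by a unit, so the condition can be tested on any
of them. -/
theorem isBasisPair_vec_iff [Nontrivial R] {x y x' y' : R} {h : IsCoprime x y}
    {h' : IsCoprime x' y'} : IsBasisPair (vec x y h) (vec x' y' h') ↔ IsUnit (x * y' - y * x') := by
  constructor
  · rintro ⟨v, w, hv, hw, hb⟩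
    replace hb := (isBasisPair_mk_of_basis v w).mp hb
    rw [mk_eq_vec, vec_eq_vec_iff] at hv hw
    obtain ⟨ε, rfl, rfl⟩ := hv
    obtain ⟨δ, rfl, rfl⟩ := hw
    have := (ε * δ).isUnit.mul hb
    convert this using 1
    push_cast
    ring
  · intro hu
    exact ⟨⟨![x, y], h⟩, ⟨![x', y'], h'⟩, rfl, rfl, (isBasisPair_mk_of_basis _ _).mpr hu⟩

theorem IsBasisPair.symm [Nontrivial R] {a b : LaxVector R} (h : IsBasisPair a b) :
    IsBasisPair b a := by
  obtain ⟨x, y, hxy, rfl⟩ := exists_eq_vec a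
  obtain ⟨z, t, hzt, rfl⟩ := exists_eq_vec b
  rw [isBasisPair_vec_iff] at h ⊢
  convert h.neg using 1
  ring

theorem IsBasisPair.ne [Nontrivial R] {a b : LaxVector R} (h : IsBasisPair a b) : a ≠ b := by
  rintro rfl
  obtain ⟨x, y, hxy, rfl⟩ := exists_eq_vec a
  rw [isBasisPair_vec_iff] at h
  rw [mul_comm, sub_self] at h
  exact not_isUnit_zero h

theorem IsBasisPair.gl_smul [Nontrivial R] (A : GL (Fin 2) R) {a b : LaxVector R}
    (h : IsBasisPair a b) : IsBasisPair (A • a) (A • b) := by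
  obtain ⟨x, y, hxy, rfl⟩ := exists_eq_vec a
  obtain ⟨z, t, hzt, rfl⟩ := exists_eq_vec b
  rw [gl_smul_vec, gl_smul_vec]
  rw [isBasisPair_vec_iff] at h ⊢
  have hd : IsUnit (A.1.det) := (Matrix.isUnit_iff_isUnit_det _).mp A.isUnit
  convert hd.mul h using 1
  rw [Matrix.det_fin_two]
  ring

theorem isBasisPair_e₁_e₂ [Nontrivial R] : IsBasisPair (e₁ : LaxVector R) e₂ := by
  simp [e₁, e₂, isBasisPair_vec_iff]

theorem isBasisPair_e₁_e₃ [Nontrivial R] : IsBasisPair (e₁ : LaxVector R) e₃ := by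
  simp [e₁, e₃, isBasisPair_vec_iff]

theorem isBasisPair_e₂_e₃ [Nontrivial R] : IsBasisPair (e₂ : LaxVector R) e₃ := by
  simp [e₂, e₃, isBasisPair_vec_iff]

/-- Two lax vectors that form a basis can be moved to `(1, 0)` and `(0, 1)`, and any third one that
forms a basis with either of them to `(1, 1)` simultaneously. -/
theorem exists_gl_smul_eq [Nontrivial R] {a b c : LaxVector R} (hab : IsBasisPair a b)
    (hac : IsBasisPair a c) (hbc : IsBasisPair b c) :
    ∃ A : GL (Fin 2) R, A • e₁ = a ∧ A • e₂ = b ∧ A • e₃ = c := by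
  obtain ⟨x, y, hxy, rfl⟩ := exists_eq_vec a
  obtain ⟨z, t, hzt, rfl⟩ := exists_eq_vec b
  obtain ⟨p, q, hpq, rfl⟩ := exists_eq_vec c
  rw [isBasisPair_vec_iff] at hab hac hbc
  obtain ⟨d, hd⟩ := hab
  obtain ⟨β, hβ⟩ := hac
  obtain ⟨α, hα⟩ := hbc
  -- Cramer's rule: with `d = det(a, b)`, `β = det(a, c)`, `α = det(b, c)` one has `d c = -α a + β
  -- b`. So the columns are `-α a` and `β b`, and `(1, 1)` is sent to `d c`.
  let A : GL (Fin 2) R := Matrix.GeneralLinearGroup.mk'' !![-α * x, β * z; -α * y, β * t] (by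
    rw [Matrix.det_fin_two_of]
    convert (-α * β * d).isUnit using 1
    push_cast
    rw [hd]
    ring)
  have hA : A.1 = !![-α * x, β * z; -α * y, β * t] := rfl
  refine ⟨A, ?_, ?_, ?_⟩
  · rw [e₁, gl_smul_vec, eq_comm, vec_eq_vec_iff]
    exact ⟨-α, by simp [hA], by simp [hA]⟩
  · rw [e₂, gl_smul_vec, eq_comm, vec_eq_vec_iff]
    exact ⟨β, by simp [hA], by simp [hA]⟩
  · rw [e₃, gl_smul_vec, eq_comm, vec_eq_vec_iff]
    refine ⟨d, ?_, ?_⟩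
    · simp only [hA, Matrix.of_apply, Matrix.cons_val', Matrix.cons_val_zero, Matrix.cons_val_one,
        Matrix.cons_val_fin_one, hα, hβ, hd]
      ring
    · simp only [hA, Matrix.of_apply, Matrix.cons_val', Matrix.cons_val_zero, Matrix.cons_val_one,
        Matrix.cons_val_fin_one, hα, hβ, hd]
      ring

theorem exists_gl_smul_eq_pair [Nontrivial R] {a b : LaxVector R} (hab : IsBasisPair a b) :
    ∃ A : GL (Fin 2) R, A • e₁ = a ∧ A • e₂ = b := by
  obtain ⟨x, y, hxy, rfl⟩ := exists_eq_vec a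
  obtain ⟨z, t, hzt, rfl⟩ := exists_eq_vec b
  rw [isBasisPair_vec_iff] at hab
  let A : GL (Fin 2) R := Matrix.GeneralLinearGroup.mk'' !![x, z; y, t] (by
    rw [Matrix.det_fin_two_of]
    convert hab using 1
    ring)
  have hA : A.1 = !![x, z; y, t] := rfl
  refine ⟨A, ?_, ?_⟩
  · rw [e₁, gl_smul_vec, eq_comm, vec_eq_vec_iff]
    exact ⟨1, by simp [hA], by simp [hA]⟩
  · rw [e₂, gl_smul_vec, eq_comm, vec_eq_vec_iff]
    exact ⟨1, by simp [hA], by simp [hA]⟩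

theorem exists_gl_smul_e₁_eq (a : LaxVector R) : ∃ A : GL (Fin 2) R, A • e₁ = a := by
  obtain ⟨x, y, hxy, rfl⟩ := exists_eq_vec a
  obtain ⟨p, q, h⟩ := id hxy
  let A : GL (Fin 2) R := Matrix.GeneralLinearGroup.mk'' !![x, -q; y, p] (by
    rw [Matrix.det_fin_two_of]
    convert isUnit_one using 1
    linear_combination h)
  have hA : A.1 = !![x, -q; y, p] := rfl
  refine ⟨A, ?_⟩
  rw [e₁, gl_smul_vec, eq_comm, vec_eq_vec_iff]
  exact ⟨1, by simp [hA], by simp [hA]⟩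

/-! ### Conjugation and the antilinear reflections. -/

section Star

variable [StarRing R]

namespace LaxVector

/-- Conjugation of the coordinates. -/
def conj : LaxVector R → LaxVector R :=
  Quotient.map (fun v => ⟨fun i => star (v.1 i), v.2.map (starRingEnd R)⟩) (by
    rintro v w ⟨ε, h⟩
    exact ⟨star ε, by ext i; simp [h, Units.smul_def]⟩)

theorem conj_vec {x y : R} (h : IsCoprime x y) :
    conj (vec x y h) = vec (star x) (star y) (h.map (starRingEnd R)) :=
  congrArg mk (Subtype.ext (by ext i; fin_cases i <;> rfl))

theorem conj_conj (a : LaxVector R) : conj (conj a) = a := by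
  obtain ⟨x, y, h, rfl⟩ := exists_eq_vec a
  rw [conj_vec, conj_vec]
  exact vec_congr (star_star x) (star_star y)

/-- Conjugation of the entries of a matrix. -/
def conjGL : GL (Fin 2) R →* GL (Fin 2) R := Matrix.GeneralLinearGroup.map (starRingEnd R)

theorem conjGL_apply (A : GL (Fin 2) R) (i j : Fin 2) : conjGL A i j = star (A i j) := rfl

theorem conj_gl_smul (A : GL (Fin 2) R) (a : LaxVector R) : conj (A • a) = conjGL A • conj a := by
  obtain ⟨x, y, h, rfl⟩ := exists_eq_vec a
  rw [gl_smul_vec, conj_vec, conj_vec, gl_smul_vec]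
  simp only [conjGL_apply, star_add, star_mul']

theorem conj_e₁ : conj (e₁ : LaxVector R) = e₁ :=
  (conj_vec _).trans (vec_congr (star_one R) (star_zero R))

theorem conj_e₂ : conj (e₂ : LaxVector R) = e₂ :=
  (conj_vec _).trans (vec_congr (star_zero R) (star_one R))

theorem conj_e₃ : conj (e₃ : LaxVector R) = e₃ :=
  (conj_vec _).trans (vec_congr (star_one R) (star_one R))

/-- The matrices of the antilinear maps that induce the reflections in the walls of the standard
chamber. -/
def reflectionMatrix (u : Rˣ) : Fin 4 → GL (Fin 2) R
  | 0 => Matrix.GeneralLinearGroup.mk'' !![0, 1; 1, 0] (by simp [Matrix.det_fin_two_of])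
  | 1 => Matrix.GeneralLinearGroup.mk'' !![-1, 1; 0, 1] (by simp [Matrix.det_fin_two_of])
  | 2 => Matrix.GeneralLinearGroup.mk'' !![1, 0; 0, (u : R)] (by simp [Matrix.det_fin_two_of])
  | 3 => 1

end LaxVector

theorem IsBasisPair.conj [Nontrivial R] {a b : LaxVector R} (h : IsBasisPair a b) :
    IsBasisPair (conj a) (conj b) := by
  obtain ⟨x, y, hxy, rfl⟩ := exists_eq_vec a
  obtain ⟨z, t, hzt, rfl⟩ := exists_eq_vec b
  rw [conj_vec, conj_vec]
  rw [isBasisPair_vec_iff] at h ⊢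
  simpa [starRingEnd_apply] using h.map (starRingEnd R)

end Star

/-! ### Group actions that preserve lax bases -/

/-- An action on lax vectors that maps lax bases to lax bases. -/
class PreservesBasisPairs (W R : Type) [Group W] [CommRing R] [MulAction W (LaxVector R)] :
    Prop where
  smul : ∀ (w : W) {a b : LaxVector R}, IsBasisPair a b → IsBasisPair (w • a) (w • b)

section Action

variable {W : Type} [Group W] [MulAction W (LaxVector R)] [PreservesBasisPairs W R]

theorem IsLaxBasis.smul_of_preserves (g : W) {s : Set (LaxVector R)} (h : IsLaxBasis s) :
    IsLaxBasis (g • s) := by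
  obtain ⟨hs, a, b, rfl, h⟩ := h
  exact ⟨by rw [ncard_smul_set, hs], g • a, g • b, Set.image_pair _ _ _,
    PreservesBasisPairs.smul g h⟩

theorem IsLaxSuperbasis.smul_of_preserves (g : W) {s : Set (LaxVector R)}
    (h : IsLaxSuperbasis s) : IsLaxSuperbasis (g • s) := by
  refine ⟨by rw [ncard_smul_set, h.1], fun t ht hc => ?_⟩
  have := (h.2 (g⁻¹ • t) (Set.smul_set_subset_iff_subset_inv_smul_set.mpr (by rwa [inv_inv]))
    (by rw [ncard_smul_set, hc])).smul_of_preserves g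
  rwa [smul_inv_smul] at this

theorem IsLaxTetrabasis.smul_of_preserves (g : W) {s : Set (LaxVector R)}
    (h : IsLaxTetrabasis s) : IsLaxTetrabasis (g • s) := by
  refine ⟨by rw [ncard_smul_set, h.1], fun t ht hc => ?_⟩
  have := (h.2 (g⁻¹ • t) (Set.smul_set_subset_iff_subset_inv_smul_set.mpr (by rwa [inv_inv]))
    (by rw [ncard_smul_set, hc])).smul_of_preserves g
  rwa [smul_inv_smul] at this

theorem IsLaxCubasis.smul_of_preserves (g : W) {P : Set (Set (LaxVector R))}
    (h : IsLaxCubasis P) : IsLaxCubasis (g • P) := by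
  obtain ⟨hP, u, v, w, hu, hv, hw, rfl, h⟩ := h
  refine ⟨by rw [ncard_smul_set, hP], fun i => g • u i, fun i => g • v i, fun i => g • w i,
    fun e => hu (MulAction.injective g e), fun e => hv (MulAction.injective g e),
    fun e => hw (MulAction.injective g e), ?_, fun i j k => ?_⟩
  · simp only [Set.smul_set_insert, Set.smul_set_singleton]
  · simpa only [Set.smul_set_insert, Set.smul_set_singleton] using (h i j k).smul_of_preserves g

/-- The action on lax bases. -/
@[reducible] def laxBasisAction : MulAction W (LaxBasis R) where
  smul g s := ⟨g • s.1, s.2.smul_of_preserves g⟩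
  one_smul s := Subtype.ext (one_smul _ s.1)
  mul_smul g h s := Subtype.ext (mul_smul g h s.1)

/-- The action on lax superbases. -/
@[reducible] def laxSuperbasisAction : MulAction W (LaxSuperbasis R) where
  smul g s := ⟨g • s.1, s.2.smul_of_preserves g⟩
  one_smul s := Subtype.ext (one_smul _ s.1)
  mul_smul g h s := Subtype.ext (mul_smul g h s.1)

/-- The action on lax tetrabases. -/
@[reducible] def laxTetrabasisAction : MulAction W (LaxTetrabasis R) where
  smul g s := ⟨g • s.1, s.2.smul_of_preserves g⟩
  one_smul s := Subtype.ext (one_smul _ s.1)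
  mul_smul g h s := Subtype.ext (mul_smul g h s.1)

/-- The action on lax cubases. -/
@[reducible] def laxCubasisAction : MulAction W (LaxCubasis R) where
  smul g P := ⟨g • P.1, P.2.smul_of_preserves g⟩
  one_smul P := Subtype.ext (one_smul _ P.1)
  mul_smul g h P := Subtype.ext (mul_smul g h P.1)

/-- The action on the elements of a topograph. -/
@[reducible] def topographElemAction (Point : Type) [hP : MulAction W Point] :
    ∀ i, MulAction W (TopographElem R Point i)
  | 0 => inferInstanceAs (MulAction W (LaxVector R))
  | 1 => (laxBasisAction : MulAction W (LaxBasis R))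
  | 2 => (laxSuperbasisAction : MulAction W (LaxSuperbasis R))
  | 3 => hP

end Action

end Lax

section

/-! ### Coxeter groups acting on lax vectors -/

namespace CoxeterMatrix

theorem simple_mem_parabolic {B : Type} (M : CoxeterMatrix B) {T : Set B} {i : B} (hi : i ∈ T) :
    M.simple i ∈ M.parabolic T :=
  Subgroup.subset_closure (Set.mem_image_of_mem _ hi)

theorem parabolic_mono {B : Type} (M : CoxeterMatrix B) {T T' : Set B} (h : T ⊆ T') :
    M.parabolic T ≤ M.parabolic T' :=
  Subgroup.closure_mono (Set.image_mono h)

theorem simple_mul_mem_evenSubgroup_iff {B : Type} (M : CoxeterMatrix B) (i : B) (w : M.Group) :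
    M.simple i * w ∈ M.evenSubgroup ↔ w ∉ M.evenSubgroup := by
  have h : ∀ y : Multiplicative (ZMod 2), Multiplicative.ofAdd 1 * y = 1 ↔ ¬y = 1 := by decide
  have hs : M.toCoxeterSystem.lengthParity (M.simple i) = Multiplicative.ofAdd 1 :=
    M.toCoxeterSystem.lengthParity_simple i
  rw [evenSubgroup, MonoidHom.mem_ker, MonoidHom.mem_ker, map_mul, hs]
  exact h _

theorem simple_notMem_evenSubgroup {B : Type} (M : CoxeterMatrix B) (i : B) :
    M.simple i ∉ M.evenSubgroup := by
  have := M.simple_mul_mem_evenSubgroup_iff i 1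
  rw [mul_one] at this
  exact fun h => this.mp h (one_mem _)

end CoxeterMatrix

/-- The arithmetic of `R` used below: the units are the powers of `u`, they generate `R`
additively, `u` is not a square of a unit, and there is division with remainder. -/
structure IsTopographRing (R : Type) [CommRing R] (u : Rˣ) : Prop where
  exists_pow : ∀ ε : Rˣ, ∃ k : ℕ, ε = u ^ k
  closure_pow : AddSubgroup.closure (Set.range fun k : ℕ => ((u ^ k : Rˣ) : R)) = ⊤
  exists_remainder : ∃ N : R → ℕ, ∀ x y : R, y ≠ 0 → ∃ q, N (x - q * y) < N y
  sq_ne : ∀ ε : Rˣ, ε ^ 2 ≠ u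

/-- The Coxeter group of `M` acts faithfully on lax vectors, and its simple reflections act by the
antilinear maps `LaxVector.reflectionMatrix u`. -/
structure IsReflectionAction {R : Type} [CommRing R] [StarRing R] (u : Rˣ)
    (M : CoxeterMatrix (Fin 4)) [MulAction M.Group (LaxVector R)] : Prop where
  simple_smul : ∀ (i : Fin 4) (a : LaxVector R),
    M.simple i • a = LaxVector.reflectionMatrix u i • a.conj
  eq_one_of_forall : ∀ w : M.Group, (∀ a : LaxVector R, w • a = a) → w = 1

namespace LaxVector

variable {R : Type} [CommRing R]

/-- The diagonal matrix with entries `1` and `d`. -/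
def diagGL (d : Rˣ) : GL (Fin 2) R :=
  Matrix.GeneralLinearGroup.mk'' !![1, 0; 0, (d : R)] (by simp [Matrix.det_fin_two_of])

/-- The matrix of a transvection. -/
def translGL (b : R) : GL (Fin 2) R :=
  Matrix.GeneralLinearGroup.mk'' !![1, b; 0, 1] (by simp [Matrix.det_fin_two_of])

/-- A scalar matrix. -/
def scalarGL (d : Rˣ) : GL (Fin 2) R :=
  Matrix.GeneralLinearGroup.mk'' !![(d : R), 0; 0, (d : R)] (by
    simp [Matrix.det_fin_two_of])

theorem coe_diagGL (d : Rˣ) : (diagGL d).1 = !![1, 0; 0, (d : R)] := rfl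

theorem coe_translGL (b : R) : (translGL b).1 = !![1, b; 0, 1] := rfl

theorem coe_scalarGL (d : Rˣ) : (scalarGL d).1 = !![(d : R), 0; 0, (d : R)] := rfl

theorem scalarGL_smul (d : Rˣ) (a : LaxVector R) : scalarGL d • a = a :=
  gl_smul_eq_self rfl rfl rfl a

theorem diagGL_mul (d d' : Rˣ) : diagGL (d * d') = diagGL d * diagGL d' := by
  apply Units.ext
  rw [Units.val_mul, coe_diagGL, coe_diagGL, coe_diagGL]
  simp

theorem diagGL_pow (d : Rˣ) (k : ℕ) : diagGL (d ^ k) = diagGL d ^ k := by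
  induction k with
  | zero =>
    apply Units.ext
    rw [pow_zero, pow_zero, coe_diagGL, Units.val_one, Units.val_one, Matrix.one_fin_two]
  | succ k ih => rw [pow_succ, pow_succ, diagGL_mul, ih]

theorem translGL_add (b b' : R) : translGL (b + b') = translGL b * translGL b' := by
  apply Units.ext
  rw [Units.val_mul, coe_translGL, coe_translGL, coe_translGL]
  simp [add_comm]

theorem translGL_zero : translGL (0 : R) = 1 := by
  apply Units.ext
  rw [coe_translGL, Units.val_one, Matrix.one_fin_two]

end LaxVector

open LaxVector

namespace IsReflectionAction

set_option linter.unusedSectionVars false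

variable {R : Type} [CommRing R] [StarRing R] {u : Rˣ}
  {M : CoxeterMatrix (Fin 4)} [MulAction M.Group (LaxVector R)]

theorem eq_of_forall (h : IsReflectionAction u M) {w w' : M.Group}
    (hw : ∀ a : LaxVector R, w • a = w' • a) : w = w' := by
  have := h.eq_one_of_forall (w'⁻¹ * w) fun a => by rw [mul_smul, hw, inv_smul_smul]
  exact (inv_mul_eq_one.mp this).symm

/-- The elements of the even subgroup act linearly, the other ones antilinearly. -/
theorem linear_or_antilinear (h : IsReflectionAction u M) (w : M.Group) :
    (w ∈ M.evenSubgroup ∧ ∃ A : GL (Fin 2) R, ∀ a : LaxVector R, w • a = A • a) ∨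
    (w ∉ M.evenSubgroup ∧ ∃ A : GL (Fin 2) R, ∀ a : LaxVector R, w • a = A • a.conj) := by
  induction w using M.toCoxeterSystem.simple_induction_left with
  | one => exact Or.inl ⟨one_mem _, 1, fun a => by rw [one_smul, one_smul]⟩
  | mul_simple_left w i ih =>
    rw [M.toCoxeterSystem_simple]
    rcases ih with ⟨hw, A, hA⟩ | ⟨hw, A, hA⟩
    · refine Or.inr ⟨fun h' => (M.simple_mul_mem_evenSubgroup_iff i w).mp h' hw,
        reflectionMatrix u i * conjGL A, fun a => ?_⟩
      rw [mul_smul, hA, h.simple_smul, conj_gl_smul, mul_smul]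
    · refine Or.inl ⟨(M.simple_mul_mem_evenSubgroup_iff i w).mpr hw,
        reflectionMatrix u i * conjGL A, fun a => ?_⟩
      rw [mul_smul, hA, h.simple_smul, conj_gl_smul, conj_conj, mul_smul]

theorem preservesBasisPairs [Nontrivial R] (h : IsReflectionAction u M) :
    PreservesBasisPairs M.Group R where
  smul w a b hab := by
    rcases h.linear_or_antilinear w with ⟨-, A, hA⟩ | ⟨-, A, hA⟩
    · rw [hA, hA]; exact hab.gl_smul A
    · rw [hA, hA]; exact hab.conj.gl_smul A

/-- The invertible matrices that act like elements of the parabolic subgroup `W_T`. -/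
def linearSubgroup (R : Type) [CommRing R] (M : CoxeterMatrix (Fin 4))
    [MulAction M.Group (LaxVector R)] (T : Set (Fin 4)) : Subgroup (GL (Fin 2) R) where
  carrier := {A | ∃ w ∈ M.parabolic T, ∀ a : LaxVector R, w • a = A • a}
  one_mem' := ⟨1, one_mem _, fun a => by rw [one_smul, one_smul]⟩
  mul_mem' := by
    rintro A B ⟨w, hw, hA⟩ ⟨v, hv, hB⟩
    exact ⟨w * v, mul_mem hw hv, fun a => by rw [mul_smul, mul_smul, hA, hB]⟩
  inv_mem' := by
    rintro A ⟨w, hw, hA⟩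
    exact ⟨w⁻¹, inv_mem hw, fun a => by rw [inv_smul_eq_iff, hA, smul_inv_smul]⟩

theorem linearSubgroup_mono {T T' : Set (Fin 4)} (h : T ⊆ T') :
    linearSubgroup R M T ≤ linearSubgroup R M T' :=
  fun _ ⟨w, hw, hA⟩ => ⟨w, M.parabolic_mono h hw, hA⟩

theorem scalarGL_mem_linearSubgroup (d : Rˣ) (T : Set (Fin 4)) :
    scalarGL d ∈ linearSubgroup R M T :=
  ⟨1, one_mem _, fun a => by rw [one_smul, scalarGL_smul]⟩

theorem reflectionMatrix_mem_linearSubgroup (h : IsReflectionAction u M) {i : Fin 4}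
    {T : Set (Fin 4)} (hi : i ∈ T) (h3 : 3 ∈ T) : reflectionMatrix u i ∈ linearSubgroup R M T :=
  ⟨M.simple i * M.simple 3, mul_mem (M.simple_mem_parabolic hi) (M.simple_mem_parabolic h3),
    fun a => by
      rw [mul_smul, h.simple_smul, h.simple_smul]
      change _ • conj ((1 : GL (Fin 2) R) • conj a) = _
      rw [one_smul, conj_conj]⟩

/-- The product `s₂s₃` acts as `diag(1, u)`, and every unit is a power of `u`. -/
theorem diagGL_mem_linearSubgroup (hR : IsTopographRing R u) (h : IsReflectionAction u M) (d : Rˣ) :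
    diagGL d ∈ linearSubgroup R M {2, 3} := by
  obtain ⟨k, rfl⟩ := hR.exists_pow d
  rw [diagGL_pow]
  exact pow_mem (h.reflectionMatrix_mem_linearSubgroup (i := 2) (by simp) (by simp)) k

/-- The product `s₁s₃` differs from the transvection by 1 only by a scalar and `diag(1, -1)`.
Conjugation by diagonal matrices yields the transvections by all powers of `u`, and these powers
generate `R` additively. -/
theorem translGL_mem_linearSubgroup (hR : IsTopographRing R u) (h : IsReflectionAction u M) (b : R) :
    translGL b ∈ linearSubgroup R M {1, 2, 3} := by
  have hd (d : Rˣ) : diagGL d ∈ linearSubgroup R M {1, 2, 3} :=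
    linearSubgroup_mono (by simp) (diagGL_mem_linearSubgroup hR h d)
  have h1 : translGL (1 : R) ∈ linearSubgroup R M {1, 2, 3} := by
    have : translGL (1 : R) = scalarGL (-1) * reflectionMatrix u 1 * diagGL (-1) := by
      apply Units.ext
      rw [Units.val_mul, Units.val_mul, coe_diagGL, coe_scalarGL, coe_translGL]
      change _ = _ * !![-1, 1; 0, 1] * _
      simp
    rw [this]
    exact mul_mem (mul_mem (scalarGL_mem_linearSubgroup _ _)
      (h.reflectionMatrix_mem_linearSubgroup (by simp) (by simp))) (hd _)
  have hb : b ∈ AddSubgroup.closure (Set.range fun k : ℕ => ((u ^ k : Rˣ) : R)) :=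
    hR.closure_pow ▸ AddSubgroup.mem_top b
  induction hb using AddSubgroup.closure_induction with
  | zero => rw [translGL_zero]; exact one_mem _
  | add b b' _ _ hb hb' => rw [translGL_add]; exact mul_mem hb hb'
  | neg b _ hb =>
    have : translGL (-b) = (translGL b)⁻¹ := by
      rw [eq_inv_iff_mul_eq_one, ← translGL_add, neg_add_cancel, translGL_zero]
    rw [this]; exact inv_mem hb
  | mem b hb =>
    obtain ⟨k, rfl⟩ := hb
    have : translGL ((u ^ k : Rˣ) : R) = (diagGL (u ^ k))⁻¹ * translGL 1 * diagGL (u ^ k) := by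
      rw [mul_assoc, eq_inv_mul_iff_mul_eq]
      apply Units.ext
      rw [Units.val_mul, Units.val_mul, coe_diagGL, coe_translGL, coe_translGL]
      simp
    dsimp only
    rw [this]
    exact mul_mem (mul_mem (inv_mem (hd _)) h1) (hd _)

theorem mem_linearSubgroup_of_fix_e₁ (hR : IsTopographRing R u) (h : IsReflectionAction u M)
    {A : GL (Fin 2) R} (hA : A • (e₁ : LaxVector R) = e₁) :
    A ∈ linearSubgroup R M {1, 2, 3} := by
  rw [e₁, gl_smul_vec, vec_eq_vec_iff] at hA
  obtain ⟨α, -, hA⟩ := hA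
  have h10 : A 1 0 = 0 := by simpa using hA.symm
  have hd : IsUnit (A.1.det) := (Matrix.isUnit_iff_isUnit_det _).mp A.isUnit
  rw [Matrix.det_fin_two, h10, mul_zero, sub_zero] at hd
  obtain ⟨a, ha⟩ := isUnit_of_mul_isUnit_left hd
  obtain ⟨d, hd⟩ := isUnit_of_mul_isUnit_right hd
  obtain ⟨b, hb⟩ : ∃ b, b = A 0 1 := ⟨_, rfl⟩
  have hA' : A.1 = !![(a : R), b; 0, (d : R)] := by
    rw [Matrix.eta_fin_two A.1, h10, ha, hd, hb]
  -- A matrix fixing `e₁` up to a unit is upper triangular. After the scalar `a` is taken out, the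
  -- factors left are a transvection in `W_{1,2,3}` and a diagonal matrix in `W_{2,3}`.
  have : A = scalarGL a * translGL (b * ((d⁻¹ : Rˣ) : R)) * diagGL (a⁻¹ * d) := by
    apply Units.ext
    rw [Units.val_mul, Units.val_mul, coe_diagGL, coe_translGL, coe_scalarGL, hA',
      Matrix.mul_fin_two, Matrix.mul_fin_two]
    have hdd : (d : R) * ((d⁻¹ : Rˣ) : R) = 1 := d.mul_inv
    have haa : (a : R) * ((a⁻¹ : Rˣ) : R) = 1 := a.mul_inv
    ext i j
    fin_cases i <;> fin_cases j <;> simp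
    linear_combination (-b) * hdd - b * (d : R) * ((d⁻¹ : Rˣ) : R) * haa
  rw [this]
  exact mul_mem (mul_mem (scalarGL_mem_linearSubgroup _ _) (translGL_mem_linearSubgroup hR h _))
    (linearSubgroup_mono (by simp) (diagGL_mem_linearSubgroup hR h _))

theorem mem_linearSubgroup_of_fix_e₁_e₂ (hR : IsTopographRing R u) (h : IsReflectionAction u M)
    {A : GL (Fin 2) R} (hA : A • (e₁ : LaxVector R) = e₁) (hA' : A • (e₂ : LaxVector R) = e₂) :
    A ∈ linearSubgroup R M {2, 3} := by
  rw [e₁, gl_smul_vec, vec_eq_vec_iff] at hA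
  rw [e₂, gl_smul_vec, vec_eq_vec_iff] at hA'
  obtain ⟨α, -, hA⟩ := hA
  obtain ⟨β, hA', -⟩ := hA'
  have h10 : A 1 0 = 0 := by simpa using hA.symm
  have h01 : A 0 1 = 0 := by simpa using hA'.symm
  have hd : IsUnit (A.1.det) := (Matrix.isUnit_iff_isUnit_det _).mp A.isUnit
  rw [Matrix.det_fin_two, h10, mul_zero, sub_zero] at hd
  obtain ⟨a, ha⟩ := isUnit_of_mul_isUnit_left hd
  obtain ⟨d, hd⟩ := isUnit_of_mul_isUnit_right hd
  have : A = scalarGL a * diagGL (a⁻¹ * d) := by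
    apply Units.ext
    rw [Units.val_mul, coe_diagGL, coe_scalarGL, Matrix.eta_fin_two A.1, h10, h01, ← ha, ← hd]
    simp
  rw [this]
  exact mul_mem (scalarGL_mem_linearSubgroup _ _) (diagGL_mem_linearSubgroup hR h _)

/-- The Euclidean algorithm: the Coxeter group acts transitively on lax vectors. -/
theorem exists_smul_eq_e₁ (hR : IsTopographRing R u) (h : IsReflectionAction u M)
    (a : LaxVector R) : ∃ w : M.Group, w • a = e₁ := by
  obtain ⟨N, hN⟩ := hR.exists_remainder
  obtain ⟨x, y, hxy, rfl⟩ := exists_eq_vec a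
  induction hn : N y using Nat.strong_induction_on generalizing x y with
  | _ n ih =>
    subst hn
    by_cases hy : y = 0
    · subst hy
      obtain ⟨ε, hε⟩ := isCoprime_zero_right.mp hxy
      refine ⟨1, ?_⟩
      rw [one_smul, e₁, eq_comm, vec_eq_vec_iff]
      exact ⟨ε, by rw [hε, mul_one], by rw [mul_zero]⟩
    · obtain ⟨q, hq⟩ := hN x y hy
      -- One division step: `w` subtracts `q` times the second coordinate from the first, and `v =
      -- s₀s₃` interchanges the coordinates, so the remainder becomes the new second coordinate.
      obtain ⟨w, -, hw⟩ := translGL_mem_linearSubgroup hR h (-q)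
      obtain ⟨v, -, hv⟩ := h.reflectionMatrix_mem_linearSubgroup (i := 0) (Set.mem_univ _)
        (Set.mem_univ _)
      have h' : IsCoprime y (x - q * y) := by
        rw [isCoprime_comm, sub_eq_add_neg, ← neg_mul]
        exact IsCoprime.add_mul_right_left hxy _
      obtain ⟨w', hw'⟩ := ih _ hq y (x - q * y) h' rfl
      refine ⟨w' * v * w, ?_⟩
      have h1 : translGL (-q) • vec x y hxy = vec (x - q * y) y h'.symm := by
        rw [gl_smul_vec]
        change vec ((1 : R) * _ + -q * _) (0 * _ + 1 * _) _ = _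
        apply vec_congr <;> simp
        ring
      have h2 : reflectionMatrix u 0 • vec (x - q * y) y h'.symm = vec y (x - q * y) h' := by
        rw [gl_smul_vec]
        change vec ((0 : R) * _ + 1 * _) (1 * _ + 0 * _) _ = _
        apply vec_congr <;> simp
      rw [mul_smul, mul_smul, hw, h1, hv, h2, hw']

/-- By transitivity some group element brings `A • e₁` back to `e₁`. It may be taken linear, after
composition with `s₃` if necessary, since conjugation fixes `e₁`. The remaining matrix fixes `e₁`
and is already known to come from the group. -/
theorem mem_linearSubgroup_univ (hR : IsTopographRing R u) (h : IsReflectionAction u M)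
    (A : GL (Fin 2) R) : A ∈ linearSubgroup R M Set.univ := by
  have key : ∃ B ∈ linearSubgroup R M Set.univ, B • A • (e₁ : LaxVector R) = e₁ := by
    obtain ⟨w, hw⟩ := h.exists_smul_eq_e₁ hR (A • e₁)
    have hpar (w : M.Group) : w ∈ M.parabolic Set.univ := by
      rw [CoxeterMatrix.parabolic, Set.image_univ]
      exact M.toCoxeterSystem.subgroup_closure_range_simple ▸ Subgroup.mem_top w
    rcases h.linear_or_antilinear w with ⟨-, B, hB⟩ | ⟨-, B, hB⟩
    · exact ⟨B, ⟨w, hpar w, hB⟩, by rw [← hB, hw]⟩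
    · have h3 (a : LaxVector R) : M.simple 3 • a = conj a := by
        rw [h.simple_smul]; exact one_smul _ _
      refine ⟨conjGL B, ⟨M.simple 3 * w, hpar _, fun a => ?_⟩, ?_⟩
      · rw [mul_smul, hB, h3, conj_gl_smul, conj_conj]
      · rw [← conj_conj (A • e₁), ← conj_gl_smul, ← hB, hw, conj_e₁]
  obtain ⟨B, hB, hBA⟩ := key
  rw [← mul_smul] at hBA
  exact (Subgroup.mul_mem_cancel_left _ hB).mp
    (linearSubgroup_mono (Set.subset_univ _) (mem_linearSubgroup_of_fix_e₁ hR h hBA))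

end IsReflectionAction

end

section

/-! ### The geometry of a topograph -/

open LaxVector

section Superbasis

variable {R : Type} [CommRing R] [Nontrivial R]

theorem IsBasisPair.isLaxBasis {a b : LaxVector R} (h : IsBasisPair a b) : IsLaxBasis {a, b} :=
  ⟨Set.ncard_pair h.ne, a, b, rfl, h⟩

theorem IsLaxBasis.isBasisPair {s : Set (LaxVector R)} (hs : IsLaxBasis s) {a b : LaxVector R}
    (ha : a ∈ s) (hb : b ∈ s) (hab : a ≠ b) : IsBasisPair a b := by
  obtain ⟨-, x, y, rfl, h⟩ := hs
  rcases ha with rfl | rfl <;> rcases hb with rfl | rfl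
  · exact absurd rfl hab
  · exact h
  · exact h.symm
  · exact absurd rfl hab

theorem IsLaxSuperbasis.isBasisPair {s : Set (LaxVector R)} (hs : IsLaxSuperbasis s)
    {a b : LaxVector R} (ha : a ∈ s) (hb : b ∈ s) (hab : a ≠ b) : IsBasisPair a b :=
  (hs.2 {a, b} (Set.pair_subset ha hb) (Set.ncard_pair hab)).isBasisPair (Set.mem_insert _ _)
    (Set.mem_insert_of_mem _ rfl) hab

theorem isLaxSuperbasis_of_isBasisPair {a b c : LaxVector R} (hab : IsBasisPair a b)
    (hac : IsBasisPair a c) (hbc : IsBasisPair b c) : IsLaxSuperbasis {a, b, c} := by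
  refine ⟨Set.ncard_eq_three.mpr ⟨a, b, c, hab.ne, hac.ne, hbc.ne, rfl⟩, fun t ht hc => ?_⟩
  obtain ⟨x, y, hxy, rfl⟩ := Set.ncard_eq_two.mp hc
  refine IsBasisPair.isLaxBasis ?_
  have hx : x ∈ ({a, b, c} : Set (LaxVector R)) := ht (Set.mem_insert _ _)
  have hy : y ∈ ({a, b, c} : Set (LaxVector R)) := ht (Set.mem_insert_of_mem _ rfl)
  rcases hx with rfl | rfl | rfl <;> rcases hy with rfl | rfl | rfl <;>
    first
    | exact absurd rfl hxy
    | assumption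
    | exact IsBasisPair.symm (by assumption)

end Superbasis

section Action

variable {R W Point : Type} [CommRing R] [Group W] [MulAction W (LaxVector R)]
  [PreservesBasisPairs W R] [MulAction W Point] {vec : Point → Set (LaxVector R)}

attribute [local instance] topographElemAction

theorem TopographElem.vectors_smul_of_preserves (hvec : ∀ (w : W) p, vec (w • p) = w • vec p)
    (w : W) {i : Fin 4} (x : TopographElem R Point i) :
    vectors vec (w • x) = w • vectors vec x := by
  match i, x with
  | 0, a => exact (Set.smul_set_singleton (α := W) (β := LaxVector R)).symm
  | 1, s => rfl
  | 2, s => rfl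
  | 3, p => exact hvec w p

theorem TopographElem.vectors_injective {i : Fin 4} (hi : i ≠ 3) (x y : TopographElem R Point i)
    (h : vectors vec x = vectors vec y) : x = y := by
  match i, x, y with
  | 0, a, b => exact Set.singleton_injective h
  | 1, s, t => exact Subtype.ext h
  | 2, s, t => exact Subtype.ext h
  | 3, p, q => exact absurd rfl hi

theorem TopographElem.ncard_vectors {i : Fin 4} (hi : i ≠ 3) (x : TopographElem R Point i) :
    (vectors vec x).ncard = i + 1 := by
  match i, x with
  | 0, a => exact Set.ncard_singleton _
  | 1, s => exact s.2.1
  | 2, s => exact s.2.1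
  | 3, p => exact absurd rfl hi

end Action

/-- The properties of the points of the topograph that make it a Coxeter geometry: `base` is one of
the two points containing the standard superbasis. -/
structure IsTopographPoint {R Point : Type} [CommRing R] (M : CoxeterMatrix (Fin 4))
    [MulAction M.Group (LaxVector R)] [MulAction M.Group Point] [MulAction PSL(2, R) Point]
    (vec : Point → Set (LaxVector R)) (base : Point) : Prop where
  vec_smul : ∀ (w : M.Group) (p : Point), vec (w • p) = w • vec p
  psl_smul : ∀ (g : PSL(2, R)) (w : M.Group), (∀ a : LaxVector R, g • a = w • a) →
    ∀ p : Point, g • p = w • p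
  e₁_mem : e₁ ∈ vec base
  e₂_mem : e₂ ∈ vec base
  e₃_mem : e₃ ∈ vec base
  simple_smul : ∀ i, i ≠ 3 → M.simple i • base = base
  simple_three_smul : M.simple 3 • base ≠ base
  exists_superbasis : ∀ p : Point, ∃ a ∈ vec p, ∃ b ∈ vec p, ∃ c ∈ vec p,
    IsBasisPair a b ∧ IsBasisPair a c ∧ IsBasisPair b c
  eq_or_eq : ∀ p : Point, e₁ ∈ vec p → e₂ ∈ vec p → e₃ ∈ vec p →
    p = base ∨ p = M.simple 3 • base
  exists_smul_eq_e₁ : ∀ a ∈ vec base, ∃ w ∈ M.parabolic {0, 1, 2}, w • a = e₁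
  exists_smul_eq_e₂ : ∀ a ∈ vec base, IsBasisPair e₁ a → ∃ w ∈ M.parabolic {1, 2}, w • a = e₂
  exists_smul_eq_e₃ : ∀ a ∈ vec base, IsBasisPair e₁ a → IsBasisPair e₂ a →
    ∃ w ∈ M.parabolic {2}, w • a = e₃

theorem smul_eq_of_mem_parabolic {M : CoxeterMatrix (Fin 4)} {α : Type} [MulAction M.Group α]
    {T : Set (Fin 4)} {x : α} (hT : ∀ i ∈ T, M.simple i • x = x) {w : M.Group}
    (hw : w ∈ M.parabolic T) : w • x = x := by
  have : M.parabolic T ≤ MulAction.stabilizer M.Group x := by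
    rw [CoxeterMatrix.parabolic, Subgroup.closure_le]
    rintro _ ⟨i, hi, rfl⟩
    exact hT i hi
  exact this hw

namespace IsReflectionAction

variable {R : Type} [CommRing R] [StarRing R] {u : Rˣ}
  {M : CoxeterMatrix (Fin 4)} [MulAction M.Group (LaxVector R)]

theorem simple_zero_smul_vec_eq_iff (h : IsReflectionAction u M) {x y x' y' : R}
    {hxy : IsCoprime x y} {hxy' : IsCoprime x' y'} :
    M.simple 0 • vec x y hxy = vec x' y' hxy' ↔
      ∃ ε : Rˣ, x' = ε * star y ∧ y' = ε * star x := by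
  rw [h.simple_smul, conj_vec, gl_smul_vec, vec_eq_vec_iff]
  change (∃ ε : Rˣ, _ = (ε : R) * ((0 : R) * _ + 1 * _) ∧ _ = (ε : R) * (1 * _ + 0 * _)) ↔ _
  simp only [zero_mul, one_mul, zero_add, add_zero]

theorem simple_one_smul_vec_eq_iff (h : IsReflectionAction u M) {x y x' y' : R}
    {hxy : IsCoprime x y} {hxy' : IsCoprime x' y'} :
    M.simple 1 • vec x y hxy = vec x' y' hxy' ↔
      ∃ ε : Rˣ, x' = ε * (-star x + star y) ∧ y' = ε * star y := by
  rw [h.simple_smul, conj_vec, gl_smul_vec, vec_eq_vec_iff]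
  change (∃ ε : Rˣ, _ = (ε : R) * ((-1 : R) * _ + 1 * _) ∧ _ = (ε : R) * (0 * _ + 1 * _)) ↔ _
  simp only [zero_mul, one_mul, zero_add, neg_mul]

theorem simple_two_smul_vec_eq_iff (h : IsReflectionAction u M) {x y x' y' : R}
    {hxy : IsCoprime x y} {hxy' : IsCoprime x' y'} :
    M.simple 2 • vec x y hxy = vec x' y' hxy' ↔
      ∃ ε : Rˣ, x' = ε * star x ∧ y' = ε * (u * star y) := by
  rw [h.simple_smul, conj_vec, gl_smul_vec, vec_eq_vec_iff]
  change (∃ ε : Rˣ, _ = (ε : R) * ((1 : R) * _ + 0 * _) ∧ _ = (ε : R) * (0 * _ + u * _)) ↔ _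
  simp only [zero_mul, one_mul, zero_add, add_zero]

theorem simple_three_smul (h : IsReflectionAction u M) (a : LaxVector R) :
    M.simple 3 • a = conj a := by
  rw [h.simple_smul]; exact one_smul _ _

theorem simple_three_smul_vec_eq_iff (h : IsReflectionAction u M) {x y x' y' : R}
    {hxy : IsCoprime x y} {hxy' : IsCoprime x' y'} :
    M.simple 3 • vec x y hxy = vec x' y' hxy' ↔
      ∃ ε : Rˣ, x' = ε * star x ∧ y' = ε * star y := by
  rw [h.simple_three_smul, conj_vec, vec_eq_vec_iff]

theorem simple_zero_smul_e₁ (h : IsReflectionAction u M) :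
    M.simple 0 • (e₁ : LaxVector R) = e₂ :=
  h.simple_zero_smul_vec_eq_iff.mpr ⟨1, by simp, by simp⟩

theorem simple_zero_smul_e₂ (h : IsReflectionAction u M) :
    M.simple 0 • (e₂ : LaxVector R) = e₁ :=
  h.simple_zero_smul_vec_eq_iff.mpr ⟨1, by simp, by simp⟩

theorem simple_zero_smul_e₃ (h : IsReflectionAction u M) :
    M.simple 0 • (e₃ : LaxVector R) = e₃ :=
  h.simple_zero_smul_vec_eq_iff.mpr ⟨1, by simp, by simp⟩

theorem simple_one_smul_e₁ (h : IsReflectionAction u M) :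
    M.simple 1 • (e₁ : LaxVector R) = e₁ :=
  h.simple_one_smul_vec_eq_iff.mpr ⟨-1, by simp, by simp⟩

theorem simple_one_smul_e₂ (h : IsReflectionAction u M) :
    M.simple 1 • (e₂ : LaxVector R) = e₃ :=
  h.simple_one_smul_vec_eq_iff.mpr ⟨1, by simp, by simp⟩

theorem simple_one_smul_e₃ (h : IsReflectionAction u M) :
    M.simple 1 • (e₃ : LaxVector R) = e₂ :=
  h.simple_one_smul_vec_eq_iff.mpr ⟨1, by simp, by simp⟩

theorem simple_two_smul_e₁ (h : IsReflectionAction u M) :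
    M.simple 2 • (e₁ : LaxVector R) = e₁ :=
  h.simple_two_smul_vec_eq_iff.mpr ⟨1, by simp, by simp⟩

theorem simple_two_smul_e₂ (h : IsReflectionAction u M) :
    M.simple 2 • (e₂ : LaxVector R) = e₂ :=
  h.simple_two_smul_vec_eq_iff.mpr ⟨u⁻¹, by simp, by simp⟩

theorem simple_three_smul_e₁ (h : IsReflectionAction u M) :
    M.simple 3 • (e₁ : LaxVector R) = e₁ := by rw [h.simple_three_smul, conj_e₁]

theorem simple_three_smul_e₂ (h : IsReflectionAction u M) :
    M.simple 3 • (e₂ : LaxVector R) = e₂ := by rw [h.simple_three_smul, conj_e₂]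

theorem simple_three_smul_e₃ (h : IsReflectionAction u M) :
    M.simple 3 • (e₃ : LaxVector R) = e₃ := by rw [h.simple_three_smul, conj_e₃]

theorem parabolic_smul_e₁ (h : IsReflectionAction u M) {w : M.Group} {T : Set (Fin 4)}
    (hT : 0 ∉ T) (hw : w ∈ M.parabolic T) : w • (e₁ : LaxVector R) = e₁ :=
  smul_eq_of_mem_parabolic (fun i hi => by
    match i, hi with
    | 0, hi => exact absurd hi hT
    | 1, _ => exact h.simple_one_smul_e₁
    | 2, _ => exact h.simple_two_smul_e₁
    | 3, _ => exact h.simple_three_smul_e₁) hw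

theorem parabolic_smul_e₂ (h : IsReflectionAction u M) {w : M.Group} {T : Set (Fin 4)}
    (hT : 0 ∉ T) (hT' : 1 ∉ T) (hw : w ∈ M.parabolic T) : w • (e₂ : LaxVector R) = e₂ :=
  smul_eq_of_mem_parabolic (fun i hi => by
    match i, hi with
    | 0, hi => exact absurd hi hT
    | 1, hi => exact absurd hi hT'
    | 2, _ => exact h.simple_two_smul_e₂
    | 3, _ => exact h.simple_three_smul_e₂) hw

/-- The only elements that fix the standard superbasis vector by vector are the identity and
`s₃`. -/
theorem eq_one_or_eq_of_fix (h : IsReflectionAction u M) {w : M.Group}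
    (h₁ : w • (e₁ : LaxVector R) = e₁) (h₂ : w • (e₂ : LaxVector R) = e₂)
    (h₃ : w • (e₃ : LaxVector R) = e₃) : w = 1 ∨ w = M.simple 3 := by
  rcases h.linear_or_antilinear w with ⟨-, A, hA⟩ | ⟨-, A, hA⟩
  · left
    rw [hA] at h₁ h₂ h₃
    exact h.eq_one_of_forall w fun a => by rw [hA, gl_smul_eq_self_of_fix h₁ h₂ h₃]
  · right
    rw [hA, conj_e₁] at h₁
    rw [hA, conj_e₂] at h₂
    rw [hA, conj_e₃] at h₃
    exact h.eq_of_forall fun a => by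
      rw [hA, gl_smul_eq_self_of_fix h₁ h₂ h₃, h.simple_three_smul]

theorem mem_parabolic_of_linear (h : IsReflectionAction u M) {T : Set (Fin 4)} {w : M.Group}
    {A : GL (Fin 2) R} (hA : A ∈ linearSubgroup R M T) (hw : ∀ a : LaxVector R, w • a = A • a) :
    w ∈ M.parabolic T := by
  obtain ⟨v, hv, hvA⟩ := hA
  rw [h.eq_of_forall fun a => (hw a).trans (hvA a).symm]
  exact hv

theorem mem_parabolic_of_antilinear (h : IsReflectionAction u M) {T : Set (Fin 4)} {w : M.Group}
    {A : GL (Fin 2) R} (hT : 3 ∈ T) (hA : A ∈ linearSubgroup R M T)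
    (hw : ∀ a : LaxVector R, w • a = A • a.conj) : w ∈ M.parabolic T := by
  have := h.mem_parabolic_of_linear (w := w * M.simple 3) hA fun a => by
    rw [mul_smul, hw, h.simple_three_smul, conj_conj]
  exact (Subgroup.mul_mem_cancel_right _ (M.simple_mem_parabolic hT)).mp this

theorem mem_parabolic_of_fix_e₁ (hR : IsTopographRing R u) (h : IsReflectionAction u M)
    {w : M.Group} (hw : w • (e₁ : LaxVector R) = e₁) : w ∈ M.parabolic {1, 2, 3} := by
  rcases h.linear_or_antilinear w with ⟨-, A, hA⟩ | ⟨-, A, hA⟩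
  · rw [hA] at hw
    exact h.mem_parabolic_of_linear (mem_linearSubgroup_of_fix_e₁ hR h hw) hA
  · rw [hA, conj_e₁] at hw
    exact h.mem_parabolic_of_antilinear (by simp) (mem_linearSubgroup_of_fix_e₁ hR h hw) hA

theorem mem_parabolic_of_fix_e₁_e₂ (hR : IsTopographRing R u) (h : IsReflectionAction u M)
    {w : M.Group} (hw : w • (e₁ : LaxVector R) = e₁) (hw' : w • (e₂ : LaxVector R) = e₂) :
    w ∈ M.parabolic {2, 3} := by
  rcases h.linear_or_antilinear w with ⟨-, A, hA⟩ | ⟨-, A, hA⟩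
  · rw [hA] at hw hw'
    exact h.mem_parabolic_of_linear (mem_linearSubgroup_of_fix_e₁_e₂ hR h hw hw') hA
  · rw [hA, conj_e₁] at hw
    rw [hA, conj_e₂] at hw'
    exact h.mem_parabolic_of_antilinear (by simp) (mem_linearSubgroup_of_fix_e₁_e₂ hR h hw hw') hA

theorem exists_smul_eq_gl_smul (hR : IsTopographRing R u) (h : IsReflectionAction u M)
    (A : GL (Fin 2) R) : ∃ w : M.Group, ∀ a : LaxVector R, w • a = A • a :=
  let ⟨w, _, hw⟩ := mem_linearSubgroup_univ hR h A
  ⟨w, hw⟩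

/-! ### The embedding of `PSL(2, R)` and its image -/

theorem exists_smul_eq_psl_smul (hR : IsTopographRing R u) (h : IsReflectionAction u M)
    (g : PSL(2, R)) : ∃ w : M.Group, ∀ a : LaxVector R, g • a = w • a := by
  induction g using QuotientGroup.induction_on with
  | H A =>
    obtain ⟨w, hw⟩ := exists_smul_eq_gl_smul hR h (A : GL (Fin 2) R)
    exact ⟨w, fun a => by rw [psl_smul, hw]⟩

/-- The homomorphism from `PSL(2, R)` to the Coxeter group. -/
def pslHom (hR : IsTopographRing R u) (h : IsReflectionAction u M) : PSL(2, R) →* M.Group where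
  -- Faithfulness leaves only one possible choice, which makes the map multiplicative.
  toFun g := (exists_smul_eq_psl_smul hR h g).choose
  map_one' := h.eq_of_forall fun a => by
    rw [← (exists_smul_eq_psl_smul hR h 1).choose_spec, one_smul, one_smul]
  map_mul' g g' := h.eq_of_forall fun a => by
    rw [← (exists_smul_eq_psl_smul hR h (g * g')).choose_spec, mul_smul, mul_smul,
      ← (exists_smul_eq_psl_smul hR h g').choose_spec,
      ← (exists_smul_eq_psl_smul hR h g).choose_spec]

theorem pslHom_smul (hR : IsTopographRing R u) (h : IsReflectionAction u M) (g : PSL(2, R))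
    (a : LaxVector R) : pslHom hR h g • a = g • a :=
  ((exists_smul_eq_psl_smul hR h g).choose_spec a).symm

theorem pslHom_injective (hR : IsTopographRing R u) (h : IsReflectionAction u M) :
    Function.Injective (pslHom hR h) := by
  rw [injective_iff_map_eq_one]
  intro g hg
  have hg' (a : LaxVector R) : g • a = a := by rw [← pslHom_smul hR h, hg, one_smul]
  induction g using QuotientGroup.induction_on with
  | H A =>
    simp_rw [psl_smul] at hg'
    obtain ⟨h01, h10, h11⟩ := exists_scalar_of_fix (hg' e₁) (hg' e₂) (hg' e₃)
    replace h01 : A 0 1 = 0 := h01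
    replace h10 : A 1 0 = 0 := h10
    replace h11 : A 1 1 = A 0 0 := h11
    refine (QuotientGroup.eq_one_iff A).mpr (Matrix.SpecialLinearGroup.mem_center_iff.mpr
      ⟨A 0 0, ?_, ?_⟩)
    · have := A.det_coe
      rw [Matrix.det_fin_two, h01, h11] at this
      rw [Fintype.card_fin]
      linear_combination this
    · ext i j
      fin_cases i <;> fin_cases j <;> simp [h01, h10, h11]

/-- If an element acted both linearly and antilinearly, conjugation would be induced by a matrix.
That matrix fixes `e₁`, `e₂`, `e₃`, so it acts trivially, and faithfulness would give `s₃ = 1`,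
although `s₃` is odd. -/
theorem pslHom_range_le (hR : IsTopographRing R u) (h : IsReflectionAction u M) :
    (pslHom hR h).range ≤ M.evenSubgroup := by
  rintro _ ⟨g, rfl⟩
  rcases h.linear_or_antilinear (pslHom hR h g) with ⟨hw, -⟩ | ⟨-, B, hB⟩
  · exact hw
  exfalso
  induction g using QuotientGroup.induction_on with
  | H A =>
    have hBA (a : LaxVector R) : B • a.conj = (A : GL (Fin 2) R) • a := by
      rw [← hB, pslHom_smul, psl_smul]
    have hfix (a : LaxVector R) : ((A : GL (Fin 2) R)⁻¹ * B) • a.conj = a := by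
      rw [mul_smul, hBA, inv_smul_smul]
    have h1 := hfix e₁
    have h2 := hfix e₂
    have h3 := hfix e₃
    rw [conj_e₁] at h1
    rw [conj_e₂] at h2
    rw [conj_e₃] at h3
    have hs : M.simple 3 = 1 := h.eq_one_of_forall _ fun a => by
      conv_rhs => rw [← hfix a, gl_smul_eq_self_of_fix h1 h2 h3]
      rw [h.simple_three_smul]
    exact M.simple_notMem_evenSubgroup 3 (hs ▸ one_mem _)

/-- A linear transformation lies in the image of `PSL(2, R)` if and only if its determinant is the
square of a unit. -/
theorem mem_pslHom_range_iff (hR : IsTopographRing R u) (h : IsReflectionAction u M) {w : M.Group}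
    {A : GL (Fin 2) R} (hw : ∀ a : LaxVector R, w • a = A • a) :
    w ∈ (pslHom hR h).range ↔ ∃ ε : Rˣ, ε ^ 2 = Matrix.GeneralLinearGroup.det A := by
  constructor
  · rintro ⟨g, rfl⟩
    induction g using QuotientGroup.induction_on with
    | H B =>
      -- The matrix `B⁻¹A` is scalar, so its determinant is a square; it equals `det A` because `det
      -- B = 1`.
      have hfix (a : LaxVector R) : ((B : GL (Fin 2) R)⁻¹ * A) • a = a := by
        rw [mul_smul, ← hw, pslHom_smul, psl_smul, inv_smul_smul]
      obtain ⟨h01, h10, h11⟩ := exists_scalar_of_fix (hfix e₁) (hfix e₂) (hfix e₃)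
      have hdet : Matrix.GeneralLinearGroup.det ((B : GL (Fin 2) R)⁻¹ * A) =
          Matrix.GeneralLinearGroup.det A := by
        rw [map_mul, map_inv]
        have : Matrix.GeneralLinearGroup.det (B : GL (Fin 2) R) = 1 := Units.ext B.det_coe
        rw [this, inv_one, one_mul]
      have hd := (Matrix.GeneralLinearGroup.det ((B : GL (Fin 2) R)⁻¹ * A)).isUnit
      have hd' : (Matrix.GeneralLinearGroup.det ((B : GL (Fin 2) R)⁻¹ * A) : R) =
          ((B : GL (Fin 2) R)⁻¹ * A) 0 0 * ((B : GL (Fin 2) R)⁻¹ * A) 0 0 := by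
        change Matrix.det _ = _
        rw [Matrix.det_fin_two, h01, h11]
        ring
      rw [hd'] at hd
      obtain ⟨ε, hε⟩ := isUnit_of_mul_isUnit_left hd
      exact ⟨ε, by rw [← hdet]; exact Units.ext (by rw [hd', ← hε, Units.val_pow_eq_pow_val, sq])⟩
  · rintro ⟨ε, hε⟩
    have hε' : Matrix.det A.1 = (ε : R) ^ 2 := by
      rw [← Units.val_pow_eq_pow_val, hε]; rfl
    let B : SL(2, R) := ⟨((ε⁻¹ : Rˣ) : R) • A.1, by
      rw [Matrix.det_smul, Fintype.card_fin, hε', ← mul_pow, Units.inv_mul, one_pow]⟩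
    refine ⟨QuotientGroup.mk B, h.eq_of_forall fun a => ?_⟩
    rw [pslHom_smul, psl_smul, hw]
    have : A = scalarGL ε * (B : GL (Fin 2) R) := by
      apply Units.ext
      rw [Units.val_mul, coe_scalarGL]
      change A.1 = _ * (((ε⁻¹ : Rˣ) : R) • A.1)
      ext i j
      fin_cases i <;> fin_cases j <;> simp [Matrix.mul_apply]
    rw [this, mul_smul, scalarGL_smul]

/-- The determinant modulo squares of units decides membership in the image. The units modulo
squares have order two, being generated by the nonsquare `u`. The nontrivial coset is represented by
`s₂s₃`, which acts as `diag(1, u)` and has determinant `u`. -/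
theorem pslHom_relIndex (hR : IsTopographRing R u) (h : IsReflectionAction u M) :
    (pslHom hR h).range.relIndex M.evenSubgroup = 2 := by
  obtain ⟨v, hv⟩ := exists_smul_eq_gl_smul hR h (diagGL u)
  have hdv : Matrix.GeneralLinearGroup.det (diagGL u) = u := Units.ext (by
    change Matrix.det (diagGL u).1 = _
    rw [coe_diagGL, Matrix.det_fin_two_of]
    ring)
  have hve : v ∈ M.evenSubgroup := by
    have : v = M.simple 2 * M.simple 3 := h.eq_of_forall fun a => by
      rw [hv, mul_smul, h.simple_smul, h.simple_three_smul, conj_conj]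
      rfl
    rw [this, M.simple_mul_mem_evenSubgroup_iff]
    exact M.simple_notMem_evenSubgroup 3
  rw [Subgroup.relIndex, Subgroup.index_eq_two_iff]
  refine ⟨⟨v, hve⟩, fun ⟨w, hwe⟩ => ?_⟩
  obtain ⟨-, A, hA⟩ : w ∈ M.evenSubgroup ∧ ∃ A : GL (Fin 2) R, ∀ a : LaxVector R, w • a = A • a :=
    (h.linear_or_antilinear w).resolve_right fun h' => h'.1 hwe
  have hAv (a : LaxVector R) : (w * v) • a = (A * diagGL u) • a := by
    rw [mul_smul, mul_smul, hv, hA]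
  rw [Subgroup.mem_subgroupOf, Subgroup.mem_subgroupOf, Subgroup.coe_mul]
  dsimp only
  rw [mem_pslHom_range_iff hR h hA, mem_pslHom_range_iff hR h hAv, map_mul, hdv]
  obtain ⟨k, hk⟩ := hR.exists_pow (Matrix.GeneralLinearGroup.det A)
  rw [hk]
  have hodd (m : ℕ) : ¬∃ ε : Rˣ, ε ^ 2 = u ^ (2 * m + 1) := by
    rintro ⟨ε, hε⟩
    refine hR.sq_ne (ε * (u ^ m)⁻¹) ?_
    rw [mul_pow, hε, inv_pow, ← pow_mul, pow_succ, mul_comm m 2, mul_comm, inv_mul_cancel_left]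
  rcases Nat.even_or_odd' k with ⟨m, rfl | rfl⟩
  · exact Or.inr ⟨⟨u ^ m, by rw [← pow_mul, mul_comm]⟩, by rw [← pow_succ]; exact hodd m⟩
  · exact Or.inl ⟨⟨u ^ (m + 1), by rw [← pow_mul, ← pow_succ]; congr 1; ring⟩, hodd m⟩

end IsReflectionAction

end

section

set_option linter.unusedSectionVars false

/-! ### Topographs as Coxeter geometries -/

attribute [local instance] topographElemAction

open LaxVector TopographElem

variable {R Point : Type} [CommRing R] [StarRing R] [Nontrivial R] {u : Rˣ}
  {M : CoxeterMatrix (Fin 4)} [MulAction M.Group (LaxVector R)] [PreservesBasisPairs M.Group R]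
  [MulAction M.Group Point] [MulAction PSL(2, R) Point]
  {vec : Point → Set (LaxVector R)} {base : Point}

/-- The standard chamber of a topograph. -/
def standardChamber (R : Type) [CommRing R] [Nontrivial R] {Point : Type} (base : Point) :
    ∀ i, TopographElem R Point i
  | 0 => (e₁ : LaxVector R)
  | 1 => (⟨{e₁, e₂}, isBasisPair_e₁_e₂.isLaxBasis⟩ : LaxBasis R)
  | 2 => (⟨{e₁, e₂, e₃}, isLaxSuperbasis_of_isBasisPair isBasisPair_e₁_e₂ isBasisPair_e₁_e₃
      isBasisPair_e₂_e₃⟩ : LaxSuperbasis R)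
  | 3 => base

namespace IsTopographPoint

/-- A matrix carries the standard superbasis to `a`, `b`, `c`. Pulling `p` back gives one of the two
points over the standard superbasis; if it is the wrong one, `s₃` corrects it without moving `e₁`,
`e₂`, `e₃`. -/
theorem exists_smul_eq_of_mem (hp : IsTopographPoint M vec base) (hR : IsTopographRing R u)
    (h : IsReflectionAction u M) {a b c : LaxVector R} {p : Point} (ha : a ∈ vec p) (hb : b ∈ vec p)
    (hc : c ∈ vec p) (hab : IsBasisPair a b) (hac : IsBasisPair a c) (hbc : IsBasisPair b c) :
    ∃ w : M.Group, w • e₁ = a ∧ w • e₂ = b ∧ w • e₃ = c ∧ w • base = p := by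
  obtain ⟨A, rfl, rfl, rfl⟩ := exists_gl_smul_eq hab hac hbc
  obtain ⟨w, hw⟩ := h.exists_smul_eq_gl_smul hR A
  simp_rw [← hw] at ha hb hc ⊢
  have hmem {x : LaxVector R} (hx : w • x ∈ vec p) : x ∈ vec (w⁻¹ • p) := by
    rw [hp.vec_smul, Set.mem_inv_smul_set_iff]
    exact hx
  rcases hp.eq_or_eq (w⁻¹ • p) (hmem ha) (hmem hb) (hmem hc) with h1 | h1
  · exact ⟨w, rfl, rfl, rfl, by rw [← h1, smul_inv_smul]⟩
  · exact ⟨w * M.simple 3, by rw [mul_smul, h.simple_three_smul_e₁],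
      by rw [mul_smul, h.simple_three_smul_e₂], by rw [mul_smul, h.simple_three_smul_e₃],
      by rw [mul_smul, ← h1, smul_inv_smul]⟩

theorem exists_smul_base_eq (hp : IsTopographPoint M vec base) (hR : IsTopographRing R u)
    (h : IsReflectionAction u M) (p : Point) : ∃ w : M.Group, w • base = p := by
  obtain ⟨a, ha, b, hb, c, hc, hab, hac, hbc⟩ := hp.exists_superbasis p
  obtain ⟨w, -, -, -, hw⟩ := hp.exists_smul_eq_of_mem hR h ha hb hc hab hac hbc
  exact ⟨w, hw⟩

theorem exists_mem_vectors (hp : IsTopographPoint M vec base) {i : Fin 4}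
    (x : TopographElem R Point i) : ∃ a, a ∈ vectors vec x := by
  match i, x with
  | 0, a => exact ⟨a, rfl⟩
  | 1, ⟨s, hs⟩ =>
    obtain ⟨-, a, b, rfl, -⟩ := hs
    exact ⟨a, Set.mem_insert _ _⟩
  | 2, ⟨s, hs⟩ =>
    obtain ⟨a, b, c, -, -, -, rfl⟩ := Set.ncard_eq_three.mp hs.1
    exact ⟨a, Set.mem_insert _ _⟩
  | 3, p =>
    obtain ⟨a, ha, -⟩ := hp.exists_superbasis p
    exact ⟨a, ha⟩

theorem parabolic_smul_base (hp : IsTopographPoint M vec base) {w : M.Group} {T : Set (Fin 4)}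
    (hT : 3 ∉ T) (hw : w ∈ M.parabolic T) : w • base = base :=
  smul_eq_of_mem_parabolic (fun i hi => hp.simple_smul i fun h3 => hT (h3 ▸ hi)) hw

theorem smul_mem_vec_base (hp : IsTopographPoint M vec base) {w : M.Group} (hw : w • base = base)
    {a : LaxVector R} : w • a ∈ vec base ↔ a ∈ vec base := by
  conv_lhs => rw [← hw, hp.vec_smul, Set.smul_mem_smul_set_iff]

theorem exists_isBasisPair (hp : IsTopographPoint M vec base) (hR : IsTopographRing R u)
    (h : IsReflectionAction u M) {i : Fin 4} (hi : 1 ≤ i) (x : TopographElem R Point i)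
    {a : LaxVector R} (ha : a ∈ vectors vec x) : ∃ b ∈ vectors vec x, IsBasisPair a b := by
  match i, x, hi with
  | 1, ⟨s, hs⟩, _ =>
    obtain ⟨b, hb, hba⟩ := Set.exists_ne_of_one_lt_ncard (by rw [hs.1]; norm_num) a
    exact ⟨b, hb, hs.isBasisPair ha hb hba.symm⟩
  | 2, ⟨s, hs⟩, _ =>
    obtain ⟨b, hb, hba⟩ := Set.exists_ne_of_one_lt_ncard (by rw [hs.1]; norm_num) a
    exact ⟨b, hb, hs.isBasisPair ha hb hba.symm⟩
  | 3, p, _ =>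
    obtain ⟨w, rfl⟩ := hp.exists_smul_base_eq hR h p
    replace ha : a ∈ vec (w • base) := ha
    rw [hp.vec_smul, Set.mem_smul_set_iff_inv_smul_mem] at ha
    obtain ⟨v, hv, hva⟩ := hp.exists_smul_eq_e₁ _ ha
    refine ⟨w • v⁻¹ • e₂, ?_, ?_⟩
    · change _ ∈ vec (w • base)
      rw [hp.vec_smul, Set.smul_mem_smul_set_iff,
        hp.smul_mem_vec_base (hp.parabolic_smul_base (by decide) (inv_mem hv))]
      exact hp.e₂_mem
    · have := PreservesBasisPairs.smul w (PreservesBasisPairs.smul v⁻¹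
        (isBasisPair_e₁_e₂ (R := R)))
      rwa [← hva, inv_smul_smul, smul_inv_smul] at this

/-- Completes a pair to a superbasis inside a given edge or point, as needed to fill gaps in a flag.
In a point, the stabilizer of `base` first moves the pair to `e₁`, `e₂`, and then `e₃` is pulled
back. -/
theorem exists_isBasisPair_isBasisPair (hp : IsTopographPoint M vec base)
    (hR : IsTopographRing R u) (h : IsReflectionAction u M) {i : Fin 4} (hi : 2 ≤ i)
    (x : TopographElem R Point i) {a b : LaxVector R} (ha : a ∈ vectors vec x)
    (hb : b ∈ vectors vec x) (hab : IsBasisPair a b) :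
    ∃ c ∈ vectors vec x, IsBasisPair a c ∧ IsBasisPair b c := by
  match i, x, hi with
  | 2, ⟨s, hs⟩, _ =>
    obtain ⟨c, hc, hcab⟩ := Set.exists_mem_notMem_of_ncard_lt_ncard (s := {a, b}) (t := s)
      (by rw [hs.1, Set.ncard_pair hab.ne]; norm_num)
    rw [Set.mem_insert_iff, Set.mem_singleton_iff, not_or] at hcab
    exact ⟨c, hc, hs.isBasisPair ha hc (Ne.symm hcab.1), hs.isBasisPair hb hc (Ne.symm hcab.2)⟩
  | 3, p, _ =>
    obtain ⟨w, rfl⟩ := hp.exists_smul_base_eq hR h p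
    replace ha : a ∈ vec (w • base) := ha
    replace hb : b ∈ vec (w • base) := hb
    rw [hp.vec_smul, Set.mem_smul_set_iff_inv_smul_mem] at ha hb
    obtain ⟨v, hv, hva⟩ := hp.exists_smul_eq_e₁ _ ha
    have hvb := hp.parabolic_smul_base (by decide) hv
    obtain ⟨t, ht, htb⟩ := hp.exists_smul_eq_e₂ (v • w⁻¹ • b) ((hp.smul_mem_vec_base hvb).mpr hb)
      (hva ▸ PreservesBasisPairs.smul v (PreservesBasisPairs.smul w⁻¹ hab))
    have hta : t • v • w⁻¹ • a = e₁ := by rw [hva, h.parabolic_smul_e₁ (by decide) ht]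
    have htv : (t * v) • base = base := by
      rw [mul_smul, hvb, hp.parabolic_smul_base (by decide) ht]
    refine ⟨w • (t * v)⁻¹ • e₃, ?_, ?_, ?_⟩
    · change _ ∈ vec (w • base)
      rw [hp.vec_smul, Set.smul_mem_smul_set_iff,
        hp.smul_mem_vec_base (inv_smul_eq_iff.mpr htv.symm)]
      exact hp.e₃_mem
    · have := PreservesBasisPairs.smul w (PreservesBasisPairs.smul (t * v)⁻¹
        (isBasisPair_e₁_e₃ (R := R)))
      rwa [← hta, ← mul_smul t, inv_smul_smul, smul_inv_smul] at this
    · have := PreservesBasisPairs.smul w (PreservesBasisPairs.smul (t * v)⁻¹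
        (isBasisPair_e₂_e₃ (R := R)))
      rwa [← htb, ← mul_smul t, inv_smul_smul, smul_inv_smul] at this

theorem exists_vectors_subset (hp : IsTopographPoint M vec base) (hR : IsTopographRing R u)
    (h : IsReflectionAction u M) {i : Fin 4} (x : TopographElem R Point i) :
    ∃ p, vectors vec x ⊆ vec p := by
  have key {a b c : LaxVector R} (hab : IsBasisPair a b) (hac : IsBasisPair a c)
      (hbc : IsBasisPair b c) : ∃ p, a ∈ vec p ∧ b ∈ vec p ∧ c ∈ vec p := by
    obtain ⟨A, rfl, rfl, rfl⟩ := exists_gl_smul_eq hab hac hbc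
    obtain ⟨w, hw⟩ := h.exists_smul_eq_gl_smul hR A
    simp_rw [← hw]
    refine ⟨w • base, ?_⟩
    simp only [hp.vec_smul, Set.smul_mem_smul_set_iff]
    exact ⟨hp.e₁_mem, hp.e₂_mem, hp.e₃_mem⟩
  match i, x with
  | 0, a =>
    obtain ⟨A, rfl⟩ := exists_gl_smul_e₁_eq a
    obtain ⟨p, h1, -⟩ := key (isBasisPair_e₁_e₂.gl_smul A) (isBasisPair_e₁_e₃.gl_smul A)
      (isBasisPair_e₂_e₃.gl_smul A)
    exact ⟨p, Set.singleton_subset_iff.mpr h1⟩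
  | 1, ⟨s, hs⟩ =>
    obtain ⟨-, a, b, rfl, hab⟩ := hs
    obtain ⟨A, rfl, rfl⟩ := exists_gl_smul_eq_pair hab
    obtain ⟨p, h1, h2, -⟩ := key hab (isBasisPair_e₁_e₃.gl_smul A) (isBasisPair_e₂_e₃.gl_smul A)
    exact ⟨p, Set.pair_subset h1 h2⟩
  | 2, ⟨s, hs⟩ =>
    obtain ⟨a, b, c, hab, hac, hbc, rfl⟩ := Set.ncard_eq_three.mp hs.1
    obtain ⟨p, h1, h2, h3⟩ := key (hs.isBasisPair (by simp) (by simp) hab)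
      (hs.isBasisPair (by simp) (by simp) hac) (hs.isBasisPair (by simp) (by simp) hbc)
    exact ⟨p, Set.insert_subset h1 (Set.pair_subset h2 h3)⟩
  | 3, p => exact ⟨p, subset_rfl⟩

end IsTopographPoint

/-! ### Incidence in a topograph and the least elements of a flag. -/

section Incidence

variable {hvec : ∀ (g : PSL(2, R)) p, vec (g • p) = g • vec p}

theorem topograph_inc_iff_eq {i : Fin 4} (x y : TopographElem R Point i) :
    (topograph R Point vec hvec).Inc ⟨i, x⟩ ⟨i, y⟩ ↔ x = y := by
  constructor
  · rintro (h | ⟨h, -⟩ | ⟨h, -⟩)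
    · exact eq_of_heq (Sigma.mk.inj_iff.mp h).2
    · exact absurd h (lt_irrefl _)
    · exact absurd h (lt_irrefl _)
  · rintro rfl
    exact Or.inl rfl

theorem topograph_inc_symm (x y : Σ i, TopographElem R Point i)
    (h : (topograph R Point vec hvec).Inc x y) : (topograph R Point vec hvec).Inc y x := by
  rcases h with h | h | h
  · exact Or.inl h.symm
  · exact Or.inr (Or.inr h)
  · exact Or.inr (Or.inl h)

theorem topograph_inc_of_subset {i j : Fin 4} (hij : i < j) {x : TopographElem R Point i}
    {y : TopographElem R Point j} (h : vectors vec x ⊆ vectors vec y) :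
    (topograph R Point vec hvec).Inc ⟨i, x⟩ ⟨j, y⟩ :=
  Or.inr (Or.inl ⟨hij, h⟩)

theorem vectors_subset_of_topograph_inc {i j : Fin 4} (hij : i ≤ j) {x : TopographElem R Point i}
    {y : TopographElem R Point j} (h : (topograph R Point vec hvec).Inc ⟨i, x⟩ ⟨j, y⟩) :
    vectors vec x ⊆ vectors vec y := by
  rcases h with h | ⟨-, h⟩ | ⟨h, -⟩
  · obtain ⟨rfl, h⟩ := Sigma.mk.inj_iff.mp h
    rw [eq_of_heq h]
  · exact h
  · exact absurd h (not_lt.mpr hij)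

/-- Among the elements of a flag whose type is at least `k`, take the least one; if there is none,
keep the given element above the flag. -/
theorem exists_least_vectors {T : Set (Fin 4)} (f : (topograph R Point vec hvec).FlagOfType T)
    {k l j : Fin 4} (hkl : l.1 = k.1 + 1) (hj : l ≤ j) (y : TopographElem R Point j)
    (h1 : ∀ i : {i : Fin 4 // i ∉ T}, l ≤ i → vectors vec y ⊆ vectors vec (f.1 i))
    (h2 : ∀ i : {i : Fin 4 // i ∉ T}, i < l → vectors vec (f.1 i) ⊆ vectors vec y) :
    ∃ j', k ≤ j' ∧ ∃ x : TopographElem R Point j', vectors vec x ⊆ vectors vec y ∧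
      (∀ i : {i : Fin 4 // i ∉ T}, k ≤ i → vectors vec x ⊆ vectors vec (f.1 i)) ∧
      (∀ i : {i : Fin 4 // i ∉ T}, i < k → vectors vec (f.1 i) ⊆ vectors vec x) := by
  have hlt {i : Fin 4} : i < l ↔ i ≤ k := by rw [Fin.lt_def, Fin.le_def]; lia
  by_cases hk : k ∈ T
  · refine ⟨j, (hlt.mp ?_ : k ≤ k).trans ((Fin.le_def.mpr (by lia) : k ≤ l).trans hj), y,
      subset_rfl, fun i hi => h1 i ?_, fun i hi => h2 i (hlt.mpr hi.le)⟩
    · exact hlt.mpr le_rfl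
    · rcases hi.eq_or_lt with hi | hi
      · exact absurd (hi ▸ hk) i.2
      · rw [Fin.lt_def] at hi; rw [Fin.le_def]; lia
  · refine ⟨k, le_rfl, f.1 ⟨k, hk⟩, h2 ⟨k, hk⟩ (hlt.mpr le_rfl), fun i hi => ?_, fun i hi => ?_⟩
    · exact vectors_subset_of_topograph_inc (hvec := hvec) hi (f.2 ⟨k, hk⟩ i)
    · exact vectors_subset_of_topograph_inc (hvec := hvec) hi.le (f.2 i ⟨k, hk⟩)

end Incidence

namespace IsTopographPoint

variable (hvec : ∀ (g : PSL(2, R)) p, vec (g • p) = g • vec p)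

theorem exists_point_above (hp : IsTopographPoint M vec base) (hR : IsTopographRing R u)
    (h : IsReflectionAction u M) {T : Set (Fin 4)}
    (f : (topograph R Point vec hvec).FlagOfType T) :
    ∃ p : Point, (∀ hT : 3 ∉ T, f.1 ⟨3, hT⟩ = p) ∧
      ∀ i : {i : Fin 4 // i ∉ T}, vectors vec (f.1 i) ⊆ vec p := by
  by_cases h3 : 3 ∈ T
  · rcases Tᶜ.eq_empty_or_nonempty with he | hne
    · exact ⟨base, fun h' => absurd h3 h', fun i => absurd i.2 (Set.eq_empty_iff_forall_notMem.mp he _)⟩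
    · obtain ⟨m, hm, hmax⟩ := Set.exists_max_image Tᶜ id (Set.toFinite _) hne
      obtain ⟨p, hpm⟩ := hp.exists_vectors_subset hR h (f.1 ⟨m, hm⟩)
      exact ⟨p, fun h' => absurd h3 h', fun i => (vectors_subset_of_topograph_inc (hvec := hvec)
        (hmax i i.2) (f.2 i ⟨m, hm⟩)).trans hpm⟩
  · exact ⟨f.1 ⟨3, h3⟩, fun _ => rfl, fun i =>
      vectors_subset_of_topograph_inc (hvec := hvec) (Fin.le_last i.1) (f.2 i ⟨3, h3⟩)⟩

/-- Both sides have `i + 1` vectors, so one inclusion suffices. Points are excluded, as nothing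
assumes that a point is determined by its vectors. -/
theorem eq_smul_standardChamber (hp : IsTopographPoint M vec base) {i : Fin 4} (hi : i ≠ 3)
    {x : TopographElem R Point i} {w : M.Group} (h1 : w • e₁ ∈ vectors vec x)
    (h2 : 1 ≤ i → w • e₂ ∈ vectors vec x) (h3 : 2 ≤ i → w • e₃ ∈ vectors vec x) :
    x = w • standardChamber R base i := by
  refine (vectors_injective (vec := vec) hi _ _
    (Set.eq_of_subset_of_ncard_le ?_ ?_ (Set.finite_of_ncard_ne_zero ?_))).symm
  · rw [vectors_smul_of_preserves hp.vec_smul]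
    match i, x, h1, h2, h3 with
    | 0, x, h1, h2, h3 =>
      change w • ({e₁} : Set (LaxVector R)) ⊆ _
      rw [Set.smul_set_singleton]
      exact Set.singleton_subset_iff.mpr h1
    | 1, x, h1, h2, h3 =>
      change w • ({e₁, e₂} : Set (LaxVector R)) ⊆ _
      rw [Set.smul_set_insert, Set.smul_set_singleton]
      exact Set.pair_subset h1 (h2 le_rfl)
    | 2, x, h1, h2, h3 =>
      change w • ({e₁, e₂, e₃} : Set (LaxVector R)) ⊆ _
      rw [Set.smul_set_insert, Set.smul_set_insert, Set.smul_set_singleton]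
      exact Set.insert_subset h1 (Set.pair_subset (h2 (by decide)) (h3 le_rfl))
    | 3, x, h1, h2, h3 => exact absurd rfl hi
  · rw [ncard_vectors hi, ncard_vectors hi]
  · rw [ncard_vectors hi]; exact Nat.succ_ne_zero _

/-- Every flag of the topograph is an image of a part of the standard chamber. -/
theorem exists_smul_standardChamber_eq (hp : IsTopographPoint M vec base)
    (hR : IsTopographRing R u) (h : IsReflectionAction u M) {T : Set (Fin 4)}
    (f : (topograph R Point vec hvec).FlagOfType T) :
    ∃ w : M.Group, ∀ i : {i : Fin 4 // i ∉ T}, f.1 i = w • standardChamber R base i := by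
  obtain ⟨p, hp3, hpf⟩ := hp.exists_point_above hvec hR h f
  -- A missing element of the flag is replaced by the next one above it. This gives a chain `x₀ ⊆ x₁
  -- ⊆ x₂ ⊆ p` in terms of vectors. Choosing `a` in `x₀`, `b` in `x₁` and `c` in `x₂` ensures that
  -- each element of the flag contains the vectors needed for its type.
  obtain ⟨j₂, hj₂, x₂, hx₂, h21, h22⟩ := exists_least_vectors f (k := 2) (l := 3) rfl le_rfl
    (p : TopographElem R Point 3)
    (fun ⟨i, hi⟩ hi3 => by
      obtain rfl : i = 3 := le_antisymm (Fin.le_last i) hi3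
      rw [hp3 hi])
    (fun i _ => hpf i)
  obtain ⟨j₁, hj₁, x₁, hx₁, h11, h12⟩ := exists_least_vectors f (k := 1) (l := 2) rfl hj₂ x₂ h21 h22
  obtain ⟨j₀, hj₀, x₀, hx₀, h01, -⟩ := exists_least_vectors f (k := 0) (l := 1) rfl hj₁ x₁ h11 h12
  obtain ⟨a, ha⟩ := hp.exists_mem_vectors x₀
  obtain ⟨b, hb, hab⟩ := hp.exists_isBasisPair hR h hj₁ x₁ (hx₀ ha)
  obtain ⟨c, hc, hac, hbc⟩ := hp.exists_isBasisPair_isBasisPair hR h hj₂ x₂ (hx₁ (hx₀ ha)) (hx₁ hb)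
    hab
  obtain ⟨w, hwa, hwb, hwc, hwp⟩ := hp.exists_smul_eq_of_mem hR h (hx₂ (hx₁ (hx₀ ha))) (hx₂ (hx₁ hb))
    (hx₂ hc) hab hac hbc
  subst hwa hwb hwc
  refine ⟨w, fun ⟨i, hi⟩ => ?_⟩
  by_cases hi3 : i = 3
  · subst hi3
    exact (hp3 hi).trans hwp.symm
  · exact hp.eq_smul_standardChamber hi3 (h01 ⟨i, hi⟩ (Fin.zero_le _) ha)
      (fun h' => h11 ⟨i, hi⟩ h' hb) (fun h' => h21 ⟨i, hi⟩ h' hc)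

end IsTopographPoint

end

/-! ### Stabilizers of the elements of the standard chamber. -/

section Stabilizers

set_option linter.unusedSectionVars false

attribute [local instance] topographElemAction

open LaxVector TopographElem

variable {R Point : Type} [CommRing R] [StarRing R] [Nontrivial R] {u : Rˣ}
  {M : CoxeterMatrix (Fin 4)} [MulAction M.Group (LaxVector R)] [PreservesBasisPairs M.Group R]
  [MulAction M.Group Point] [MulAction PSL(2, R) Point]
  {vec : Point → Set (LaxVector R)} {base : Point}

namespace IsTopographPoint

theorem simple_smul_standardChamber (hp : IsTopographPoint M vec base)
    (h : IsReflectionAction u M) {i j : Fin 4} (hij : j ≠ i) :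
    M.simple j • standardChamber R base i = standardChamber R base i := by
  by_cases hi : i = 3
  · subst hi
    exact hp.simple_smul j hij
  refine (hp.eq_smul_standardChamber hi ?_ ?_ ?_).symm
  · match i, j, hij with
    | 0, 1, _ => exact h.simple_one_smul_e₁
    | 0, 2, _ => exact h.simple_two_smul_e₁
    | 0, 3, _ => exact h.simple_three_smul_e₁
    | 1, 0, _ => exact Or.inr h.simple_zero_smul_e₁
    | 1, 2, _ => exact Or.inl h.simple_two_smul_e₁
    | 1, 3, _ => exact Or.inl h.simple_three_smul_e₁
    | 2, 0, _ => exact Or.inr (Or.inl h.simple_zero_smul_e₁)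
    | 2, 1, _ => exact Or.inl h.simple_one_smul_e₁
    | 2, 3, _ => exact Or.inl h.simple_three_smul_e₁
    | 3, _, _ => exact absurd rfl hi
  · intro hi1
    match i, j, hij, hi1 with
    | 1, 0, _, _ => exact Or.inl h.simple_zero_smul_e₂
    | 1, 2, _, _ => exact Or.inr h.simple_two_smul_e₂
    | 1, 3, _, _ => exact Or.inr h.simple_three_smul_e₂
    | 2, 0, _, _ => exact Or.inl h.simple_zero_smul_e₂
    | 2, 1, _, _ => exact Or.inr (Or.inr h.simple_one_smul_e₂)
    | 2, 3, _, _ => exact Or.inr (Or.inl h.simple_three_smul_e₂)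
    | 3, _, _, _ => exact absurd rfl hi
  · intro hi2
    match i, j, hij, hi2 with
    | 2, 0, _, _ => exact Or.inr (Or.inr h.simple_zero_smul_e₃)
    | 2, 1, _, _ => exact Or.inr (Or.inl h.simple_one_smul_e₃)
    | 2, 3, _, _ => exact Or.inr (Or.inr h.simple_three_smul_e₃)
    | 3, _, _, _ => exact absurd rfl hi

/-- Since `s₀` interchanges `e₁` and `e₂`, it suffices to treat elements fixing both vectors. -/
theorem mem_parabolic_of_smul_face (base : Point) (hR : IsTopographRing R u)
    (h : IsReflectionAction u M) {w : M.Group}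
    (hw : w • standardChamber R base 1 = standardChamber R base 1) : w ∈ M.parabolic {0, 2, 3} := by
  have hw' : w • ({e₁, e₂} : Set (LaxVector R)) = {e₁, e₂} := congrArg Subtype.val hw
  rw [Set.smul_set_insert, Set.smul_set_singleton, Set.pair_eq_pair_iff] at hw'
  rcases hw' with ⟨h1, h2⟩ | ⟨h1, h2⟩
  · exact M.parabolic_mono (by simp) (h.mem_parabolic_of_fix_e₁_e₂ hR h1 h2)
  · have := h.mem_parabolic_of_fix_e₁_e₂ hR (w := M.simple 0 * w)
      (by rw [mul_smul, h1, h.simple_zero_smul_e₂]) (by rw [mul_smul, h2, h.simple_zero_smul_e₁])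
    exact (Subgroup.mul_mem_cancel_left _ (M.simple_mem_parabolic (by simp))).mp
      (M.parabolic_mono (by simp) this)

/-- Descending along the standard basis vectors, an element that stabilizes a set `s` of lax vectors
is the product of elements of suitable parabolic subgroups and of `1` or `s₃`. -/
theorem exists_mem_parabolic_of_smul_set (h : IsReflectionAction u M) {T : Set (Fin 4)}
    {s : Set (LaxVector R)} (hT : ∀ v ∈ M.parabolic T, v • s = s) (h1s : e₁ ∈ s) (h2s : e₂ ∈ s)
    (h3s : e₃ ∈ s) (h1 : ∀ a ∈ s, ∃ v ∈ M.parabolic T, v • a = e₁)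
    (h2 : ∀ a ∈ s, IsBasisPair e₁ a → ∃ v ∈ M.parabolic (T ∩ {1, 2}), v • a = e₂)
    (h3 : ∀ a ∈ s, IsBasisPair e₁ a → IsBasisPair e₂ a →
      ∃ v ∈ M.parabolic (T ∩ {2}), v • a = e₃) {w : M.Group} (hw : w • s = s) :
    ∃ v ∈ M.parabolic T, v * w = 1 ∨ v * w = M.simple 3 := by
  have hmem {v : M.Group} (hv : v • s = s) {a : LaxVector R} (ha : a ∈ s) : v • a ∈ s :=
    hv ▸ Set.smul_mem_smul_set ha
  obtain ⟨v₁, hv₁, h₁⟩ := h1 _ (hmem hw h1s)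
  have hs₁ : (v₁ * w) • s = s := by rw [mul_smul, hw, hT v₁ hv₁]
  rw [← mul_smul] at h₁
  -- The correcting element lies in a parabolic subgroup without `s₀`, hence fixes `e₁` and keeps
  -- what the previous step achieved. Likewise the third correction involves only `s₂` and fixes
  -- `e₁` and `e₂`.
  obtain ⟨v₂, hv₂, h₂⟩ := h2 _ (hmem hs₁ h2s)
    (h₁ ▸ PreservesBasisPairs.smul (v₁ * w) (isBasisPair_e₁_e₂ (R := R)))
  have hv₂T := M.parabolic_mono Set.inter_subset_left hv₂
  have hs₂ : (v₂ * (v₁ * w)) • s = s := by rw [mul_smul, hs₁, hT v₂ hv₂T]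
  have h₁' : (v₂ * (v₁ * w)) • (e₁ : LaxVector R) = e₁ := by
    rw [mul_smul, h₁, h.parabolic_smul_e₁ (by simp) hv₂]
  rw [← mul_smul] at h₂
  obtain ⟨v₃, hv₃, h₃⟩ := h3 _ (hmem hs₂ h3s)
    (by
      have := PreservesBasisPairs.smul (v₂ * (v₁ * w)) (isBasisPair_e₁_e₃ (R := R))
      rwa [h₁'] at this)
    (by
      have := PreservesBasisPairs.smul (v₂ * (v₁ * w)) (isBasisPair_e₂_e₃ (R := R))
      rwa [h₂] at this)
  have hv₃T := M.parabolic_mono Set.inter_subset_left hv₃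
  rw [← mul_smul] at h₃
  refine ⟨v₃ * v₂ * v₁, mul_mem (mul_mem hv₃T hv₂T) hv₁, ?_⟩
  have he : v₃ * v₂ * v₁ * w = v₃ * (v₂ * (v₁ * w)) := by simp only [mul_assoc]
  rw [he]
  refine h.eq_one_or_eq_of_fix ?_ ?_ h₃
  · rw [mul_smul, h₁', h.parabolic_smul_e₁ (by simp) hv₃]
  · rw [mul_smul, h₂, h.parabolic_smul_e₂ (by simp) (by simp) hv₃]

theorem mem_parabolic_of_smul_edge (hp : IsTopographPoint M vec base)
    (h : IsReflectionAction u M) {w : M.Group}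
    (hw : w • standardChamber R base 2 = standardChamber R base 2) : w ∈ M.parabolic {0, 1, 3} := by
  have hw' : w • ({e₁, e₂, e₃} : Set (LaxVector R)) = {e₁, e₂, e₃} := congrArg Subtype.val hw
  have hT : ∀ v ∈ M.parabolic {0, 1}, v • ({e₁, e₂, e₃} : Set (LaxVector R)) = {e₁, e₂, e₃} :=
    fun v hv => congrArg Subtype.val (smul_eq_of_mem_parabolic
      (x := standardChamber R base 2) (fun i hi => hp.simple_smul_standardChamber h (by
        rintro rfl; simp at hi)) hv)
  have h0 : M.simple 0 ∈ M.parabolic {0, 1} := M.simple_mem_parabolic (by simp)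
  have h1 : M.simple 1 ∈ M.parabolic {0, 1} := M.simple_mem_parabolic (by simp)
  obtain ⟨v, hv, hvw⟩ := exists_mem_parabolic_of_smul_set h hT (by simp) (by simp) (by simp)
    (by
      rintro a (rfl | rfl | rfl)
      · exact ⟨1, one_mem _, one_smul _ _⟩
      · exact ⟨_, h0, h.simple_zero_smul_e₂⟩
      · exact ⟨_, mul_mem h0 h1, by
          rw [mul_smul, h.simple_one_smul_e₃, h.simple_zero_smul_e₂]⟩)
    (by
      rintro a (rfl | rfl | rfl) hb
      · exact absurd rfl hb.ne
      · exact ⟨1, one_mem _, one_smul _ _⟩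
      · exact ⟨_, M.simple_mem_parabolic (by simp), h.simple_one_smul_e₃⟩)
    (by
      rintro a (rfl | rfl | rfl) hb hb'
      · exact absurd rfl hb.ne
      · exact absurd rfl hb'.ne
      · exact ⟨1, one_mem _, one_smul _ _⟩) hw'
  refine (Subgroup.mul_mem_cancel_left _ (M.parabolic_mono (by simp) hv)).mp ?_
  rcases hvw with hvw | hvw
  · rw [hvw]; exact one_mem _
  · rw [hvw]; exact M.simple_mem_parabolic (by simp)

/-- After correction by `W_{0,1,2}`, which fixes `base`, the element is `1` or `s₃`; the latter is
impossible because it moves `base`. -/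
theorem mem_parabolic_of_smul_base (hp : IsTopographPoint M vec base)
    (h : IsReflectionAction u M) {w : M.Group} (hw : w • base = base) :
    w ∈ M.parabolic {0, 1, 2} := by
  have hfix {v : M.Group} (hv : v • base = base) : v • vec base = vec base := by
    rw [← hp.vec_smul, hv]
  have hT {v : M.Group} (hv : v ∈ M.parabolic {0, 1, 2}) : v • base = base :=
    hp.parabolic_smul_base (by decide) hv
  obtain ⟨v, hv, hvw⟩ := exists_mem_parabolic_of_smul_set h (fun v hv => hfix (hT hv)) hp.e₁_mem
    hp.e₂_mem hp.e₃_mem hp.exists_smul_eq_e₁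
    (by
      have : ({0, 1, 2} ∩ {1, 2} : Set (Fin 4)) = {1, 2} := by ext i; fin_cases i <;> simp
      rw [this]
      exact hp.exists_smul_eq_e₂)
    (by
      have : ({0, 1, 2} ∩ {2} : Set (Fin 4)) = {2} := by ext i; fin_cases i <;> simp
      rw [this]
      exact hp.exists_smul_eq_e₃) (hfix hw)
  rcases hvw with hvw | hvw
  · rw [← inv_eq_of_mul_eq_one_right hvw]
    exact inv_mem hv
  · refine absurd ?_ hp.simple_three_smul
    rw [← hvw, mul_smul, hw, hT hv]

theorem smul_standardChamber_eq_iff (hp : IsTopographPoint M vec base) (hR : IsTopographRing R u)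
    (h : IsReflectionAction u M) (i : Fin 4) (w : M.Group) :
    w • standardChamber R base i = standardChamber R base i ↔ w ∈ M.parabolic {i}ᶜ := by
  constructor
  · intro hw
    match i, hw with
    | 0, hw => exact M.parabolic_mono (by simp) (h.mem_parabolic_of_fix_e₁ hR hw)
    | 1, hw => exact M.parabolic_mono (by simp) (mem_parabolic_of_smul_face base hR h hw)
    | 2, hw => exact M.parabolic_mono (by simp) (hp.mem_parabolic_of_smul_edge h hw)
    | 3, hw => exact M.parabolic_mono (by simp) (hp.mem_parabolic_of_smul_base h hw)
  · exact smul_eq_of_mem_parabolic fun j hj => hp.simple_smul_standardChamber h hj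

variable (hvec : ∀ (g : PSL(2, R)) p, vec (g • p) = g • vec p)

theorem isCoxeterGeometry (hp : IsTopographPoint M vec base) (hR : IsTopographRing R u)
    (h : IsReflectionAction u M) {c : Matrix (Fin 4) (Fin 4) ℤ} (hc : M.IsCartan c)
    (hM : ∀ i j, M i j ≠ 0) :
    @IncidenceGeometry.IsCoxeterGeometry PSL(2, R) _ (topograph R Point vec hvec) M
      (topographElemAction Point) (standardChamber R base) := by
  let : ∀ i, MulAction M.Group ((topograph R Point vec hvec).Elem i) := topographElemAction Point
  have hchamber : ∀ i j : Fin 4, (topograph R Point vec hvec).Inc ⟨i, standardChamber R base i⟩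
      ⟨j, standardChamber R base j⟩ := by
    have hlt : ∀ i j : Fin 4, i < j → vectors vec (standardChamber R base i) ⊆
        vectors vec (standardChamber R base j) := by
      intro i j hij
      match i, j, hij with
      | 0, 1, _ => exact Set.singleton_subset_iff.mpr (Or.inl rfl)
      | 0, 2, _ => exact Set.singleton_subset_iff.mpr (Or.inl rfl)
      | 0, 3, _ => exact Set.singleton_subset_iff.mpr hp.e₁_mem
      | 1, 2, _ => exact Set.pair_subset (Or.inl rfl) (Or.inr (Or.inl rfl))
      | 1, 3, _ => exact Set.pair_subset hp.e₁_mem hp.e₂_mem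
      | 3, j, hij => exact absurd hij (not_lt.mpr (Fin.le_last j))
      | 2, 3, _ => exact Set.insert_subset hp.e₁_mem (Set.pair_subset hp.e₂_mem hp.e₃_mem)
    intro i j
    rcases lt_trichotomy i j with hij | rfl | hij
    · exact topograph_inc_of_subset hij (hlt i j hij)
    · exact (topograph_inc_iff_eq _ _).mpr rfl
    · exact topograph_inc_symm _ _ (topograph_inc_of_subset hij (hlt j i hij))
  have hsmul : ∀ (w : M.Group) {i j : Fin 4} (x : TopographElem R Point i)
      (y : TopographElem R Point j), (topograph R Point vec hvec).Inc ⟨i, x⟩ ⟨j, y⟩ →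
      (topograph R Point vec hvec).Inc ⟨i, w • x⟩ ⟨j, w • y⟩ := by
    intro w i j x y hxy
    have hsub {i j : Fin 4} {x : TopographElem R Point i} {y : TopographElem R Point j}
        (hxy : vectors vec x ⊆ vectors vec y) : vectors vec (w • x) ⊆ vectors vec (w • y) := by
      rw [vectors_smul_of_preserves hp.vec_smul, vectors_smul_of_preserves hp.vec_smul]
      exact Set.smul_set_mono hxy
    rcases hxy with hxy | ⟨hij, hxy⟩ | ⟨hij, hxy⟩
    · obtain ⟨rfl, hxy⟩ := Sigma.mk.inj_iff.mp hxy
      obtain rfl := eq_of_heq hxy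
      exact Or.inl rfl
    · exact Or.inr (Or.inl ⟨hij, hsub hxy⟩)
    · exact Or.inr (Or.inr ⟨hij, hsub hxy⟩)
  exact
    { inc_smul := hsmul
      inc_iff_eq := topograph_inc_iff_eq
      inc_symm := topograph_inc_symm
      chamber := hchamber
      exists_chamber := fun f => by
        obtain ⟨w, hw⟩ := hp.exists_smul_standardChamber_eq hvec hR h f
        exact ⟨fun i => w • standardChamber R base i, fun i j => hsmul w _ _ (hchamber i j),
          fun i => (hw i).symm⟩
      exists_smul_eq := fun F hF => by
        -- A chamber is a flag of type `∅`, so transitivity on chambers is a case of the result on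
        -- flags.
        obtain ⟨w, hw⟩ := hp.exists_smul_standardChamber_eq hvec hR h (T := ∅)
          ⟨fun i => F i, fun i j => hF i j⟩
        exact ⟨w, fun i => hw ⟨i, Set.notMem_empty i⟩⟩
      smul_eq_iff := hp.smul_standardChamber_eq_iff hR h
      mem_parabolic_iff := fun T w => ⟨fun hw i hi =>
        M.parabolic_mono (Set.subset_compl_singleton_iff.mpr hi) hw,
        fun hw => M.toCoxeterSystem.mem_closure_of_forall_compl hc hM hw⟩ }

/-- The topograph is equivariantly isomorphic to the Coxeter geometry. -/
theorem exists_equivariantIso (hp : IsTopographPoint M vec base) (hR : IsTopographRing R u)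
    (h : IsReflectionAction u M) {c : Matrix (Fin 4) (Fin 4) ℤ} (hc : M.IsCartan c)
    (hM : ∀ i j, M i j ≠ 0) :
    ∃ ι : PSL(2, R) →* M.Group, Function.Injective ι ∧ ι.range ≤ M.evenSubgroup ∧
      ι.range.relIndex M.evenSubgroup = 2 ∧
      Nonempty ((topograph R Point vec hvec).flags.EquivariantIso M.geometry ι) := by
  let : ∀ i, MulAction M.Group ((topograph R Point vec hvec).Elem i) := topographElemAction Point
  refine ⟨h.pslHom hR, h.pslHom_injective hR, h.pslHom_range_le hR, h.pslHom_relIndex hR,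
    ⟨(hp.isCoxeterGeometry hvec hR h hc hM).equivariantIso _ ?_⟩⟩
  have hset (g : PSL(2, R)) (s : Set (LaxVector R)) : g • s = h.pslHom hR g • s :=
    Set.image_congr fun a _ => (h.pslHom_smul hR g a).symm
  intro g i x
  match i, x with
  | 0, a => exact (h.pslHom_smul hR g a).symm
  | 1, s => exact Subtype.ext (hset g s.1)
  | 2, s => exact Subtype.ext (hset g s.1)
  | 3, p => exact hp.psl_smul g _ (fun a => (h.pslHom_smul hR g a).symm) p

end IsTopographPoint

end Stabilizers

section

/-! ### Constructing reflection actions -/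

open LaxVector CoxeterMatrix

section ReflectionAction

set_option linter.unusedSectionVars false

variable {R : Type} [CommRing R] [StarRing R]

/-- The antilinear maps `LaxVector.reflectionMatrix` as transformations of lax vectors. -/
def reflectionEnd (u : Rˣ) (i : Fin 4) : Function.End (LaxVector R) :=
  fun a => reflectionMatrix u i • a.conj

theorem reflectionEnd_mul_pow_apply (u : Rˣ) (i j : Fin 4) (m : ℕ) (a : LaxVector R) :
    ((reflectionEnd u i * reflectionEnd u j) ^ m) a =
      ((reflectionMatrix u i * conjGL (reflectionMatrix u j)) ^ m) • a := by
  induction m generalizing a with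
  | zero => rw [pow_zero, pow_zero, one_smul]; rfl
  | succ m ih =>
    rw [pow_succ, pow_succ, mul_smul]
    refine (ih _).trans (congrArg _ ?_)
    change reflectionMatrix u i • conj (reflectionMatrix u j • conj a) = _
    rw [conj_gl_smul, conj_conj, mul_smul]

/-- The entries of `LaxVector.reflectionMatrix`. -/
def reflectionEntries (u : R) : Fin 4 → Matrix (Fin 2) (Fin 2) R
  | 0 => !![0, 1; 1, 0]
  | 1 => !![-1, 1; 0, 1]
  | 2 => !![1, 0; 0, u]
  | 3 => !![1, 0; 0, 1]

theorem coe_reflectionMatrix (u : Rˣ) (i : Fin 4) :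
    (reflectionMatrix u i).1 = reflectionEntries (u : R) i := by
  match i with
  | 0 => rfl
  | 1 => rfl
  | 2 => rfl
  | 3 => exact Matrix.one_fin_two

/-- A product of two antilinear maps is linear with matrix `A_i · conj(A_j)`, so the Coxeter
relation holds on lax vectors once the appropriate power is scalar. Plain matrix entries make this a
computation in `R`. -/
theorem isLiftable_reflectionEnd {u : Rˣ} {M : CoxeterMatrix (Fin 4)}
    (h : ∀ i j : Fin 4, ∀ B, B = (reflectionEntries (u : R) i *
      (reflectionEntries (u : R) j).map star) ^ M i j → B 0 1 = 0 ∧ B 1 0 = 0 ∧ B 1 1 = B 0 0) :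
    M.IsLiftable (reflectionEnd u) := by
  intro i j
  funext a
  rw [reflectionEnd_mul_pow_apply]
  have hB : ((reflectionMatrix u i * conjGL (reflectionMatrix u j)) ^ M i j).1 =
      (reflectionEntries (u : R) i * (reflectionEntries (u : R) j).map star) ^ M i j := by
    rw [Units.val_pow_eq_pow_val, Units.val_mul, ← coe_reflectionMatrix, ← coe_reflectionMatrix]
    rfl
  obtain ⟨h01, h10, h11⟩ := h i j _ hB
  exact gl_smul_eq_self h01 h10 h11 a

/-- The action of the Coxeter group on lax vectors. -/
@[reducible] def reflectionAction {u : Rˣ} {M : CoxeterMatrix (Fin 4)}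
    (h : M.IsLiftable (reflectionEnd u)) : MulAction M.Group (LaxVector R) :=
  MulAction.compHom (LaxVector R) (M.toCoxeterSystem.lift ⟨reflectionEnd u, h⟩)

theorem reflectionAction_simple_smul {u : Rˣ} {M : CoxeterMatrix (Fin 4)}
    (h : M.IsLiftable (reflectionEnd u)) (i : Fin 4) (a : LaxVector R) :
    (reflectionAction h).toSMul.smul (M.simple i) a = reflectionMatrix u i • a.conj :=
  congrFun (M.toCoxeterSystem.lift_apply_simple h i) a

/-- An action is faithful if it is compatible with the contragredient of the reflection
representation by a map from lax vectors to weights whose image spans. -/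
theorem eq_one_of_forall_smul_eq {M : CoxeterMatrix (Fin 4)} [MulAction M.Group (LaxVector R)]
    {c : Matrix (Fin 4) (Fin 4) ℤ} (hc : M.IsCartan c) (hM : ∀ i j, M i j ≠ 0)
    (N : LaxVector R → Fin 4 → ℤ)
    (hN : ∀ i a j, N (M.simple i • a) j = N a j - c i j * N a i)
    (hspan : ∀ v : Fin 4 → ℤ, (∀ a, ∑ k, N a k * v k = 0) → v = 0)
    (w : M.Group) (hw : ∀ a : LaxVector R, w • a = a) : w = 1 := by
  -- The pairing of weights with roots is invariant: pairing `N (w • a)` with `w α_j` gives `N a j`.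
  -- If `w` fixes all lax vectors, every weight vanishes on `w α_j - α_j`, and spanning makes this
  -- zero.
  have key (w : M.Group) : ∀ (a : LaxVector R) (j : Fin 4),
      ∑ k, N (w • a) k * M.toCoxeterSystem.reflectionRep hc w k j = N a j := by
    induction w using M.toCoxeterSystem.simple_induction_right with
    | one => intro a j; simp [Matrix.one_apply]
    | mul_simple_right w i ih =>
      intro a j
      simp_rw [CoxeterSystem.reflectionRep_mul_simple, mul_sub, ← mul_assoc,
        Finset.sum_sub_distrib, ← Finset.sum_mul]
      rw [M.toCoxeterSystem_simple, mul_smul, ih, ih, hN, hN, hc.diag]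
      ring
  refine M.toCoxeterSystem.reflectionRep_injective hc hM (Matrix.ext fun i j => ?_)
  have := hspan (fun k => M.toCoxeterSystem.reflectionRep hc w k j -
    (1 : Matrix (Fin 4) (Fin 4) ℤ) k j) fun a => by
      have := key w a j
      rw [hw] at this
      simp [mul_sub, Finset.sum_sub_distrib, this, Matrix.one_apply]
  exact sub_eq_zero.mp (congrFun this i)

/-- The entries of the Hermitian matrix attached to a lax vector. -/
def hermitianEntries (hunit : ∀ ε : Rˣ, (ε : R) * star (ε : R) = 1) : LaxVector R → R × R × R :=
  Quotient.lift (fun v => (v.1 0 * star (v.1 0), v.1 1 * star (v.1 1), v.1 0 * star (v.1 1))) (by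
    rintro v w ⟨ε, h⟩
    have key (x y : R) : ε * x * star (ε * y) = x * star y := by
      rw [star_mul']
      linear_combination (x * star y) * hunit ε
    simp only [h, Pi.smul_apply, Units.smul_def, smul_eq_mul, key])

end ReflectionAction

end

/-! ### The Eisenstein topograph -/

namespace EisensteinInt

open LaxVector CoxeterMatrix QuadraticAlgebra

/-- The unit `1 + ω`, a primitive sixth root of unity. -/
def u : EisensteinIntˣ := ⟨⟨1, 1⟩, ⟨0, -1⟩, by decide, by decide⟩

theorem coe_u : (u : EisensteinInt) = ⟨1, 1⟩ := rfl

theorem isLiftable_reflectionEnd_u : type336.IsLiftable (reflectionEnd u) :=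
  isLiftable_reflectionEnd (by
    intro i j B hB
    subst hB
    revert i j
    change ∀ i j : Fin 4, ((reflectionEntries (⟨1, 1⟩ : EisensteinInt) i *
      (reflectionEntries (⟨1, 1⟩ : EisensteinInt) j).map star) ^ type336 i j) 0 1 = 0 ∧ _
    decide +kernel)

instance : MulAction type336.Group (LaxVector EisensteinInt) :=
  reflectionAction isLiftable_reflectionEnd_u

theorem norm_eq (z : EisensteinInt) : norm z = z.re * z.re - z.re * z.im + z.im * z.im := by
  rw [norm_def]; ring

theorem norm_nonneg (z : EisensteinInt) : 0 ≤ norm z := by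
  rw [norm_eq]; nlinarith [sq_nonneg (z.re - z.im), sq_nonneg z.re, sq_nonneg z.im]

theorem norm_pos {z : EisensteinInt} (hz : z ≠ 0) : 0 < QuadraticAlgebra.norm z := by
  refine lt_of_le_of_ne (norm_nonneg z) fun h => hz ?_
  rw [norm_eq] at h
  have him : z.im = 0 := by
    have : 3 * z.im ^ 2 ≤ 0 := by nlinarith [sq_nonneg (2 * z.re - z.im)]
    exact pow_eq_zero_iff (two_ne_zero) |>.mp (le_antisymm (by linarith) (sq_nonneg _))
  have hre : z.re = 0 := by
    rw [him] at h
    exact mul_self_eq_zero.mp (by linarith)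
  exact QuadraticAlgebra.ext hre him

theorem norm_eq_one_of_isUnit {z : EisensteinInt} (hz : IsUnit z) : norm z = 1 := by
  rcases Int.isUnit_iff.mp (hz.map QuadraticAlgebra.norm) with h | h
  · exact h
  · have := norm_nonneg z
    rw [h] at this
    norm_num at this

theorem eq_of_norm_eq_one {z : EisensteinInt} (hz : norm z = 1) :
    z = ⟨1, 0⟩ ∨ z = ⟨1, 1⟩ ∨ z = ⟨0, 1⟩ ∨ z = ⟨-1, 0⟩ ∨ z = ⟨-1, -1⟩ ∨ z = ⟨0, -1⟩ := by
  obtain ⟨a, b⟩ := z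
  rw [norm_eq] at hz
  dsimp only at hz
  have ha : -1 ≤ a ∧ a ≤ 1 := by
    constructor <;> nlinarith [sq_nonneg (a - 2 * b)]
  have hb : -1 ≤ b ∧ b ≤ 1 := by
    constructor <;> nlinarith [sq_nonneg (b - 2 * a)]
  obtain ⟨ha1, ha2⟩ := ha
  obtain ⟨hb1, hb2⟩ := hb
  interval_cases a <;> interval_cases b <;> simp_all

theorem exists_eq_u_pow (ε : EisensteinIntˣ) : ∃ k : ℕ, ε = u ^ k := by
  rcases eq_of_norm_eq_one (norm_eq_one_of_isUnit ε.isUnit) with h | h | h | h | h | h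
  · exact ⟨0, Units.ext (h.trans (by decide))⟩
  · exact ⟨1, Units.ext (h.trans (by decide))⟩
  · exact ⟨2, Units.ext (h.trans (by decide))⟩
  · exact ⟨3, Units.ext (h.trans (by decide))⟩
  · exact ⟨4, Units.ext (h.trans (by decide))⟩
  · exact ⟨5, Units.ext (h.trans (by decide))⟩

theorem exists_norm_sub_mul_lt (x y : EisensteinInt) (hy : y ≠ 0) :
    ∃ q, (norm (x - q * y)).natAbs < (norm y).natAbs := by
  have hn := norm_pos hy
  obtain ⟨n, hny⟩ : ∃ n, n = norm y := ⟨_, rfl⟩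
  have hround (t : ℤ) : ∃ q : ℤ, -n ≤ 2 * (t - n * q) ∧ 2 * (t - n * q) ≤ n := by
    -- This quotient is the integer nearest to `t / n`, that is, the floor of `t / n + 1/2`.
    refine ⟨(2 * t + n) / (2 * n), ?_, ?_⟩
    · have := Int.mul_ediv_self_le (x := 2 * t + n) (k := 2 * n) (by lia)
      linarith
    · have := Int.lt_mul_ediv_self_add (x := 2 * t + n) (k := 2 * n) (by lia)
      linarith
  obtain ⟨q₁, h₁, h₁'⟩ := hround (x.re * (y.re - y.im) + x.im * y.im)
  obtain ⟨q₂, h₂, h₂'⟩ := hround (x.im * y.re - x.re * y.im)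
  refine ⟨⟨q₁, q₂⟩, ?_⟩
  -- The right side is the norm of `x ȳ - n q`. Both of its coordinates are at most `n / 2` in
  -- absolute value, so it is at most `3 n² / 4`.
  have hmul : norm (x - ⟨q₁, q₂⟩ * y) * n =
      (x.re * (y.re - y.im) + x.im * y.im - n * q₁) ^ 2 -
      (x.re * (y.re - y.im) + x.im * y.im - n * q₁) * (x.im * y.re - x.re * y.im - n * q₂) +
      (x.im * y.re - x.re * y.im - n * q₂) ^ 2 := by
    rw [hny, norm_eq, norm_eq]
    simp only [re_sub, im_sub, re_mul, im_mul]
    ring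
  rw [← hny] at hn ⊢
  generalize x.re * (y.re - y.im) + x.im * y.im - n * q₁ = d₁ at h₁ h₁' hmul
  generalize x.im * y.re - x.re * y.im - n * q₂ = d₂ at h₂ h₂' hmul
  have hlt : norm (x - ⟨q₁, q₂⟩ * y) * n < n * n := by
    rw [hmul]
    nlinarith
  have := lt_of_mul_lt_mul_right hlt hn.le
  have := norm_nonneg (x - ⟨q₁, q₂⟩ * y)
  lia

theorem isTopographRing : IsTopographRing EisensteinInt u where
  exists_pow := exists_eq_u_pow
  closure_pow := by
    refine (AddSubgroup.eq_top_iff' _).mpr fun z => ?_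
    have h0 : ((u ^ 0 : EisensteinIntˣ) : EisensteinInt) = ⟨1, 0⟩ := by decide
    have h2 : ((u ^ 2 : EisensteinIntˣ) : EisensteinInt) = ⟨0, 1⟩ := by decide
    have hz : z = z.re • ((u ^ 0 : EisensteinIntˣ) : EisensteinInt) +
        z.im • ((u ^ 2 : EisensteinIntˣ) : EisensteinInt) := by
      rw [h0, h2]
      ext <;> simp
    rw [hz]
    exact add_mem (zsmul_mem (AddSubgroup.subset_closure (Set.mem_range_self 0)) _)
      (zsmul_mem (AddSubgroup.subset_closure (Set.mem_range_self 2)) _)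
  exists_remainder := ⟨fun z => (norm z).natAbs, exists_norm_sub_mul_lt⟩
  sq_ne ε h := by
    have h' : (ε : EisensteinInt) ^ 2 = ⟨1, 1⟩ := congrArg Units.val h
    rcases eq_of_norm_eq_one (norm_eq_one_of_isUnit ε.isUnit) with h | h | h | h | h | h <;>
      (rw [h] at h'; revert h'; decide)

theorem unit_mul_star (ε : EisensteinIntˣ) : (ε : EisensteinInt) * star (ε : EisensteinInt) = 1 := by
  rcases eq_of_norm_eq_one (norm_eq_one_of_isUnit ε.isUnit) with h | h | h | h | h | h <;>
    (rw [h]; decide)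

/-- The coordinates of a lax vector with respect to the walls of the standard chamber. -/
def weight (a : LaxVector EisensteinInt) : Fin 4 → ℤ :=
  let H := hermitianEntries unit_mul_star a
  ![H.1.re - H.2.1.re, H.2.1.re - 2 * H.2.2.re + H.2.2.im, H.2.2.re + H.2.2.im, -H.2.2.im]

theorem simple_smul (i : Fin 4) (a : LaxVector EisensteinInt) :
    type336.simple i • a = reflectionMatrix u i • a.conj :=
  reflectionAction_simple_smul isLiftable_reflectionEnd_u i a

theorem weight_vec {x y : EisensteinInt} (h : IsCoprime x y) :
    weight (vec x y h) = ![(x * star x).re - (y * star y).re,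
      (y * star y).re - 2 * (x * star y).re + (x * star y).im,
      (x * star y).re + (x * star y).im, -(x * star y).im] := rfl

/-- The coordinate `i` of `weight` is a linear form in the Hermitian matrix that changes sign under
`s_i`. For instance, coordinate 0 is `|x|² - |y|²`, and coordinate 1 is `|x - y|² - |x|²`, the
change of `|x|²` under `s₁`. The scaling of the forms is adapted to the Cartan matrix. -/
theorem weight_simple_smul (i : Fin 4) (a : LaxVector EisensteinInt) (j : Fin 4) :
    weight (type336.simple i • a) j = weight a j - cartan336 i j * weight a i := by
  obtain ⟨x, y, h, rfl⟩ := exists_eq_vec a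
  rw [simple_smul, conj_vec, gl_smul_vec, weight_vec, weight_vec, coe_reflectionMatrix, coe_u]
  obtain ⟨a, b⟩ := x
  obtain ⟨c, d⟩ := y
  fin_cases i <;> fin_cases j <;> simp [reflectionEntries, cartan336] <;> ring

theorem isReflectionAction : IsReflectionAction u type336 where
  simple_smul := simple_smul
  eq_one_of_forall := eq_one_of_forall_smul_eq isCartan_cartan336 type336_ne_zero weight
    weight_simple_smul (by
      intro v hv
      -- Hermitian matrices form a space of dimension four, and the four vectors tested here have
      -- linearly independent weights.
      have h1 := hv e₁
      have h2 := hv e₂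
      have h3 := hv e₃
      have h4 := hv (vec 1 ⟨1, 1⟩ isCoprime_one_left)
      simp only [e₁, e₂, e₃, weight_vec, Fin.sum_univ_four] at h1 h2 h3 h4
      simp at h1 h2 h3 h4
      ext i
      fin_cases i <;> simp <;> lia)

instance : PreservesBasisPairs type336.Group EisensteinInt := isReflectionAction.preservesBasisPairs

end EisensteinInt

/-! ### Tetrabases in terms of pairs. -/

section Tetrabasis

variable {R : Type} [CommRing R] [Nontrivial R]

theorem IsLaxTetrabasis.isBasisPair {s : Set (LaxVector R)} (hs : IsLaxTetrabasis s)
    {a b : LaxVector R} (ha : a ∈ s) (hb : b ∈ s) (hab : a ≠ b) : IsBasisPair a b := by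
  obtain ⟨t, ht, hts, htc⟩ := Set.exists_subsuperset_card_eq (s := {a, b}) (t := s) (n := 3)
    (Set.pair_subset ha hb) (by rw [Set.ncard_pair hab]; norm_num) (by rw [hs.1]; norm_num)
  exact (hs.2 t hts htc).isBasisPair (ht (Or.inl rfl)) (ht (Or.inr rfl)) hab

theorem isLaxTetrabasis_of_isBasisPair {s : Set (LaxVector R)} (hs : s.ncard = 4)
    (h : ∀ a ∈ s, ∀ b ∈ s, a ≠ b → IsBasisPair a b) : IsLaxTetrabasis s := by
  refine ⟨hs, fun t ht hc => ?_⟩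
  obtain ⟨a, b, c, hab, hac, hbc, rfl⟩ := Set.ncard_eq_three.mp hc
  exact isLaxSuperbasis_of_isBasisPair (h a (ht (by simp)) b (ht (by simp)) hab)
    (h a (ht (by simp)) c (ht (by simp)) hac) (h b (ht (by simp)) c (ht (by simp)) hbc)

end Tetrabasis

/-! ### The standard tetrabasis and its stabilizer. -/

namespace EisensteinInt

open LaxVector CoxeterMatrix

theorem isUnit_of_norm_eq_one {z : EisensteinInt} (hz : QuadraticAlgebra.norm z = 1) :
    IsUnit z := by
  rcases eq_of_norm_eq_one hz with rfl | rfl | rfl | rfl | rfl | rfl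
  · exact IsUnit.of_mul_eq_one ⟨1, 0⟩ (by decide)
  · exact IsUnit.of_mul_eq_one ⟨0, -1⟩ (by decide)
  · exact IsUnit.of_mul_eq_one ⟨-1, -1⟩ (by decide)
  · exact IsUnit.of_mul_eq_one ⟨-1, 0⟩ (by decide)
  · exact IsUnit.of_mul_eq_one ⟨0, 1⟩ (by decide)
  · exact IsUnit.of_mul_eq_one ⟨1, 1⟩ (by decide)

/-- The fourth vector of the standard tetrabasis. -/
def e₄ : LaxVector EisensteinInt := vec 1 ⟨1, 1⟩ isCoprime_one_left

/-- The fourth vector of the other tetrabasis that contains the standard superbasis. -/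
def e₄' : LaxVector EisensteinInt := vec 1 ⟨0, -1⟩ isCoprime_one_left

theorem isBasisPair_e₁_e₄ : IsBasisPair e₁ e₄ :=
  isBasisPair_vec_iff.mpr (isUnit_of_norm_eq_one (by decide))

theorem isBasisPair_e₂_e₄ : IsBasisPair e₂ e₄ :=
  isBasisPair_vec_iff.mpr (isUnit_of_norm_eq_one (by decide))

theorem isBasisPair_e₃_e₄ : IsBasisPair e₃ e₄ :=
  isBasisPair_vec_iff.mpr (isUnit_of_norm_eq_one (by decide))

theorem e₄'_ne_e₄ : e₄' ≠ e₄ := by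
  intro h
  obtain ⟨ε, h1, h2⟩ := vec_eq_vec_iff.mp h
  rw [mul_one] at h1
  rw [← h1] at h2
  revert h2
  decide

theorem isBasisPair_e₁_e₄' : IsBasisPair e₁ e₄' :=
  isBasisPair_vec_iff.mpr (isUnit_of_norm_eq_one (by decide))

theorem isBasisPair_e₂_e₄' : IsBasisPair e₂ e₄' :=
  isBasisPair_vec_iff.mpr (isUnit_of_norm_eq_one (by decide))

theorem isBasisPair_e₃_e₄' : IsBasisPair e₃ e₄' :=
  isBasisPair_vec_iff.mpr (isUnit_of_norm_eq_one (by decide))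

/-- The standard tetrabasis. -/
def base : LaxTetrabasis EisensteinInt :=
  ⟨{e₁, e₂, e₃, e₄}, isLaxTetrabasis_of_isBasisPair
    (by
      rw [Set.ncard_insert_of_notMem, Set.ncard_eq_three.mpr ⟨e₂, e₃, e₄, isBasisPair_e₂_e₃.ne,
        isBasisPair_e₂_e₄.ne, isBasisPair_e₃_e₄.ne, rfl⟩]
      rintro (h | h | h)
      · exact isBasisPair_e₁_e₂.ne h
      · exact isBasisPair_e₁_e₃.ne h
      · exact isBasisPair_e₁_e₄.ne h)
    (by
      rintro a (rfl | rfl | rfl | rfl) b (rfl | rfl | rfl | rfl) hab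
      · exact absurd rfl hab
      · exact isBasisPair_e₁_e₂
      · exact isBasisPair_e₁_e₃
      · exact isBasisPair_e₁_e₄
      · exact isBasisPair_e₁_e₂.symm
      · exact absurd rfl hab
      · exact isBasisPair_e₂_e₃
      · exact isBasisPair_e₂_e₄
      · exact isBasisPair_e₁_e₃.symm
      · exact isBasisPair_e₂_e₃.symm
      · exact absurd rfl hab
      · exact isBasisPair_e₃_e₄
      · exact isBasisPair_e₁_e₄.symm
      · exact isBasisPair_e₂_e₄.symm
      · exact isBasisPair_e₃_e₄.symm
      · exact absurd rfl hab)⟩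

instance : MulAction type336.Group (LaxTetrabasis EisensteinInt) := laxTetrabasisAction

theorem simple_zero_smul_e₄ : type336.simple 0 • e₄ = e₄ :=
  isReflectionAction.simple_zero_smul_vec_eq_iff.mpr ⟨u, by decide, by decide⟩

theorem simple_one_smul_e₄ : type336.simple 1 • e₄ = e₄ :=
  isReflectionAction.simple_one_smul_vec_eq_iff.mpr ⟨u ^ 2, by decide, by decide⟩

theorem simple_two_smul_e₃ : type336.simple 2 • (e₃ : LaxVector EisensteinInt) = e₄ :=
  isReflectionAction.simple_two_smul_vec_eq_iff.mpr ⟨1, by decide, by decide⟩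

theorem simple_two_smul_e₄ : type336.simple 2 • e₄ = (e₃ : LaxVector EisensteinInt) :=
  isReflectionAction.simple_two_smul_vec_eq_iff.mpr ⟨1, by decide, by decide⟩

theorem simple_three_smul_e₄ : type336.simple 3 • e₄ = e₄' :=
  isReflectionAction.simple_three_smul_vec_eq_iff.mpr ⟨1, by decide, by decide⟩

theorem coe_base : base.1 = {e₁, e₂, e₃, e₄} := rfl

/-- The reflections `s₀`, `s₁`, `s₂` act on `e₁`, `e₂`, `e₃`, `e₄` as the three adjacent
transpositions. -/
theorem simple_smul_base {i : Fin 4} (hi : i ≠ 3) : type336.simple i • base = base := by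
  refine Subtype.ext ?_
  change type336.simple i • ({e₁, e₂, e₃, e₄} : Set (LaxVector EisensteinInt)) = {e₁, e₂, e₃, e₄}
  have h := isReflectionAction
  simp only [Set.smul_set_insert, Set.smul_set_singleton]
  match i, hi with
  | 0, _ =>
    rw [h.simple_zero_smul_e₁, h.simple_zero_smul_e₂, h.simple_zero_smul_e₃, simple_zero_smul_e₄,
      Set.insert_comm]
  | 1, _ =>
    rw [h.simple_one_smul_e₁, h.simple_one_smul_e₂, h.simple_one_smul_e₃, simple_one_smul_e₄,
      Set.insert_comm e₃]
  | 2, _ =>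
    rw [h.simple_two_smul_e₁, h.simple_two_smul_e₂, simple_two_smul_e₃, simple_two_smul_e₄,
      Set.pair_comm]
  | 3, hi => exact absurd rfl hi

theorem coe_simple_three_smul_base : (type336.simple 3 • base).1 = {e₁, e₂, e₃, e₄'} := by
  change type336.simple 3 • ({e₁, e₂, e₃, e₄} : Set (LaxVector EisensteinInt)) = _
  have h := isReflectionAction
  simp only [Set.smul_set_insert, Set.smul_set_singleton]
  rw [h.simple_three_smul_e₁, h.simple_three_smul_e₂, h.simple_three_smul_e₃, simple_three_smul_e₄]

/-- A lax vector that forms a superbasis with any two vectors of the standard superbasis is one of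
two. -/
theorem eq_e₄_or_eq_e₄' {a : LaxVector EisensteinInt} (h₁ : IsBasisPair e₁ a)
    (h₂ : IsBasisPair e₂ a) (h₃ : IsBasisPair e₃ a) : a = e₄ ∨ a = e₄' := by
  obtain ⟨x, y, h, rfl⟩ := exists_eq_vec a
  rw [e₁, isBasisPair_vec_iff, one_mul, zero_mul, sub_zero] at h₁
  rw [e₂, isBasisPair_vec_iff, one_mul, zero_mul, zero_sub, IsUnit.neg_iff] at h₂
  rw [e₃, isBasisPair_vec_iff, one_mul, one_mul] at h₃
  obtain ⟨ε, rfl⟩ := h₂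
  obtain ⟨δ, rfl⟩ := h₁
  -- Up to a unit the vector is `(1, t)` with `t` and `t - 1` both units. Only the two primitive
  -- sixth roots of unity `1 + ω` and `-ω` qualify.
  obtain ⟨t, rfl⟩ : ∃ t : EisensteinIntˣ, δ = ε * t := ⟨ε⁻¹ * δ, by rw [mul_inv_cancel_left]⟩
  have ht : IsUnit ((t : EisensteinInt) - 1) := by
    refine isUnit_of_mul_isUnit_right (x := (ε : EisensteinInt)) ?_
    convert h₃ using 1
    push_cast
    ring
  have key (z : EisensteinInt) (hz : (t : EisensteinInt) = z) :
      vec (ε : EisensteinInt) ((ε * t : EisensteinIntˣ) : EisensteinInt) h =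
        vec 1 z isCoprime_one_left :=
    (vec_eq_vec_iff.mpr ⟨ε, (mul_one _).symm, by rw [← hz, Units.val_mul]⟩).symm
  have hn := norm_eq_one_of_isUnit ht
  rcases eq_of_norm_eq_one (norm_eq_one_of_isUnit t.isUnit) with h | h | h | h | h | h
  · rw [h] at hn; exact absurd hn (by decide)
  · exact Or.inl (key _ h)
  · rw [h] at hn; exact absurd hn (by decide)
  · rw [h] at hn; exact absurd hn (by decide)
  · rw [h] at hn; exact absurd hn (by decide)
  · exact Or.inr (key _ h)

theorem isTopographPoint :
    IsTopographPoint type336 (fun s : LaxTetrabasis EisensteinInt => s.1) base where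
  vec_smul _ _ := rfl
  psl_smul g w h p := Subtype.ext (Set.image_congr fun a _ => h a)
  e₁_mem := Or.inl rfl
  e₂_mem := Or.inr (Or.inl rfl)
  e₃_mem := Or.inr (Or.inr (Or.inl rfl))
  simple_smul i hi := simple_smul_base hi
  simple_three_smul h := by
    have hmem : e₄' ∈ base.1 := by
      rw [← h, coe_simple_three_smul_base]
      simp
    rw [coe_base] at hmem
    rcases hmem with h | h | h | h
    · exact isBasisPair_e₁_e₄'.ne h.symm
    · exact isBasisPair_e₂_e₄'.ne h.symm
    · exact isBasisPair_e₃_e₄'.ne h.symm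
    · exact e₄'_ne_e₄ h
  exists_superbasis p := by
    obtain ⟨t, ht, htc⟩ := Set.exists_subset_card_eq (s := p.1) (n := 3) (by rw [p.2.1]; norm_num)
    have hs := p.2.2 t ht htc
    obtain ⟨a, b, c, hab, hac, hbc, rfl⟩ := Set.ncard_eq_three.mp htc
    exact ⟨a, ht (by simp), b, ht (by simp), c, ht (by simp), hs.isBasisPair (by simp) (by simp) hab,
      hs.isBasisPair (by simp) (by simp) hac, hs.isBasisPair (by simp) (by simp) hbc⟩
  eq_or_eq p h₁ h₂ h₃ := by
    obtain ⟨d, hd, hde⟩ := Set.exists_mem_notMem_of_ncard_lt_ncard (s := {e₁, e₂, e₃}) (t := p.1)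
      (by
        rw [p.2.1, Set.ncard_eq_three.mpr ⟨e₁, e₂, e₃, isBasisPair_e₁_e₂.ne, isBasisPair_e₁_e₃.ne,
          isBasisPair_e₂_e₃.ne, rfl⟩]
        norm_num)
    simp only [Set.mem_insert_iff, Set.mem_singleton_iff, not_or] at hde
    have key (q : LaxTetrabasis EisensteinInt) (hq : q.1 ⊆ p.1) : p = q :=
      (Subtype.ext (Set.eq_of_subset_of_ncard_le hq (by rw [p.2.1, q.2.1])
        (Set.finite_of_ncard_ne_zero (by rw [p.2.1]; norm_num)))).symm
    rcases eq_e₄_or_eq_e₄' (p.2.isBasisPair h₁ hd (Ne.symm hde.1))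
      (p.2.isBasisPair h₂ hd (Ne.symm hde.2.1)) (p.2.isBasisPair h₃ hd (Ne.symm hde.2.2)) with
      rfl | rfl
    · exact Or.inl (key _ (by
        rw [coe_base]
        exact Set.insert_subset h₁ (Set.insert_subset h₂ (Set.pair_subset h₃ hd))))
    · exact Or.inr (key _ (by
        rw [coe_simple_three_smul_base]
        exact Set.insert_subset h₁ (Set.insert_subset h₂ (Set.pair_subset h₃ hd))))
  exists_smul_eq_e₁ := by
    have h := isReflectionAction
    have h0 : type336.simple 0 ∈ type336.parabolic {0, 1, 2} := simple_mem_parabolic _ (by simp)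
    have h1 : type336.simple 1 ∈ type336.parabolic {0, 1, 2} := simple_mem_parabolic _ (by simp)
    have h2 : type336.simple 2 ∈ type336.parabolic {0, 1, 2} := simple_mem_parabolic _ (by simp)
    rintro a (rfl | rfl | rfl | rfl)
    · exact ⟨1, one_mem _, one_smul _ _⟩
    · exact ⟨_, h0, h.simple_zero_smul_e₂⟩
    · exact ⟨_, mul_mem h0 h1, by rw [mul_smul, h.simple_one_smul_e₃, h.simple_zero_smul_e₂]⟩
    · exact ⟨_, mul_mem (mul_mem h0 h1) h2, by
        rw [mul_smul, mul_smul, simple_two_smul_e₄, h.simple_one_smul_e₃, h.simple_zero_smul_e₂]⟩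
  exists_smul_eq_e₂ := by
    have h := isReflectionAction
    have h1 : type336.simple 1 ∈ type336.parabolic {1, 2} := simple_mem_parabolic _ (by simp)
    have h2 : type336.simple 2 ∈ type336.parabolic {1, 2} := simple_mem_parabolic _ (by simp)
    rintro a (rfl | rfl | rfl | rfl) ha
    · exact absurd rfl ha.ne
    · exact ⟨1, one_mem _, one_smul _ _⟩
    · exact ⟨_, h1, h.simple_one_smul_e₃⟩
    · exact ⟨_, mul_mem h1 h2, by rw [mul_smul, simple_two_smul_e₄, h.simple_one_smul_e₃]⟩
  exists_smul_eq_e₃ := by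
    rintro a (rfl | rfl | rfl | rfl) ha ha'
    · exact absurd rfl ha.ne
    · exact absurd rfl ha'.ne
    · exact ⟨1, one_mem _, one_smul _ _⟩
    · exact ⟨_, simple_mem_parabolic _ (by simp), simple_two_smul_e₄⟩

end EisensteinInt

theorem exists_equivariantIso_eisensteinTopograph :
    ∃ ι : PSL(2, EisensteinInt) →* CoxeterMatrix.type336.Group,
      Function.Injective ι ∧
      ι.range ≤ CoxeterMatrix.type336.evenSubgroup ∧
      ι.range.relIndex CoxeterMatrix.type336.evenSubgroup = 2 ∧
      Nonempty (eisensteinTopograph.flags.EquivariantIso CoxeterMatrix.type336.geometry ι) :=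
  EisensteinInt.isTopographPoint.exists_equivariantIso _ EisensteinInt.isTopographRing
    EisensteinInt.isReflectionAction CoxeterMatrix.isCartan_cartan336
    CoxeterMatrix.type336_ne_zero

/-! ### The Gaussian topograph -/

namespace GaussianInt

open LaxVector CoxeterMatrix

/-- The unit `i`. -/
def u : GaussianIntˣ := ⟨⟨0, 1⟩, ⟨0, -1⟩, by decide, by decide⟩

theorem coe_u : (u : GaussianInt) = ⟨0, 1⟩ := rfl

theorem isLiftable_reflectionEnd_u : type344.IsLiftable (reflectionEnd u) :=
  isLiftable_reflectionEnd (by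
    intro i j B hB
    subst hB
    revert i j
    change ∀ i j : Fin 4, ((reflectionEntries (⟨0, 1⟩ : GaussianInt) i *
      (reflectionEntries (⟨0, 1⟩ : GaussianInt) j).map star) ^ type344 i j) 0 1 = 0 ∧ _
    decide +kernel)

instance : MulAction type344.Group (LaxVector GaussianInt) :=
  reflectionAction isLiftable_reflectionEnd_u

theorem eq_of_isUnit {z : GaussianInt} (hz : IsUnit z) :
    z = ⟨1, 0⟩ ∨ z = ⟨0, 1⟩ ∨ z = ⟨-1, 0⟩ ∨ z = ⟨0, -1⟩ := by
  have h := (Zsqrtd.norm_eq_one_iff' (by norm_num) z).mpr hz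
  obtain ⟨a, b⟩ := z
  rw [Zsqrtd.norm_def] at h
  dsimp only at h
  have ha : -1 ≤ a ∧ a ≤ 1 := by constructor <;> nlinarith [sq_nonneg b]
  have hb : -1 ≤ b ∧ b ≤ 1 := by constructor <;> nlinarith [sq_nonneg a]
  obtain ⟨ha1, ha2⟩ := ha
  obtain ⟨hb1, hb2⟩ := hb
  interval_cases a <;> interval_cases b <;> simp_all

theorem exists_eq_u_pow (ε : GaussianIntˣ) : ∃ k : ℕ, ε = u ^ k := by
  rcases eq_of_isUnit ε.isUnit with h | h | h | h
  · exact ⟨0, Units.ext (h.trans (by decide))⟩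
  · exact ⟨1, Units.ext (h.trans (by decide))⟩
  · exact ⟨2, Units.ext (h.trans (by decide))⟩
  · exact ⟨3, Units.ext (h.trans (by decide))⟩

theorem isTopographRing : IsTopographRing GaussianInt u where
  exists_pow := exists_eq_u_pow
  closure_pow := by
    refine (AddSubgroup.eq_top_iff' _).mpr fun z => ?_
    have h0 : ((u ^ 0 : GaussianIntˣ) : GaussianInt) = ⟨1, 0⟩ := by decide
    have h1 : ((u ^ 1 : GaussianIntˣ) : GaussianInt) = ⟨0, 1⟩ := by decide
    have hz : z = z.re • ((u ^ 0 : GaussianIntˣ) : GaussianInt) +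
        z.im • ((u ^ 1 : GaussianIntˣ) : GaussianInt) := by
      rw [h0, h1]
      ext <;> simp
    rw [hz]
    exact add_mem (zsmul_mem (AddSubgroup.subset_closure (Set.mem_range_self 0)) _)
      (zsmul_mem (AddSubgroup.subset_closure (Set.mem_range_self 1)) _)
  exists_remainder := ⟨fun z => z.norm.natAbs, fun x y hy => ⟨x / y, by
    have h := GaussianInt.natAbs_norm_mod_lt x hy
    rwa [GaussianInt.mod_def, mul_comm] at h⟩⟩
  sq_ne ε h := by
    have h' : (ε : GaussianInt) ^ 2 = ⟨0, 1⟩ := congrArg Units.val h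
    rcases eq_of_isUnit ε.isUnit with h | h | h | h <;> (rw [h] at h'; revert h'; decide)

theorem unit_mul_star (ε : GaussianIntˣ) : (ε : GaussianInt) * star (ε : GaussianInt) = 1 := by
  rcases eq_of_isUnit ε.isUnit with h | h | h | h <;> (rw [h]; decide)

/-- The coordinates of a lax vector with respect to the walls of the standard chamber. -/
def weight (a : LaxVector GaussianInt) : Fin 4 → ℤ :=
  let H := hermitianEntries unit_mul_star a
  ![H.1.re - H.2.1.re, H.2.1.re - 2 * H.2.2.re, H.2.2.re + H.2.2.im, -H.2.2.im]

theorem simple_smul (i : Fin 4) (a : LaxVector GaussianInt) :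
    type344.simple i • a = reflectionMatrix u i • a.conj :=
  reflectionAction_simple_smul isLiftable_reflectionEnd_u i a

theorem weight_vec {x y : GaussianInt} (h : IsCoprime x y) :
    weight (vec x y h) = ![(x * star x).re - (y * star y).re,
      (y * star y).re - 2 * (x * star y).re,
      (x * star y).re + (x * star y).im, -(x * star y).im] := rfl

/-- As over the Eisenstein integers, coordinate `i` is a form negated by `s_i`. Only the trace in
`|x - y|² - |x|² = |y|² - tr(x ȳ)` looks different, since `i` has trace zero while `ω` has trace -1.
-/
theorem weight_simple_smul (i : Fin 4) (a : LaxVector GaussianInt) (j : Fin 4) :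
    weight (type344.simple i • a) j = weight a j - cartan344 i j * weight a i := by
  obtain ⟨x, y, h, rfl⟩ := exists_eq_vec a
  rw [simple_smul, conj_vec, gl_smul_vec, weight_vec, weight_vec, coe_reflectionMatrix, coe_u]
  obtain ⟨a, b⟩ := x
  obtain ⟨c, d⟩ := y
  fin_cases i <;> fin_cases j <;> simp [reflectionEntries, cartan344] <;> ring

theorem isReflectionAction : IsReflectionAction u type344 where
  simple_smul := simple_smul
  eq_one_of_forall := eq_one_of_forall_smul_eq isCartan_cartan344 type344_ne_zero weight
    weight_simple_smul (by
      intro v hv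
      have h1 := hv e₁
      have h2 := hv e₂
      have h3 := hv e₃
      have h4 := hv (vec 1 ⟨0, 1⟩ isCoprime_one_left)
      simp only [e₁, e₂, e₃, weight_vec, Fin.sum_univ_four] at h1 h2 h3 h4
      simp at h1 h2 h3 h4
      ext i
      fin_cases i <;> simp <;> lia)

instance : PreservesBasisPairs type344.Group GaussianInt := isReflectionAction.preservesBasisPairs

end GaussianInt

/-! ### Cubases as triples of pairs. -/

section Cubasis

variable {R : Type} [CommRing R]

/-- The cubasis `P` consists of the two-element sets `A`, `B`, `C`. -/
structure IsCubasisTriple (P : Set (Set (LaxVector R))) (A B C : Set (LaxVector R)) : Prop where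
  eq : P = {A, B, C}
  card_left : A.ncard = 2
  card_middle : B.ncard = 2
  card_right : C.ncard = 2
  left_middle : ∀ a ∈ A, ∀ b ∈ B, IsBasisPair a b
  left_right : ∀ a ∈ A, ∀ c ∈ C, IsBasisPair a c
  middle_right : ∀ b ∈ B, ∀ c ∈ C, IsBasisPair b c

variable [Nontrivial R]

theorem IsLaxCubasis.exists_isCubasisTriple {P : Set (Set (LaxVector R))} (hP : IsLaxCubasis P) :
    ∃ A B C, IsCubasisTriple P A B C := by
  obtain ⟨-, u, v, w, hu, hv, hw, rfl, h⟩ := hP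
  -- A transversal is a superbasis and so has three elements; a coincidence would leave at most two.
  have hne (i j k : Fin 2) : u i ≠ v j ∧ u i ≠ w k ∧ v j ≠ w k := by
    have hc := (h i j k).1
    have hlt : ∀ x y : LaxVector R, ({x, y} : Set (LaxVector R)).ncard ≠ 3 := fun x y hxy => by
      have := Set.ncard_insert_le x {y}
      rw [Set.ncard_singleton] at this
      lia
    refine ⟨fun e => ?_, fun e => ?_, fun e => ?_⟩
    · rw [e, Set.insert_eq_of_mem (Set.mem_insert _ _)] at hc
      exact hlt _ _ hc
    · rw [e, Set.insert_eq_of_mem (by simp : w k ∈ ({v j, w k} : Set (LaxVector R)))] at hc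
      exact hlt _ _ hc
    · rw [e, Set.pair_eq_singleton] at hc
      exact hlt _ _ hc
  have hmem (t : Fin 2 → LaxVector R) (a : LaxVector R) (ha : a ∈ ({t 0, t 1} : Set (LaxVector R))) :
      ∃ i, a = t i := by
    rcases ha with rfl | rfl
    · exact ⟨0, rfl⟩
    · exact ⟨1, rfl⟩
  refine ⟨_, _, _, rfl, Set.ncard_pair hu, Set.ncard_pair hv, Set.ncard_pair hw, fun a ha b hb => ?_,
    fun a ha c hc => ?_, fun b hb c hc => ?_⟩
  · obtain ⟨i, rfl⟩ := hmem u a ha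
    obtain ⟨j, rfl⟩ := hmem v b hb
    exact (h i j 0).isBasisPair (by simp) (by simp) (hne i j 0).1
  · obtain ⟨i, rfl⟩ := hmem u a ha
    obtain ⟨k, rfl⟩ := hmem w c hc
    exact (h i 0 k).isBasisPair (by simp) (by simp) (hne i 0 k).2.1
  · obtain ⟨j, rfl⟩ := hmem v b hb
    obtain ⟨k, rfl⟩ := hmem w c hc
    exact (h 0 j k).isBasisPair (by simp) (by simp) (hne 0 j k).2.2

namespace IsCubasisTriple

variable {P : Set (Set (LaxVector R))} {A B C : Set (LaxVector R)}

theorem swap_left (h : IsCubasisTriple P A B C) : IsCubasisTriple P B A C where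
  eq := by rw [h.eq, Set.insert_comm]
  card_left := h.card_middle
  card_middle := h.card_left
  card_right := h.card_right
  left_middle b hb a ha := (h.left_middle a ha b hb).symm
  left_right := h.middle_right
  middle_right := h.left_right

theorem swap_right (h : IsCubasisTriple P A B C) : IsCubasisTriple P A C B where
  eq := by rw [h.eq, Set.pair_comm]
  card_left := h.card_left
  card_middle := h.card_right
  card_right := h.card_middle
  left_middle := h.left_right
  left_right := h.left_middle
  middle_right b hb a ha := (h.middle_right a ha b hb).symm

theorem exists_mem_left (h : IsCubasisTriple P A B C) : ∃ a, a ∈ A := by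
  obtain ⟨x, y, -, rfl⟩ := Set.ncard_eq_two.mp h.card_left
  exact ⟨x, Or.inl rfl⟩

theorem isLaxCubasis (h : IsCubasisTriple P A B C) : IsLaxCubasis P := by
  obtain ⟨a, ha⟩ := h.exists_mem_left
  obtain ⟨b, hb⟩ := h.swap_left.exists_mem_left
  -- The three pairs are distinct because no vector forms a basis with itself.
  refine ⟨Set.ncard_eq_three.mpr ⟨A, B, C, ?_, ?_, ?_, h.eq⟩, ?_⟩
  · rintro rfl; exact (h.left_middle a ha a ha).ne rfl
  · rintro rfl; exact (h.left_right a ha a ha).ne rfl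
  · rintro rfl; exact (h.middle_right b hb b hb).ne rfl
  obtain ⟨a, a', haa, rfl⟩ := Set.ncard_eq_two.mp h.card_left
  obtain ⟨b, b', hbb, rfl⟩ := Set.ncard_eq_two.mp h.card_middle
  obtain ⟨c, c', hcc, rfl⟩ := Set.ncard_eq_two.mp h.card_right
  have hmem (x y : LaxVector R) (i : Fin 2) : ![x, y] i ∈ ({x, y} : Set (LaxVector R)) := by
    fin_cases i <;> simp
  exact ⟨![a, a'], ![b, b'], ![c, c'], haa, hbb, hcc, h.eq, fun i j k =>
    isLaxSuperbasis_of_isBasisPair (h.left_middle _ (hmem _ _ i) _ (hmem _ _ j))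
      (h.left_right _ (hmem _ _ i) _ (hmem _ _ k)) (h.middle_right _ (hmem _ _ j) _ (hmem _ _ k))⟩

end IsCubasisTriple

theorem IsLaxCubasis.exists_isCubasisTriple_mem {P : Set (Set (LaxVector R))} (hP : IsLaxCubasis P)
    {a : LaxVector R} (ha : a ∈ ⋃₀ P) : ∃ A B C, IsCubasisTriple P A B C ∧ a ∈ A := by
  obtain ⟨A, B, C, h⟩ := hP.exists_isCubasisTriple
  rw [h.eq] at ha
  obtain ⟨S, rfl | rfl | rfl, haS⟩ := ha
  · exact ⟨_, _, _, h, haS⟩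
  · exact ⟨_, _, _, h.swap_left, haS⟩
  · exact ⟨_, _, _, h.swap_right.swap_left, haS⟩

end Cubasis

/-! ### The standard cubasis and its stabilizer. -/

namespace GaussianInt

open LaxVector CoxeterMatrix

/-- Reduction modulo `1 + i`. -/
def parity : GaussianInt →+* ZMod 2 := Zsqrtd.lift ⟨1, by decide⟩

theorem parity_eq_one {z : GaussianInt} (hz : IsUnit z) : parity z = 1 := by
  have h : ∀ x : ZMod 2, x ≠ 0 → x = 1 := by decide
  exact h _ (hz.map parity).ne_zero

/-- There are no four lax vectors any two of which form a basis, since the projective line over the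
field with two elements has only three points. -/
theorem not_isBasisPair {a b c d : LaxVector GaussianInt} (hac : IsBasisPair a c)
    (had : IsBasisPair a d) (hbc : IsBasisPair b c) (hbd : IsBasisPair b d)
    (hcd : IsBasisPair c d) : ¬IsBasisPair a b := by
  intro hab
  obtain ⟨x, y, _, rfl⟩ := exists_eq_vec a
  obtain ⟨z, t, _, rfl⟩ := exists_eq_vec b
  obtain ⟨p, q, _, rfl⟩ := exists_eq_vec c
  obtain ⟨r, s, _, rfl⟩ := exists_eq_vec d
  rw [isBasisPair_vec_iff] at hab hac had hbc hbd hcd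
  have key : ∀ x y z t p q r s : ZMod 2, x * t - y * z = 1 → x * q - y * p = 1 →
      x * s - y * r = 1 → z * q - t * p = 1 → z * s - t * r = 1 → p * s - q * r = 1 → False := by
    decide +kernel
  refine key (parity x) (parity y) (parity z) (parity t) (parity p) (parity q) (parity r) (parity s)
    ?_ ?_ ?_ ?_ ?_ ?_ <;> rw [← map_mul, ← map_mul, ← map_sub] <;> apply parity_eq_one <;> assumption

theorem exists_isCubasisTriple_mem_mem {P : Set (Set (LaxVector GaussianInt))}
    (hP : IsLaxCubasis P) {a b c : LaxVector GaussianInt} (ha : a ∈ ⋃₀ P) (hb : b ∈ ⋃₀ P)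
    (hc : c ∈ ⋃₀ P) (hab : IsBasisPair a b) (hac : IsBasisPair a c) (hbc : IsBasisPair b c) :
    ∃ A B C, IsCubasisTriple P A B C ∧ a ∈ A ∧ b ∈ B ∧ c ∈ C := by
  -- Two vectors of the same pair that formed a basis would, together with one vector from each
  -- other pair, be four vectors that are pairwise bases. Hence a superbasis in a cubasis is a
  -- transversal.
  have hnot {A B C : Set (LaxVector GaussianInt)} (h : IsCubasisTriple P A B C)
      {x y : LaxVector GaussianInt} (hx : x ∈ A) (hy : y ∈ A) : ¬IsBasisPair x y := by
    obtain ⟨z, hz⟩ := h.swap_left.exists_mem_left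
    obtain ⟨t, ht⟩ := h.swap_right.swap_left.exists_mem_left
    exact not_isBasisPair (h.left_middle x hx z hz) (h.left_right x hx t ht)
      (h.left_middle y hy z hz) (h.left_right y hy t ht) (h.middle_right z hz t ht)
  obtain ⟨A, B₀, C₀, h₀, haA⟩ := hP.exists_isCubasisTriple_mem ha
  obtain ⟨B, C, h, hbB⟩ : ∃ B C, IsCubasisTriple P A B C ∧ b ∈ B := by
    rw [h₀.eq] at hb
    obtain ⟨S, rfl | rfl | rfl, hbS⟩ := hb
    · exact absurd hab (hnot h₀ haA hbS)
    · exact ⟨_, _, h₀, hbS⟩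
    · exact ⟨_, _, h₀.swap_right, hbS⟩
  refine ⟨A, B, C, h, haA, hbB, ?_⟩
  rw [h.eq] at hc
  obtain ⟨S, rfl | rfl | rfl, hcS⟩ := hc
  · exact absurd hac (hnot h haA hcS)
  · exact absurd hbc (hnot h.swap_left hbB hcS)
  · exact hcS

theorem isUnit_of_norm_eq_one {z : GaussianInt} (hz : z.norm = 1) : IsUnit z :=
  (Zsqrtd.norm_eq_one_iff' (by norm_num) z).mp hz

/-- The vector opposite to `e₁` in the standard cubasis. -/
def f₁ : LaxVector GaussianInt := vec 1 ⟨1, 1⟩ isCoprime_one_left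

/-- The vector opposite to `e₂` in the standard cubasis. -/
def f₂ : LaxVector GaussianInt := vec ⟨1, -1⟩ 1 isCoprime_one_right

/-- The vector opposite to `e₃` in the standard cubasis. -/
def f₃ : LaxVector GaussianInt := vec 1 ⟨0, 1⟩ isCoprime_one_left

/-- The vector opposite to `e₁` in the conjugate of the standard cubasis. -/
def f₁' : LaxVector GaussianInt := vec 1 ⟨1, -1⟩ isCoprime_one_left

/-- The vector opposite to `e₂` in the conjugate of the standard cubasis. -/
def f₂' : LaxVector GaussianInt := vec ⟨1, 1⟩ 1 isCoprime_one_right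

/-- The vector opposite to `e₃` in the conjugate of the standard cubasis. -/
def f₃' : LaxVector GaussianInt := vec 1 ⟨0, -1⟩ isCoprime_one_left

theorem isBasisPair_e₁_f₂ : IsBasisPair e₁ f₂ :=
  isBasisPair_vec_iff.mpr (isUnit_of_norm_eq_one (by decide))

theorem isBasisPair_e₁_f₃ : IsBasisPair e₁ f₃ :=
  isBasisPair_vec_iff.mpr (isUnit_of_norm_eq_one (by decide))

theorem isBasisPair_e₂_f₁ : IsBasisPair e₂ f₁ :=
  isBasisPair_vec_iff.mpr (isUnit_of_norm_eq_one (by decide))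

theorem isBasisPair_e₂_f₃ : IsBasisPair e₂ f₃ :=
  isBasisPair_vec_iff.mpr (isUnit_of_norm_eq_one (by decide))

theorem isBasisPair_e₃_f₁ : IsBasisPair e₃ f₁ :=
  isBasisPair_vec_iff.mpr (isUnit_of_norm_eq_one (by decide))

theorem isBasisPair_e₃_f₂ : IsBasisPair e₃ f₂ :=
  isBasisPair_vec_iff.mpr (isUnit_of_norm_eq_one (by decide))

theorem isBasisPair_f₁_f₂ : IsBasisPair f₁ f₂ :=
  isBasisPair_vec_iff.mpr (isUnit_of_norm_eq_one (by decide))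

theorem isBasisPair_f₁_f₃ : IsBasisPair f₁ f₃ :=
  isBasisPair_vec_iff.mpr (isUnit_of_norm_eq_one (by decide))

theorem isBasisPair_f₂_f₃ : IsBasisPair f₂ f₃ :=
  isBasisPair_vec_iff.mpr (isUnit_of_norm_eq_one (by decide))

theorem not_isBasisPair_e₁_f₁ : ¬IsBasisPair e₁ f₁ := fun h =>
  absurd (eq_of_isUnit (isBasisPair_vec_iff.mp h)) (by decide)

theorem not_isBasisPair_e₂_f₂ : ¬IsBasisPair e₂ f₂ := fun h =>
  absurd (eq_of_isUnit (isBasisPair_vec_iff.mp h)) (by decide)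

theorem e₁_ne_f₁ : (e₁ : LaxVector GaussianInt) ≠ f₁ := by
  intro h
  obtain ⟨ε, -, h2⟩ := vec_eq_vec_iff.mp h
  rw [mul_zero] at h2
  revert h2
  decide

theorem e₂_ne_f₂ : (e₂ : LaxVector GaussianInt) ≠ f₂ := by
  intro h
  obtain ⟨ε, h1, -⟩ := vec_eq_vec_iff.mp h
  rw [mul_zero] at h1
  revert h1
  decide

theorem e₃_ne_f₃ : (e₃ : LaxVector GaussianInt) ≠ f₃ := by
  intro h
  obtain ⟨ε, h1, h2⟩ := vec_eq_vec_iff.mp h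
  rw [← h1] at h2
  revert h2
  decide

theorem simple_zero_smul_f₁ : type344.simple 0 • f₁ = f₂ :=
  isReflectionAction.simple_zero_smul_vec_eq_iff.mpr ⟨1, by decide, by decide⟩

theorem simple_zero_smul_f₂ : type344.simple 0 • f₂ = f₁ :=
  isReflectionAction.simple_zero_smul_vec_eq_iff.mpr ⟨1, by decide, by decide⟩

theorem simple_zero_smul_f₃ : type344.simple 0 • f₃ = f₃ :=
  isReflectionAction.simple_zero_smul_vec_eq_iff.mpr ⟨u, by decide, by decide⟩

theorem simple_one_smul_f₁ : type344.simple 1 • f₁ = f₁ :=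
  isReflectionAction.simple_one_smul_vec_eq_iff.mpr ⟨u, by decide, by decide⟩

theorem simple_one_smul_f₂ : type344.simple 1 • f₂ = f₃ :=
  isReflectionAction.simple_one_smul_vec_eq_iff.mpr ⟨u, by decide, by decide⟩

theorem simple_one_smul_f₃ : type344.simple 1 • f₃ = f₂ :=
  isReflectionAction.simple_one_smul_vec_eq_iff.mpr ⟨u, by decide, by decide⟩

theorem simple_two_smul_f₁ : type344.simple 2 • f₁ = f₁ :=
  isReflectionAction.simple_two_smul_vec_eq_iff.mpr ⟨1, by decide, by decide⟩

theorem simple_two_smul_f₂ : type344.simple 2 • f₂ = f₂ :=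
  isReflectionAction.simple_two_smul_vec_eq_iff.mpr ⟨u ^ 3, by decide, by decide⟩

theorem simple_two_smul_f₃ : type344.simple 2 • f₃ = e₃ :=
  isReflectionAction.simple_two_smul_vec_eq_iff.mpr ⟨1, by decide, by decide⟩

theorem simple_two_smul_e₃ : type344.simple 2 • (e₃ : LaxVector GaussianInt) = f₃ :=
  isReflectionAction.simple_two_smul_vec_eq_iff.mpr ⟨1, by decide, by decide⟩

theorem simple_three_smul_f₁ : type344.simple 3 • f₁ = f₁' :=
  isReflectionAction.simple_three_smul_vec_eq_iff.mpr ⟨1, by decide, by decide⟩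

theorem simple_three_smul_f₂ : type344.simple 3 • f₂ = f₂' :=
  isReflectionAction.simple_three_smul_vec_eq_iff.mpr ⟨1, by decide, by decide⟩

theorem simple_three_smul_f₃ : type344.simple 3 • f₃ = f₃' :=
  isReflectionAction.simple_three_smul_vec_eq_iff.mpr ⟨1, by decide, by decide⟩

theorem isCubasisTriple_base :
    IsCubasisTriple {{e₁, f₁}, {e₂, f₂}, {e₃, f₃}} {e₁, f₁} {e₂, f₂} {e₃, f₃} where
  eq := rfl
  card_left := Set.ncard_pair e₁_ne_f₁
  card_middle := Set.ncard_pair e₂_ne_f₂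
  card_right := Set.ncard_pair e₃_ne_f₃
  left_middle := by
    rintro a (rfl | rfl) b (rfl | rfl)
    · exact isBasisPair_e₁_e₂
    · exact isBasisPair_e₁_f₂
    · exact isBasisPair_e₂_f₁.symm
    · exact isBasisPair_f₁_f₂
  left_right := by
    rintro a (rfl | rfl) b (rfl | rfl)
    · exact isBasisPair_e₁_e₃
    · exact isBasisPair_e₁_f₃
    · exact isBasisPair_e₃_f₁.symm
    · exact isBasisPair_f₁_f₃
  middle_right := by
    rintro a (rfl | rfl) b (rfl | rfl)
    · exact isBasisPair_e₂_e₃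
    · exact isBasisPair_e₂_f₃
    · exact isBasisPair_e₃_f₂.symm
    · exact isBasisPair_f₂_f₃

/-- The standard cubasis. -/
def base : LaxCubasis GaussianInt :=
  ⟨{{e₁, f₁}, {e₂, f₂}, {e₃, f₃}}, isCubasisTriple_base.isLaxCubasis⟩

instance : MulAction type344.Group (LaxCubasis GaussianInt) := laxCubasisAction

theorem mem_sUnion_base_iff {a : LaxVector GaussianInt} :
    a ∈ ⋃₀ base.1 ↔ a = e₁ ∨ a = f₁ ∨ a = e₂ ∨ a = f₂ ∨ a = e₃ ∨ a = f₃ := by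
  change a ∈ ⋃₀ ({{e₁, f₁}, {e₂, f₂}, {e₃, f₃}} : Set (Set (LaxVector GaussianInt))) ↔ _
  simp only [Set.sUnion_insert, Set.sUnion_singleton, Set.mem_union, Set.mem_insert_iff,
    Set.mem_singleton_iff, or_assoc]

theorem smul_base_eq (w : type344.Group) :
    (w • base).1 = {{w • e₁, w • f₁}, {w • e₂, w • f₂}, {w • e₃, w • f₃}} := by
  change w • ({{e₁, f₁}, {e₂, f₂}, {e₃, f₃}} : Set (Set (LaxVector GaussianInt))) = _
  simp only [Set.smul_set_insert, Set.smul_set_singleton]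

/-- The six vectors are the vertices of an octahedron with opposite vertices `eᵢ`, `fᵢ`. The
reflections act as signed permutations: `s₀` and `s₁` interchange adjacent pairs, and `s₂`
interchanges `e₃` and `f₃`. -/
theorem simple_smul_base {i : Fin 4} (hi : i ≠ 3) : type344.simple i • base = base := by
  refine Subtype.ext ((smul_base_eq _).trans ?_)
  change _ = ({{e₁, f₁}, {e₂, f₂}, {e₃, f₃}} : Set (Set (LaxVector GaussianInt)))
  have h := isReflectionAction
  match i, hi with
  | 0, _ =>
    rw [h.simple_zero_smul_e₁, h.simple_zero_smul_e₂, h.simple_zero_smul_e₃, simple_zero_smul_f₁,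
      simple_zero_smul_f₂, simple_zero_smul_f₃, Set.insert_comm]
  | 1, _ =>
    rw [h.simple_one_smul_e₁, h.simple_one_smul_e₂, h.simple_one_smul_e₃, simple_one_smul_f₁,
      simple_one_smul_f₂, simple_one_smul_f₃, Set.pair_comm ({e₃, f₃} : Set (LaxVector GaussianInt))]
  | 2, _ =>
    rw [h.simple_two_smul_e₁, h.simple_two_smul_e₂, simple_two_smul_e₃, simple_two_smul_f₁,
      simple_two_smul_f₂, simple_two_smul_f₃, Set.pair_comm f₃]
  | 3, hi => exact absurd rfl hi

theorem coe_simple_three_smul_base :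
    (type344.simple 3 • base).1 = {{e₁, f₁'}, {e₂, f₂'}, {e₃, f₃'}} := by
  have h := isReflectionAction
  rw [smul_base_eq, h.simple_three_smul_e₁, h.simple_three_smul_e₂, h.simple_three_smul_e₃,
    simple_three_smul_f₁, simple_three_smul_f₂, simple_three_smul_f₃]

theorem vec_one_ne_vec_one {y z : GaussianInt} (hyz : y ≠ z) :
    vec 1 y isCoprime_one_left ≠ vec 1 z isCoprime_one_left := by
  intro h
  obtain ⟨ε, h1, h2⟩ := vec_eq_vec_iff.mp h
  rw [mul_one] at h1
  rw [← h1, one_mul] at h2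
  exact hyz h2.symm

theorem f₁'_notMem_base : f₁' ∉ ⋃₀ base.1 := by
  rw [mem_sUnion_base_iff]
  rintro (h | h | h | h | h | h)
  · exact vec_one_ne_vec_one (by decide) h
  · exact vec_one_ne_vec_one (by decide) h
  · obtain ⟨ε, h1, -⟩ := vec_eq_vec_iff.mp h
    rw [mul_one] at h1
    exact ε.ne_zero h1.symm
  · obtain ⟨ε, h1, h2⟩ := vec_eq_vec_iff.mp h
    rw [mul_one] at h1
    rw [← h1] at h2
    revert h2
    decide
  · exact vec_one_ne_vec_one (by decide) h
  · exact vec_one_ne_vec_one (by decide) h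

/-- The units of the Gaussian integers. -/
def unitList : List GaussianInt := [⟨1, 0⟩, ⟨0, 1⟩, ⟨-1, 0⟩, ⟨0, -1⟩]

theorem mem_unitList {z : GaussianInt} (hz : IsUnit z) : z ∈ unitList := by
  simpa [unitList] using eq_of_isUnit hz

theorem exists_eq_vec_one {a : LaxVector GaussianInt} (h : IsBasisPair e₂ a) :
    ∃ t, a = vec 1 t isCoprime_one_left := by
  obtain ⟨x, y, hxy, rfl⟩ := exists_eq_vec a
  rw [e₂, isBasisPair_vec_iff, one_mul, zero_mul, zero_sub, IsUnit.neg_iff] at h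
  obtain ⟨ε, rfl⟩ := h
  exact ⟨((ε⁻¹ : GaussianIntˣ) : GaussianInt) * y,
    (vec_eq_vec_iff.mpr ⟨ε, (mul_one _).symm, by simp⟩).symm⟩

theorem exists_eq_vec_one' {a : LaxVector GaussianInt} (h : IsBasisPair e₁ a) :
    ∃ t, a = vec t 1 isCoprime_one_right := by
  obtain ⟨x, y, hxy, rfl⟩ := exists_eq_vec a
  rw [e₁, isBasisPair_vec_iff, one_mul, zero_mul, sub_zero] at h
  obtain ⟨ε, rfl⟩ := h
  exact ⟨((ε⁻¹ : GaussianIntˣ) : GaussianInt) * x,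
    (vec_eq_vec_iff.mpr ⟨ε, by simp, (mul_one _).symm⟩).symm⟩

/-- There are exactly two ways to complete the standard superbasis to a cubasis. -/
theorem eq_of_isBasisPair {a b c : LaxVector GaussianInt} (ha : a ≠ e₁) (hb : b ≠ e₂) (hc : c ≠ e₃)
    (h2a : IsBasisPair e₂ a) (h3a : IsBasisPair e₃ a) (h1b : IsBasisPair e₁ b)
    (h3b : IsBasisPair e₃ b) (h1c : IsBasisPair e₁ c) (h2c : IsBasisPair e₂ c)
    (hab : IsBasisPair a b) (hac : IsBasisPair a c) (hbc : IsBasisPair b c) :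
    (a = f₁ ∧ b = f₂ ∧ c = f₃) ∨ (a = f₁' ∧ b = f₂' ∧ c = f₃') := by
  obtain ⟨t, rfl⟩ := exists_eq_vec_one h2a
  obtain ⟨s, rfl⟩ := exists_eq_vec_one' h1b
  obtain ⟨r, rfl⟩ := exists_eq_vec_one h2c
  have ht : t ≠ 0 := by rintro rfl; exact ha rfl
  have hs : s ≠ 0 := by rintro rfl; exact hb rfl
  have hr : r ≠ 1 := by rintro rfl; exact hc rfl
  rw [e₃, isBasisPair_vec_iff] at h3a h3b
  rw [e₁, isBasisPair_vec_iff] at h1c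
  rw [isBasisPair_vec_iff] at hab hac hbc
  simp only [one_mul, mul_one, sub_zero] at h3a h3b h1c hab hac hbc
  -- With `a = (1, t)`, `b = (s, 1)`, `c = (1, r)`, the pairs with `e₁` and `e₃` make `x = t - 1`,
  -- `y = 1 - s` and `r` units. So only 64 triples have to be checked against the three remaining
  -- determinants.
  have key : ∀ x ∈ unitList, ∀ y ∈ unitList, ∀ r ∈ unitList, x + 1 ≠ 0 → 1 - y ≠ 0 → r ≠ 1 →
      1 - (x + 1) * (1 - y) ∈ unitList → r - (x + 1) ∈ unitList → (1 - y) * r - 1 ∈ unitList →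
      (x + 1 = ⟨1, 1⟩ ∧ 1 - y = ⟨1, -1⟩ ∧ r = ⟨0, 1⟩) ∨
      (x + 1 = ⟨1, -1⟩ ∧ 1 - y = ⟨1, 1⟩ ∧ r = ⟨0, -1⟩) := by
    decide +kernel
  have h := key (t - 1) (mem_unitList h3a) (1 - s) (mem_unitList h3b) r (mem_unitList h1c)
  rw [sub_add_cancel, sub_sub_cancel] at h
  rcases h ht hs hr (mem_unitList hab) (mem_unitList hac) (mem_unitList hbc) with
    ⟨rfl, rfl, rfl⟩ | ⟨rfl, rfl, rfl⟩
  · exact Or.inl ⟨rfl, rfl, rfl⟩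
  · exact Or.inr ⟨rfl, rfl, rfl⟩

theorem exists_eq_pair {A : Set (LaxVector GaussianInt)} (hA : A.ncard = 2)
    {a : LaxVector GaussianInt} (ha : a ∈ A) : ∃ b, b ≠ a ∧ A = {a, b} := by
  obtain ⟨x, y, hxy, rfl⟩ := Set.ncard_eq_two.mp hA
  rcases ha with rfl | rfl
  · exact ⟨y, hxy.symm, rfl⟩
  · exact ⟨x, hxy, Set.pair_comm _ _⟩

theorem eq_base_or_eq {P : LaxCubasis GaussianInt} (h₁ : e₁ ∈ ⋃₀ P.1) (h₂ : e₂ ∈ ⋃₀ P.1)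
    (h₃ : e₃ ∈ ⋃₀ P.1) : P = base ∨ P = type344.simple 3 • base := by
  obtain ⟨A, B, C, h, hA, hB, hC⟩ := exists_isCubasisTriple_mem_mem P.2 h₁ h₂ h₃ isBasisPair_e₁_e₂
    isBasisPair_e₁_e₃ isBasisPair_e₂_e₃
  obtain ⟨a, ha, rfl⟩ := exists_eq_pair h.card_left hA
  obtain ⟨b, hb, rfl⟩ := exists_eq_pair h.card_middle hB
  obtain ⟨c, hc, rfl⟩ := exists_eq_pair h.card_right hC
  have ha' : a ∈ ({e₁, a} : Set (LaxVector GaussianInt)) := Or.inr rfl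
  have hb' : b ∈ ({e₂, b} : Set (LaxVector GaussianInt)) := Or.inr rfl
  have hc' : c ∈ ({e₃, c} : Set (LaxVector GaussianInt)) := Or.inr rfl
  rcases eq_of_isBasisPair ha hb hc (h.left_middle a ha' e₂ hB).symm
    (h.left_right a ha' e₃ hC).symm (h.left_middle e₁ hA b hb') (h.middle_right b hb' e₃ hC).symm
    (h.left_right e₁ hA c hc') (h.middle_right e₂ hB c hc') (h.left_middle a ha' b hb')
    (h.left_right a ha' c hc') (h.middle_right b hb' c hc') with ⟨rfl, rfl, rfl⟩ | ⟨rfl, rfl, rfl⟩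
  · exact Or.inl (Subtype.ext h.eq)
  · exact Or.inr (Subtype.ext (h.eq.trans coe_simple_three_smul_base.symm))

theorem isTopographPoint :
    IsTopographPoint type344 (fun P : LaxCubasis GaussianInt => ⋃₀ P.1) base where
  vec_smul g P := by
    change ⋃₀ ((fun s => g • s) '' P.1) = (fun a => g • a) '' (⋃₀ P.1)
    rw [Set.sUnion_eq_biUnion, Set.sUnion_eq_biUnion, Set.biUnion_image, Set.image_iUnion₂]
    rfl
  psl_smul g w h P := Subtype.ext (Set.image_congr fun s _ => Set.image_congr fun a _ => h a)
  e₁_mem := mem_sUnion_base_iff.mpr (by simp)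
  e₂_mem := mem_sUnion_base_iff.mpr (by simp)
  e₃_mem := mem_sUnion_base_iff.mpr (by simp)
  simple_smul i hi := simple_smul_base hi
  simple_three_smul h := by
    apply f₁'_notMem_base
    rw [← h, coe_simple_three_smul_base]
    exact ⟨_, Or.inl rfl, Or.inr rfl⟩
  exists_superbasis P := by
    obtain ⟨A, B, C, h⟩ := P.2.exists_isCubasisTriple
    obtain ⟨a, ha⟩ := h.exists_mem_left
    obtain ⟨b, hb⟩ := h.swap_left.exists_mem_left
    obtain ⟨c, hc⟩ := h.swap_right.swap_left.exists_mem_left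
    rw [h.eq]
    exact ⟨a, ⟨A, by simp, ha⟩, b, ⟨B, by simp, hb⟩, c, ⟨C, by simp, hc⟩, h.left_middle a ha b hb,
      h.left_right a ha c hc, h.middle_right b hb c hc⟩
  eq_or_eq _ := eq_base_or_eq
  exists_smul_eq_e₁ a ha := by
    have h := isReflectionAction
    have h0 : type344.simple 0 ∈ type344.parabolic {0, 1, 2} := simple_mem_parabolic _ (by simp)
    have h1 : type344.simple 1 ∈ type344.parabolic {0, 1, 2} := simple_mem_parabolic _ (by simp)
    have h2 : type344.simple 2 ∈ type344.parabolic {0, 1, 2} := simple_mem_parabolic _ (by simp)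
    have h012 := mul_mem (mul_mem h0 h1) h2
    rcases mem_sUnion_base_iff.mp ha with rfl | rfl | rfl | rfl | rfl | rfl
    · exact ⟨1, one_mem _, one_smul _ _⟩
    -- The word `s₀s₁s₂s₁s₀` follows the path `f₁ → f₂ → f₃ → e₃ → e₂ → e₁`; the other vectors enter
    -- this path at a later stage.
    · exact ⟨_, mul_mem (mul_mem h012 h1) h0, by
        simp only [mul_smul, simple_zero_smul_f₁, simple_one_smul_f₂, simple_two_smul_f₃,
          h.simple_one_smul_e₃, h.simple_zero_smul_e₂]⟩
    · exact ⟨_, h0, h.simple_zero_smul_e₂⟩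
    · exact ⟨_, mul_mem h012 h1, by
        simp only [mul_smul, simple_one_smul_f₂, simple_two_smul_f₃, h.simple_one_smul_e₃,
          h.simple_zero_smul_e₂]⟩
    · exact ⟨_, mul_mem h0 h1, by simp only [mul_smul, h.simple_one_smul_e₃, h.simple_zero_smul_e₂]⟩
    · exact ⟨_, h012, by
        simp only [mul_smul, simple_two_smul_f₃, h.simple_one_smul_e₃, h.simple_zero_smul_e₂]⟩
  exists_smul_eq_e₂ a ha h1a := by
    have h := isReflectionAction
    have h1 : type344.simple 1 ∈ type344.parabolic {1, 2} := simple_mem_parabolic _ (by simp)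
    have h2 : type344.simple 2 ∈ type344.parabolic {1, 2} := simple_mem_parabolic _ (by simp)
    rcases mem_sUnion_base_iff.mp ha with rfl | rfl | rfl | rfl | rfl | rfl
    · exact absurd rfl h1a.ne
    · exact absurd h1a not_isBasisPair_e₁_f₁
    · exact ⟨1, one_mem _, one_smul _ _⟩
    · exact ⟨_, mul_mem (mul_mem h1 h2) h1, by
        simp only [mul_smul, simple_one_smul_f₂, simple_two_smul_f₃, h.simple_one_smul_e₃]⟩
    · exact ⟨_, h1, h.simple_one_smul_e₃⟩
    · exact ⟨_, mul_mem h1 h2, by simp only [mul_smul, simple_two_smul_f₃, h.simple_one_smul_e₃]⟩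
  exists_smul_eq_e₃ a ha h1a h2a := by
    rcases mem_sUnion_base_iff.mp ha with rfl | rfl | rfl | rfl | rfl | rfl
    · exact absurd rfl h1a.ne
    · exact absurd h1a not_isBasisPair_e₁_f₁
    · exact absurd rfl h2a.ne
    · exact absurd h2a not_isBasisPair_e₂_f₂
    · exact ⟨1, one_mem _, one_smul _ _⟩
    · exact ⟨_, simple_mem_parabolic _ (by simp), simple_two_smul_f₃⟩

end GaussianInt

theorem exists_equivariantIso_gaussianTopograph :
    ∃ ι : PSL(2, GaussianInt) →* CoxeterMatrix.type344.Group,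
      Function.Injective ι ∧
      ι.range ≤ CoxeterMatrix.type344.evenSubgroup ∧
      ι.range.relIndex CoxeterMatrix.type344.evenSubgroup = 2 ∧
      Nonempty (gaussianTopograph.flags.EquivariantIso CoxeterMatrix.type344.geometry ι) :=
  GaussianInt.isTopographPoint.exists_equivariantIso _ GaussianInt.isTopographRing
    GaussianInt.isReflectionAction CoxeterMatrix.isCartan_cartan344
    CoxeterMatrix.type344_ne_zero

end

theorem mainTheorem1 :
    (∃ ι : PSL(2, EisensteinInt) →* CoxeterMatrix.type336.Group,
      Function.Injective ι ∧
      ι.range ≤ CoxeterMatrix.type336.evenSubgroup ∧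
      ι.range.relIndex CoxeterMatrix.type336.evenSubgroup = 2 ∧
      Nonempty (eisensteinTopograph.flags.EquivariantIso CoxeterMatrix.type336.geometry ι)) ∧
    (∃ ι : PSL(2, GaussianInt) →* CoxeterMatrix.type344.Group,
      Function.Injective ι ∧
      ι.range ≤ CoxeterMatrix.type344.evenSubgroup ∧
      ι.range.relIndex CoxeterMatrix.type344.evenSubgroup = 2 ∧
      Nonempty (gaussianTopograph.flags.EquivariantIso CoxeterMatrix.type344.geometry ι)) :=
  ⟨exists_equivariantIso_eisensteinTopograph, exists_equivariantIso_gaussianTopograph⟩
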